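/- **Setting.** Two bidders have types in $[0,1]$ (their valuations). A belief $P$ is a probability measure on $[0,1]^2$ with a positive density $f(\theta,\theta')$; write $F(z)=P\{\theta\le z\}$ for the marginal distribution function, $f_1(\theta)=\int_0^1 f(\theta,z)\,dz$ for the marginal density, and $P(d\theta'|\theta)=\frac{f(\theta,\theta')}{f_1(\theta)}\,d\theta'$ for the conditional distribution of the competitor's type. $P$ is *IID* if $P=Q\times Q$ for some probability measure $Q$; it is *symmetric* if $f(\theta,\theta')=f(\theta',\theta)$, and *affiliated* if $f(\theta,\theta')f(\varphi,\varphi')\le f(\max\{\theta,\varphi\},\max\{\theta',\varphi'\})\,f(\min\{\theta,\varphi\},\min\{\theta',\varphi'\})$ for all types. The auctions are the first-price auction (I), the second-price auction (II), the all-pay auction (A) and the war of attrition (W). A bidder who bids $a\in[0,\infty]$ against $b\in[0,\infty]$ wins with probability $s(a,b)=\mathbf 1[a>b]+\tfrac12\mathbf 1[a=b]$ and pays $a\,s(a,b)$ in I, $b\,s(a,b)$ in II, $a$ in A, and $\min\{a,b\}$ in W. A *symmetric increasing equilibrium* of an auction under $P$ is a non-decreasing $\beta:[0,1]\to[0,\infty]$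 such that, for every type $\theta$, the bid $\beta(\theta)$ maximizes, over all bids $a\in[0,\infty]$, $\theta$ times the probability of winning minus the expected payment, when the competitor's type is distributed according to $P(\cdot|\theta)$ and she bids according to $\beta$. The corresponding transfer $t(\theta,\theta')$ is the payment of a bidder who bids $\beta(\theta)$ against $\beta(\theta')$. For IID $P$ the transfers are those of the standard equilibria: $$b^{I}(\theta)=\theta-\int_0^\theta\frac{F(z)}{F(\theta)}dz,\quad b^{II}(\theta)=\theta,\quad b^{A}(\theta)=\theta F(\theta)-\int_0^\theta F(z)\,dz,\quad b^{W}(\theta)=\int_0^\theta\frac{z f_1(z)}{1-F(z)}dz,$$ (with $b^W(1)=\infty$), $t^{I}(\theta,\theta')=b^{I}(\theta)s(\theta,\theta')$, $t^{II}(\theta,\theta')=b^{II}(\theta')s(\theta,\theta')$, $t^{A}(\theta,\theta')=b^{A}(\theta)$, $t^{W}(\theta,\theta')=b^{W}(\theta')\mathbf 1[\theta>\theta']+b^{W}(\theta)\mathbf 1[\theta\le\theta']$. *WSCC* for $(X,Y)$: for every $\theta\in[0,1]$ there is $\hat\theta\in[0,1]$ such that for all $\theta'\in[0,1]$, $\theta'<\hat\theta$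 implies $t^X(\theta,\theta')\ge t^Y(\theta,\theta')$, and $\theta'>\hat\theta$ implies $t^X(\theta,\theta')\le t^Y(\theta,\theta')$. Let $e(\hat\theta,\theta)=\int t(\hat\theta,\theta')P(d\theta'|\theta)$ and $w(\hat\theta,\theta)=\int_0^{\hat\theta}t(\hat\theta,\theta')\frac{P(d\theta'|\theta)}{P([0,\hat\theta]|\theta)}$, and let $\partial_2$ be the partial derivative in the second argument (one-sided at $0$ and $1$). *LC1* for $(X,Y)$: for every $\theta\in[0,1]$, $e^X(\theta,\cdot)$ and $e^Y(\theta,\cdot)$ are finite, are differentiable at $\theta$, and satisfy $\partial_2e^X(\theta,\theta)\le\partial_2e^Y(\theta,\theta)$. *LC2* for $(X,Y)$: in both $X$ and $Y$ the loser pays nothing ($t(\theta,\theta')=0$ whenever $\theta<\theta'$) and, for every $\theta\in(0,1]$, $w^X(\theta,\cdot)$ and $w^Y(\theta,\cdot)$ are finite, are differentiable at $\theta$, and satisfy $\partial_2w^X(\theta,\theta)\le\partial_2w^Y(\theta,\theta)$. **Proposition.** Let $X\neq Y$ be two of the auctions I, II, A, W. The following are equivalent: (i) For every IID belief $P$ (in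 the case $\{X,Y\}=\{II,W\}$: for every IID belief $P$ such that $\theta f_1(\theta)/(1-F(\theta))$ is non-decreasing on $[0,1)$), $(X,Y)$ satisfies WSCC. (ii) For every symmetric and affiliated belief $P$ whose density is continuously differentiable on $[0,1]^2$, and for all symmetric increasing equilibria of $X$ and of $Y$ under $P$, $(X,Y)$ satisfies LC1 or LC2. Moreover, these conditions hold if and only if $(X,Y)$ is one of $(I,II)$, $(I,A)$, $(A,W)$, $(II,W)$, $(I,W)$. -/

import Mathlib

open MeasureTheory Set
open scoped ENNReal

noncomputable section

/-- The four sealed-bid auctions with two bidders. -/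
inductive Auction where
  | firstPrice : Auction
  | secondPrice : Auction
  | allPay : Auction
  | warOfAttrition : Auction

/-- A reference belief: a probability measure on `[0,1]²` with a positive density. Only the values
of `density` on `[0,1]²` matter. -/
structure Belief where
  density : ℝ → ℝ → ℝ
  measurable_density : Measurable (fun p : ℝ × ℝ => density p.1 p.2)
  density_pos : ∀ θ ∈ Icc (0 : ℝ) 1, ∀ θ' ∈ Icc (0 : ℝ) 1, 0 < density θ θ'
  total_mass : ∫⁻ p in Icc (0 : ℝ) 1 ×ˢ Icc (0 : ℝ) 1, ENNReal.ofReal (density p.1 p.2) = 1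

namespace Belief

/-- The probability measure itself. -/
def law (P : Belief) : Measure (ℝ × ℝ) :=
  (volume.restrict (Icc (0 : ℝ) 1 ×ˢ Icc (0 : ℝ) 1)).withDensity
    (fun p => ENNReal.ofReal (P.density p.1 p.2))

/-- The two types are independent and identically distributed. -/
def IsIID (P : Belief) : Prop :=
  ∃ Q : Measure ℝ, IsProbabilityMeasure Q ∧ P.law = Q.prod Q

def IsSymmetric (P : Belief) : Prop :=
  ∀ θ ∈ Icc (0 : ℝ) 1, ∀ θ' ∈ Icc (0 : ℝ) 1, P.density θ θ' = P.density θ' θ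

def IsAffiliated (P : Belief) : Prop :=
  ∀ θ ∈ Icc (0 : ℝ) 1, ∀ θ' ∈ Icc (0 : ℝ) 1, ∀ φ ∈ Icc (0 : ℝ) 1, ∀ φ' ∈ Icc (0 : ℝ) 1,
    P.density θ θ' * P.density φ φ' ≤
      P.density (max θ φ) (max θ' φ') * P.density (min θ φ) (min θ' φ')

/-- The density is continuously differentiable on the closed square. -/
def IsC1 (P : Belief) : Prop :=
  ContDiffOn ℝ 1 (fun p : ℝ × ℝ => P.density p.1 p.2) (Icc (0 : ℝ) 1 ×ˢ Icc (0 : ℝ) 1)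

/-- Marginal cumulative distribution function of the first type. -/
def cdf (P : Belief) (z : ℝ) : ℝ := (P.law {p | p.1 ≤ z}).toReal

/-- Marginal density of the first type. -/
def marginal (P : Belief) (θ : ℝ) : ℝ := ∫ z in Icc (0 : ℝ) 1, P.density θ z

/-- The conditional distribution of the competitor's type given one's own type `θ`. For symmetric
beliefs it does not depend on which bidder's type is `θ`. -/
def condLaw (P : Belief) (θ : ℝ) : Measure ℝ :=
  (volume.restrict (Icc (0 : ℝ) 1)).withDensity
    (fun z => ENNReal.ofReal (P.density θ z / P.marginal θ))

/-- `θ f(θ) / (1 - F(θ))` is non-decreasing in `θ`. -/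
def WeaklyIncreasingHazard (P : Belief) : Prop :=
  MonotoneOn (fun θ => θ * P.marginal θ / (1 - P.cdf θ)) (Ico (0 : ℝ) 1)

end Belief

/-- The share of the object won with `a` against `b`: the higher one wins, ties are split. -/
def winShare {α : Type*} [LinearOrder α] (a b : α) : ℝ≥0∞ :=
  if b < a then 1 else if a = b then 2⁻¹ else 0

/-! ### Equilibrium bids and transfers under IID beliefs

The values are extended non-negative reals because the bid of type `1` in the war of attrition is
infinite; all other bids are finite. -/

namespace Belief

def bidIID (P : Belief) : Auction → ℝ → ℝ≥0∞
  | .firstPrice, θ => ENNReal.ofReal (θ - ∫ z in (0 : ℝ)..θ, P.cdf z / P.cdf θ)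
  | .secondPrice, θ => ENNReal.ofReal θ
  | .allPay, θ => ENNReal.ofReal (θ * P.cdf θ - ∫ z in (0 : ℝ)..θ, P.cdf z)
  | .warOfAttrition, θ =>
      ∫⁻ z in Icc (0 : ℝ) θ, ENNReal.ofReal (z * P.marginal z / (1 - P.cdf z))

/-- The payment `t(θ, θ')` of a bidder of type `θ` against a competitor of type `θ'`; it is the
same function for both bidders. -/
def transferIID (P : Belief) : Auction → ℝ → ℝ → ℝ≥0∞
  | .firstPrice, θ, θ' => P.bidIID .firstPrice θ * winShare θ θ'
  | .secondPrice, θ, θ' => P.bidIID .secondPrice θ' * winShare θ θ'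
  | .allPay, θ, _ => P.bidIID .allPay θ
  | .warOfAttrition, θ, θ' =>
      if θ' < θ then P.bidIID .warOfAttrition θ' else P.bidIID .warOfAttrition θ

end Belief

/-- Weak Single-Crossing Condition for a pair of transfer functions on `[0,1]²`. -/
def WSCC (tX tY : ℝ → ℝ → ℝ≥0∞) : Prop :=
  ∀ θ ∈ Icc (0 : ℝ) 1, ∃ θhat ∈ Icc (0 : ℝ) 1, ∀ θ' ∈ Icc (0 : ℝ) 1,
    (θ' < θhat → tY θ θ' ≤ tX θ θ') ∧ (θhat < θ' → tX θ θ' ≤ tY θ θ')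

/-! ### The auctions as games, and their symmetric increasing equilibria -/

/-- The payment of a bidder who bids `a` against a competitor who bids `b`. -/
def Auction.payment : Auction → ℝ≥0∞ → ℝ≥0∞ → ℝ≥0∞
  | .firstPrice, a, b => a * winShare a b
  | .secondPrice, a, b => b * winShare a b
  | .allPay, a, _ => a
  | .warOfAttrition, a, b => min a b

/-- Interim expected payoff of type `θ` from the bid `a` when the competitor uses the strategy `β`.
The first term is at most `θ`, so the difference is never of the form `⊤ - ⊤`. -/
def interimPayoff (P : Belief) (X : Auction) (β : ℝ → ℝ≥0∞) (θ : ℝ) (a : ℝ≥0∞) : EReal :=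
  ((ENNReal.ofReal θ * ∫⁻ z, winShare a (β z) ∂(P.condLaw θ) : ℝ≥0∞) : EReal) -
    ((∫⁻ z, X.payment a (β z) ∂(P.condLaw θ) : ℝ≥0∞) : EReal)

/-- `β` is a non-decreasing strategy on `[0,1]` such that both bidders using `β` is a
Bayes–Nash equilibrium: for every type `θ`, the bid `β θ` is optimal among all bids. -/
def IsSymmetricIncreasingEquilibrium (P : Belief) (X : Auction) (β : ℝ → ℝ≥0∞) : Prop :=
  MonotoneOn β (Icc (0 : ℝ) 1) ∧
    ∀ θ ∈ Icc (0 : ℝ) 1, ∀ a : ℝ≥0∞, interimPayoff P X β θ a ≤ interimPayoff P X β θ (β θ)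

/-- The transfer function that the strategy `β` induces. -/
def Auction.transfer (X : Auction) (β : ℝ → ℝ≥0∞) (θ θ' : ℝ) : ℝ≥0∞ :=
  X.payment (β θ) (β θ')

/-! ### Linkage conditions -/

/-- `e(θhat, θ)`: expected payment of type `θ` who reports `θhat`. -/
def expectedPayment (P : Belief) (t : ℝ → ℝ → ℝ≥0∞) (θhat θ : ℝ) : ℝ≥0∞ :=
  ∫⁻ z, t θhat z ∂(P.condLaw θ)

/-- `w(θhat, θ)`: expected payment, conditional on winning, of type `θ` who reports `θhat`. -/
def expectedPaymentWin (P : Belief) (t : ℝ → ℝ → ℝ≥0∞) (θhat θ : ℝ) : ℝ≥0∞ :=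
  (∫⁻ z in Icc (0 : ℝ) θhat, t θhat z ∂(P.condLaw θ)) / P.condLaw θ (Icc (0 : ℝ) θhat)

/-- `∂₂ gX(θ, θ) ≤ ∂₂ gY(θ, θ)`; the functions are finite and the partial derivatives
(one-sided if `θ` is `0` or `1`) exist. -/
def PartialDerivLE (gX gY : ℝ → ℝ → ℝ≥0∞) (θ : ℝ) : Prop :=
  (∀ φ ∈ Icc (0 : ℝ) 1, gX θ φ ≠ ∞ ∧ gY θ φ ≠ ∞) ∧
  ∃ dX dY : ℝ,
    HasDerivWithinAt (fun φ => (gX θ φ).toReal) dX (Icc (0 : ℝ) 1) θ ∧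
    HasDerivWithinAt (fun φ => (gY θ φ).toReal) dY (Icc (0 : ℝ) 1) θ ∧
    dX ≤ dY

/-- Linkage Condition, version 1. -/
def LC1 (P : Belief) (tX tY : ℝ → ℝ → ℝ≥0∞) : Prop :=
  ∀ θ ∈ Icc (0 : ℝ) 1, PartialDerivLE (expectedPayment P tX) (expectedPayment P tY) θ

/-- The loser, who is the bidder with the lower type, pays nothing. -/
def LoserPaysNothing (t : ℝ → ℝ → ℝ≥0∞) : Prop :=
  ∀ θ ∈ Icc (0 : ℝ) 1, ∀ θ' ∈ Icc (0 : ℝ) 1, θ < θ' → t θ θ' = 0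

/-- Linkage Condition, version 2. The report `0` wins with probability zero, so the expectation
conditional on winning is meaningful for positive types only. -/
def LC2 (P : Belief) (tX tY : ℝ → ℝ → ℝ≥0∞) : Prop :=
  LoserPaysNothing tX ∧ LoserPaysNothing tY ∧
    ∀ θ ∈ Ioc (0 : ℝ) 1, PartialDerivLE (expectedPaymentWin P tX) (expectedPaymentWin P tY) θ

/-! ### The two conditions that are compared -/

/-- The pair `{X, Y}` consists of the second-price auction and the war of attrition. -/
def IsSecondPriceWarPair (X Y : Auction) : Prop :=
  (X = .secondPrice ∧ Y = .warOfAttrition) ∨ (X = .warOfAttrition ∧ Y = .secondPrice)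

/-- `(X, Y)` satisfies WSCC under every IID belief; for the pair of the second-price auction and
the war of attrition, under every IID belief with `θ f(θ) / (1 - F(θ))` non-decreasing. -/
def WSCCUnderIID (X Y : Auction) : Prop :=
  ∀ P : Belief, P.IsIID → (IsSecondPriceWarPair X Y → P.WeaklyIncreasingHazard) →
    WSCC (P.transferIID X) (P.transferIID Y)

/-- `(X, Y)` satisfies LC1 or LC2 under every symmetric affiliated belief with a continuously
differentiable density for which both auctions have symmetric increasing equilibria. -/
def LinkageUnderAffiliation (X Y : Auction) : Prop :=
  ∀ P : Belief, P.IsSymmetric → P.IsAffiliated → P.IsC1 → ∀ βX βY : ℝ → ℝ≥0∞,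
    IsSymmetricIncreasingEquilibrium P X βX → IsSymmetricIncreasingEquilibrium P Y βY →
      LC1 P (X.transfer βX) (Y.transfer βY) ∨ LC2 P (X.transfer βX) (Y.transfer βY)

end

noncomputable section

/-! ### Shares of the object -/

/-! Both conditions are shown to hold exactly for the five listed pairs; the equivalence follows by
comparing the two characterisations.

WSCC. The first-price transfer is non-increasing in the competitor's type, the all-pay transfer is
constant and the war-of-attrition transfer is non-decreasing, which settles (I,W) and (A,W). For
(I,A), `b^A = F b^I ≤ b^I` and a loser pays nothing in I. For (I,II), a winner pays `b^I(θ)` against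
`θ'`. For (II,W), a non-decreasing hazard term makes `b^W(z) - z` change sign at most once. The
other ordered pairs already fail for type `1/2` under the uniform belief.

Linkage, positive part. Affiliation is a monotone likelihood ratio property, so by Chebyshev's
inequality the conditional mean of a non-decreasing function rises with the conditioning type
(`IsC1.condMean_mono`). Hence the partial derivatives are ordered whenever `t^Y - t^X` is
non-decreasing in the competitor's type. This gives LC1 for (I,A), (I,W), (A,W), and LC2 for (I,II),
where only types below `θ` count. Equilibria are arbitrary here, so incentive constraints must first
yield what is needed: no flat pieces in I and W, truthful bids below type 1 in II, and a lower bound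
on the increments of bids in W.

The pair (II,W) is the hard one, as `t^W - t^II` need not be monotone. The function `B(z) =
hazardBid θ (min θ z)`, the war-of-attrition payment if all beliefs were those of type `θ`, is
placed in between. Equilibrium bids grow at least as fast as `B` below `θ`, because lower types
believe in higher hazard rates; so `t^W - B` is non-decreasing. By Tonelli, the means of `B` and
`t^II` agree under the belief of `θ`, and since hazard rates fall with the type, their difference
under the belief of `φ` has the sign of `φ - θ`.

Linkage, negative part. Under the affiliated density `2/3 (1 + 2θθ')` all four auctions have
explicit equilibria, and the derivative at `θ` of the expected payment has the sign of `∫ t(θ,z)(2z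
- 1) dz`. The signs of these integrals at `θ = 1/2` and `θ = 1` contradict LC1. LC2 fails because
losers pay in A and W, and for (II,I) because at `θ = 1` it gives the same inequality as LC1. -/

theorem winShare_of_lt {α : Type*} [LinearOrder α] {a b : α} (h : b < a) : winShare a b = 1 := by
  simp [winShare, h]

theorem winShare_of_gt {α : Type*} [LinearOrder α] {a b : α} (h : a < b) : winShare a b = 0 := by
  simp [winShare, h.not_gt, h.ne]

theorem winShare_self {α : Type*} [LinearOrder α] (a : α) : winShare a a = 2⁻¹ := by
  simp [winShare]

theorem winShare_le_one {α : Type*} [LinearOrder α] (a b : α) : winShare a b ≤ 1 := by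
  unfold winShare
  split_ifs <;> simp

theorem winShare_antitone {α : Type*} [LinearOrder α] (a : α) : Antitone (winShare a) := by
  intro b c hbc
  rcases lt_trichotomy a b with h | h | h
  · rw [winShare_of_gt h, winShare_of_gt (h.trans_le hbc)]
  · subst h
    rcases hbc.eq_or_lt with h' | h'
    · rw [h']
    · rw [winShare_of_gt h']; exact zero_le
  · rw [winShare_of_lt h]; exact winShare_le_one _ _

/-! ### Single crossing in the standard IID equilibria -/

/-- The threshold is the supremum of `S`, or `0` if `S` is empty, in which case no point of the
interval lies below it. -/
theorem exists_threshold {S : Set ℝ} (hS : S ⊆ Icc (0 : ℝ) 1) :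
    ∃ c ∈ Icc (0 : ℝ) 1, (∀ x ∈ Icc (0 : ℝ) 1, x < c → ∃ z ∈ S, x < z) ∧
      ∀ x, c < x → x ∉ S := by
  rcases S.eq_empty_or_nonempty with rfl | ⟨s, hs⟩
  · exact ⟨0, by simp, fun x hx h => absurd hx.1 (not_le.2 h), by simp⟩
  · have hb : BddAbove S := ⟨1, fun x hx => (hS hx).2⟩
    refine ⟨sSup S, ⟨(hS hs).1.trans (le_csSup hb hs), csSup_le ⟨s, hs⟩ fun x hx => (hS hx).2⟩,
      fun x _ h => exists_lt_of_lt_csSup ⟨s, hs⟩ h, fun x h hx => ?_⟩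
    exact absurd (le_csSup hb hx) (not_le.2 h)

/-- The set of competitors' types at which `tY ≤ tX` is downward closed, so its supremum serves as
the crossing point. -/
theorem WSCC.of_antitoneOn_of_monotoneOn {tX tY : ℝ → ℝ → ℝ≥0∞}
    (hX : ∀ θ ∈ Icc (0 : ℝ) 1, AntitoneOn (tX θ) (Icc 0 1))
    (hY : ∀ θ ∈ Icc (0 : ℝ) 1, MonotoneOn (tY θ) (Icc 0 1)) : WSCC tX tY := by
  intro θ hθ
  obtain ⟨c, hc, h1, h2⟩ := exists_threshold
    (S := {z | z ∈ Icc (0 : ℝ) 1 ∧ tY θ z ≤ tX θ z}) fun z hz => hz.1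
  refine ⟨c, hc, fun x hx => ⟨fun hxc => ?_, fun hxc => ?_⟩⟩
  · obtain ⟨z, ⟨hz, hle⟩, hxz⟩ := h1 x hx hxc
    exact (hY θ hθ hx hz hxz.le).trans (hle.trans (hX θ hθ hx hz hxz.le))
  · have := h2 x hxc
    simp only [mem_ofPred_eq, not_and, not_le] at this
    exact (this hx).le

namespace Belief

variable (P : Belief)

instance isProbabilityMeasure_law : IsProbabilityMeasure P.law :=
  ⟨by rw [law, withDensity_apply _ MeasurableSet.univ, Measure.restrict_univ]; exact P.total_mass⟩

theorem cdf_nonneg (z : ℝ) : 0 ≤ P.cdf z := ENNReal.toReal_nonneg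

theorem cdf_le_one (z : ℝ) : P.cdf z ≤ 1 := by
  have : P.law {p | p.1 ≤ z} ≤ 1 := prob_le_one
  simpa [cdf] using ENNReal.toReal_mono ENNReal.one_ne_top this

theorem bidIID_warOfAttrition_mono : Monotone (P.bidIID .warOfAttrition) := fun _ _ h =>
  lintegral_mono_set (Icc_subset_Icc_right h)

theorem transferIID_warOfAttrition (θ θ' : ℝ) :
    P.transferIID .warOfAttrition θ θ' = P.bidIID .warOfAttrition (min θ' θ) := by
  simp only [transferIID]
  split_ifs with h
  · rw [min_eq_left h.le]
  · rw [min_eq_right (not_lt.1 h)]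

theorem transferIID_warOfAttrition_mono (θ : ℝ) : Monotone (P.transferIID .warOfAttrition θ) := by
  intro x y h
  simp only [transferIID_warOfAttrition]
  exact P.bidIID_warOfAttrition_mono (min_le_min_right _ h)

theorem transferIID_firstPrice_antitone (θ : ℝ) : Antitone (P.transferIID .firstPrice θ) := by
  intro x y h
  exact mul_le_mul_right (winShare_antitone θ h) _

theorem wscc_firstPrice_warOfAttrition :
    WSCC (P.transferIID .firstPrice) (P.transferIID .warOfAttrition) :=
  .of_antitoneOn_of_monotoneOn (fun θ _ => (P.transferIID_firstPrice_antitone θ).antitoneOn _)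
    fun θ _ => (P.transferIID_warOfAttrition_mono θ).monotoneOn _

theorem wscc_allPay_warOfAttrition :
    WSCC (P.transferIID .allPay) (P.transferIID .warOfAttrition) :=
  .of_antitoneOn_of_monotoneOn (fun θ _ => (antitone_const (c := P.bidIID .allPay θ)).antitoneOn _)
    fun θ _ => (P.transferIID_warOfAttrition_mono θ).monotoneOn _

/-- The all-pay bid is the first-price bid times the probability of winning, `b^A = F b^I` with `F ≤
1`. If `F(θ) = 0`, the real expression for `b^A` is non-positive and is truncated to `0`. -/
theorem bidIID_allPay_le_firstPrice (θ : ℝ) (hθ : 0 ≤ θ) :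
    P.bidIID .allPay θ ≤ P.bidIID .firstPrice θ := by
  simp only [bidIID, intervalIntegral.integral_div]
  rcases (P.cdf_nonneg θ).eq_or_lt with h | h
  · rw [← h, mul_zero, ENNReal.ofReal_of_nonpos]
    · exact zero_le
    · linarith [intervalIntegral.integral_nonneg (μ := volume) hθ fun z _ => P.cdf_nonneg z]
  · have : θ * P.cdf θ - ∫ z in (0 : ℝ)..θ, P.cdf z
        = P.cdf θ * (θ - (∫ z in (0 : ℝ)..θ, P.cdf z) / P.cdf θ) := by
      field_simp
    rw [this, ENNReal.ofReal_mul h.le]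
    calc _ ≤ ENNReal.ofReal 1 * _ := by
          gcongr
          exact P.cdf_le_one θ
      _ = _ := by simp

theorem wscc_firstPrice_allPay : WSCC (P.transferIID .firstPrice) (P.transferIID .allPay) := by
  intro θ hθ
  refine ⟨θ, hθ, fun x _ => ⟨fun h => ?_, fun h => ?_⟩⟩
  · simpa [transferIID, winShare_of_lt h] using P.bidIID_allPay_le_firstPrice θ hθ.1
  · simp [transferIID, winShare_of_gt h]

/-- Both transfers carry the factor `winShare θ θ'`, which leaves `b^I(θ)` against `θ'`. The
crossing is therefore at `b^I(θ)`. -/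
theorem wscc_firstPrice_secondPrice :
    WSCC (P.transferIID .firstPrice) (P.transferIID .secondPrice) := by
  intro θ hθ
  set x := θ - ∫ z in (0 : ℝ)..θ, P.cdf z / P.cdf θ with hx
  have hx1 : x ≤ 1 := by
    have := intervalIntegral.integral_nonneg (μ := volume) hθ.1
      fun z _ => div_nonneg (P.cdf_nonneg z) (P.cdf_nonneg θ)
    linarith [hθ.2]
  refine ⟨max x 0, ⟨le_max_right _ _, max_le hx1 zero_le_one⟩, fun y hy => ⟨fun h => ?_, fun h => ?_⟩⟩
  · refine mul_le_mul_left (ENNReal.ofReal_le_ofReal ?_) _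
    rcases lt_max_iff.1 h with h | h
    · exact h.le
    · exact absurd hy.1 (not_le.2 h)
  · exact mul_le_mul_left (ENNReal.ofReal_le_ofReal ((le_max_left _ _).trans h.le)) _

variable {P}

/-- If `b^W(x) > x`, the integrand averages more than 1 on `[0,x]`. Being non-decreasing, it is at
least 1 from `x` on, so `b^W` stays ahead of the identity. -/
theorem WeaklyIncreasingHazard.lt_bidIID (hP : P.WeaklyIncreasingHazard) {x y : ℝ} (hx : 0 ≤ x)
    (hxy : x < y) (hy : y ≤ 1) (h : ENNReal.ofReal x < P.bidIID .warOfAttrition x) :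
    ENNReal.ofReal y < P.bidIID .warOfAttrition y := by
  set l : ℝ → ℝ≥0∞ := fun θ => ENNReal.ofReal (θ * P.marginal θ / (1 - P.cdf θ)) with hl
  have hmono : ∀ u v, 0 ≤ u → u ≤ v → v < 1 → l u ≤ l v := fun u v hu huv hv =>
    ENNReal.ofReal_le_ofReal (hP ⟨hu, huv.trans_lt hv⟩ ⟨hu.trans huv, hv⟩ huv)
  have hx1 : x < 1 := hxy.trans_le hy
  have hle : P.bidIID .warOfAttrition x ≤ l x * ENNReal.ofReal x := by
    calc ∫⁻ z in Icc 0 x, l z ≤ ∫⁻ z in Icc 0 x, l x :=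
          setLIntegral_mono measurable_const fun z hz => hmono z x hz.1 hz.2 hx1
      _ = _ := by simp
  have h1 : 1 ≤ l x := by
    by_contra hcon
    refine absurd (h.trans_le hle) (not_lt.2 ?_)
    calc l x * ENNReal.ofReal x ≤ 1 * ENNReal.ofReal x := by gcongr; exact (not_le.1 hcon).le
      _ = _ := one_mul _
  -- The open interval leaves out `y`, which may equal 1, where the hazard term is not controlled.
  have hadd : P.bidIID .warOfAttrition x + ENNReal.ofReal (y - x) ≤ P.bidIID .warOfAttrition y := by
    calc _ ≤ (∫⁻ z in Icc 0 x, l z) + ∫⁻ z in Ioo x y, l z := by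
          gcongr
          · exact le_rfl
          · calc ENNReal.ofReal (y - x) = ∫⁻ z in Ioo x y, 1 := by simp
              _ ≤ _ := setLIntegral_mono' measurableSet_Ioo fun z hz =>
                h1.trans (hmono x z hx hz.1.le (hz.2.trans_le hy))
      _ = ∫⁻ z in Icc 0 x ∪ Ioo x y, l z := by
          rw [lintegral_union measurableSet_Ioo]
          exact Set.disjoint_left.2 fun z hz hz' => absurd hz.2 (not_le.2 hz'.1)
      _ ≤ _ := lintegral_mono_set (union_subset (Icc_subset_Icc_right hxy.le)
          fun z hz => ⟨hx.trans hz.1.le, hz.2.le⟩)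
  refine lt_of_lt_of_le ?_ hadd
  calc ENNReal.ofReal y = ENNReal.ofReal x + ENNReal.ofReal (y - x) := by
        rw [← ENNReal.ofReal_add hx (by linarith)]; congr 1; ring
    _ < _ := ENNReal.add_lt_add_right ENNReal.ofReal_ne_top h

theorem WeaklyIncreasingHazard.wscc_secondPrice_warOfAttrition (hP : P.WeaklyIncreasingHazard) :
    WSCC (P.transferIID .secondPrice) (P.transferIID .warOfAttrition) := by
  intro θ hθ
  obtain ⟨c, hc, h1, h2⟩ := exists_threshold
    (S := {z | z ∈ Icc (0 : ℝ) 1 ∧ z < θ ∧ P.bidIID .warOfAttrition z ≤ ENNReal.ofReal z})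
    fun z hz => hz.1
  refine ⟨c, hc, fun x hx => ⟨fun hxc => ?_, fun hxc => ?_⟩⟩
  · obtain ⟨z, ⟨hz, hzθ, hle⟩, hxz⟩ := h1 x hx hxc
    rw [transferIID_warOfAttrition, min_eq_left (hxz.trans hzθ).le]
    simp only [transferIID, winShare_of_lt (hxz.trans hzθ), mul_one]
    by_contra hcon
    exact absurd (hP.lt_bidIID hx.1 hxz hz.2 (not_le.1 hcon)) (not_lt.2 hle)
  · have hout : ∀ z, c < z → z < θ → ENNReal.ofReal z < P.bidIID .warOfAttrition z := by
      intro z hz hzθ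
      have := h2 z hz
      simp only [mem_ofPred_eq, not_and, not_le] at this
      exact this ⟨hc.1.trans hz.le, hzθ.le.trans hθ.2⟩ hzθ
    rw [transferIID_warOfAttrition]
    rcases lt_trichotomy x θ with h | h | h
    · rw [min_eq_left h.le]
      simpa [transferIID, winShare_of_lt h, bidIID] using (hout x hxc h).le
    · subst h
      -- The tie lies outside the set that defines `c`, so the strict excess is carried up to it
      -- from a type in between.
      obtain ⟨z, hz, hzx⟩ := exists_between hxc
      have := hP.lt_bidIID (hc.1.trans hz.le) hzx hx.2 (hout z hz hzx)
      rw [min_self]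
      refine le_trans ?_ this.le
      calc _ ≤ ENNReal.ofReal x * 1 := mul_le_mul_right (winShare_le_one _ _) _
        _ = _ := mul_one _
    · simp [transferIID, winShare_of_gt h]

/-! ### The uniform belief -/

/-- Two independent types, each uniform on the unit interval. -/
def uniform : Belief where
  density _ _ := 1
  measurable_density := measurable_const
  density_pos _ _ _ _ := one_pos
  total_mass := by
    rw [ENNReal.ofReal_one, setLIntegral_one, Measure.volume_eq_prod, Measure.prod_prod]
    simp

theorem law_uniform :
    uniform.law = (volume.restrict (Icc (0 : ℝ) 1)).prod (volume.restrict (Icc (0 : ℝ) 1)) := by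
  rw [law, Measure.prod_restrict, ← Measure.volume_eq_prod]
  simp [uniform]

theorem isIID_uniform : uniform.IsIID :=
  ⟨volume.restrict (Icc (0 : ℝ) 1), ⟨by simp⟩, law_uniform⟩

theorem cdf_uniform {z : ℝ} (hz : z ∈ Icc (0 : ℝ) 1) : uniform.cdf z = z := by
  have : {p : ℝ × ℝ | p.1 ≤ z} = Iic z ×ˢ univ := by ext; simp
  rw [cdf, law_uniform, this, Measure.prod_prod, Measure.restrict_apply measurableSet_Iic]
  have : Iic z ∩ Icc 0 1 = Icc 0 z := by
    ext x
    simp only [mem_inter_iff, mem_Iic, mem_Icc]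
    exact ⟨fun h => ⟨h.2.1, h.1⟩, fun h => ⟨h.2, h.1, h.2.trans hz.2⟩⟩
  simp [this, hz.1]

theorem marginal_uniform (θ : ℝ) : uniform.marginal θ = 1 := by simp [marginal, uniform]

theorem weaklyIncreasingHazard_uniform : uniform.WeaklyIncreasingHazard := by
  intro x hx y hy hxy
  simp only [marginal_uniform, cdf_uniform ⟨hx.1, hx.2.le⟩, cdf_uniform ⟨hy.1, hy.2.le⟩]
  have := hx.2
  have := hy.2
  rw [div_le_div_iff₀ (by linarith) (by linarith)]
  nlinarith

theorem bidIID_firstPrice_uniform : uniform.bidIID .firstPrice (1 / 2) = ENNReal.ofReal (1 / 4) := by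
  have : ∫ z in (0 : ℝ)..(1 / 2), uniform.cdf z = ∫ z in (0 : ℝ)..(1 / 2), z := by
    refine intervalIntegral.integral_congr fun z hz => cdf_uniform ?_
    rw [uIcc_of_le (by norm_num)] at hz
    exact ⟨hz.1, hz.2.trans (by norm_num)⟩
  simp only [bidIID, intervalIntegral.integral_div, this, cdf_uniform (z := 1 / 2) (by norm_num)]
  rw [integral_id]
  norm_num

theorem bidIID_allPay_uniform : uniform.bidIID .allPay (1 / 2) = ENNReal.ofReal (1 / 8) := by
  have : ∫ z in (0 : ℝ)..(1 / 2), uniform.cdf z = ∫ z in (0 : ℝ)..(1 / 2), z := by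
    refine intervalIntegral.integral_congr fun z hz => cdf_uniform ?_
    rw [uIcc_of_le (by norm_num)] at hz
    exact ⟨hz.1, hz.2.trans (by norm_num)⟩
  simp only [bidIID, this, cdf_uniform (z := 1 / 2) (by norm_num)]
  rw [integral_id]
  norm_num

theorem bidIID_warOfAttrition_zero : P.bidIID .warOfAttrition 0 = 0 := by
  simp [bidIID]

theorem lt_bidIID_warOfAttrition_uniform :
    ENNReal.ofReal (1 / 8) < uniform.bidIID .warOfAttrition (1 / 2) := by
  -- The integrand `z / (1 - z)` is at least `z + z²`, whose integral over `[0, 1/2]` is `1/8 + 1/24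
  -- = 1/6`.
  have : ENNReal.ofReal (1 / 6) ≤ uniform.bidIID .warOfAttrition (1 / 2) := by
    calc ENNReal.ofReal (1 / 6) = ∫⁻ z in Icc (0 : ℝ) (1 / 2), ENNReal.ofReal (z + z ^ 2) := by
          rw [← ofReal_integral_eq_lintegral_ofReal]
          · rw [integral_Icc_eq_integral_Ioc, ← intervalIntegral.integral_of_le (by norm_num),
              intervalIntegral.integral_add (by simp) (by simp), integral_id, integral_pow]
            norm_num
          · exact (Continuous.continuousOn (by fun_prop)).integrableOn_Icc
          · filter_upwards [self_mem_ae_restrict measurableSet_Icc] with z hz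
            have := hz.1
            positivity
      _ ≤ _ := by
          refine setLIntegral_mono' measurableSet_Icc fun z hz => ENNReal.ofReal_le_ofReal ?_
          rw [marginal_uniform, cdf_uniform ⟨hz.1, hz.2.trans (by norm_num)⟩,
            le_div_iff₀ (by linarith [hz.2])]
          nlinarith [hz.1, hz.2, pow_nonneg hz.1 3]
  exact lt_of_lt_of_le ((ENNReal.ofReal_lt_ofReal_iff (by norm_num)).2 (by norm_num)) this

/-- The first transfer is smaller against some type and larger against some higher type. -/
theorem not_wscc_of_lt {tX tY : ℝ → ℝ → ℝ≥0∞} {θ x y : ℝ} (hθ : θ ∈ Icc (0 : ℝ) 1)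
    (hx : x ∈ Icc (0 : ℝ) 1) (hy : y ∈ Icc (0 : ℝ) 1) (hxy : x < y) (h1 : tX θ x < tY θ x)
    (h2 : tY θ y < tX θ y) : ¬ WSCC tX tY := by
  intro h
  obtain ⟨c, -, hc⟩ := h θ hθ
  rcases lt_or_ge x c with h | h
  · exact absurd ((hc x hx).1 h) (not_le.2 h1)
  · exact absurd ((hc y hy).2 (h.trans_lt hxy)) (not_le.2 h2)

theorem transferIID_firstPrice_uniform (x : ℝ) : uniform.transferIID .firstPrice (1 / 2) x
    = if x < 1 / 2 then ENNReal.ofReal (1 / 4) else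
      if 1 / 2 < x then 0 else ENNReal.ofReal (1 / 4) * 2⁻¹ := by
  rw [transferIID, bidIID_firstPrice_uniform]
  split_ifs with h h'
  · rw [winShare_of_lt h, mul_one]
  · rw [winShare_of_gt h', mul_zero]
  · rw [show x = 1 / 2 by linarith, winShare_self]

theorem transferIID_secondPrice_uniform (x : ℝ) : uniform.transferIID .secondPrice (1 / 2) x
    = if x < 1 / 2 then ENNReal.ofReal x else
      if 1 / 2 < x then 0 else ENNReal.ofReal (1 / 2) * 2⁻¹ := by
  rw [transferIID, bidIID]
  split_ifs with h h'
  · rw [winShare_of_lt h, mul_one]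
  · rw [winShare_of_gt h', mul_zero]
  · rw [show x = 1 / 2 by linarith, winShare_self]

theorem transferIID_allPay_uniform (x : ℝ) :
    uniform.transferIID .allPay (1 / 2) x = ENNReal.ofReal (1 / 8) := by
  rw [transferIID, bidIID_allPay_uniform]

theorem transferIID_warOfAttrition_uniform_zero :
    uniform.transferIID .warOfAttrition (1 / 2) 0 = 0 := by
  rw [transferIID_warOfAttrition, min_eq_left (by norm_num), bidIID_warOfAttrition_zero]

theorem lt_transferIID_warOfAttrition_uniform_one :
    ENNReal.ofReal (1 / 8) < uniform.transferIID .warOfAttrition (1 / 2) 1 := by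
  rw [transferIID_warOfAttrition, min_eq_right (by norm_num)]
  exact lt_bidIID_warOfAttrition_uniform

theorem transferIID_warOfAttrition_uniform_lt :
    uniform.transferIID .warOfAttrition (1 / 2) (1 / 4) < ENNReal.ofReal (1 / 4) := by
  rw [transferIID_warOfAttrition, min_eq_left (by norm_num)]
  -- On `[0, 1/4]` the integrand `z / (1 - z)` is at most `1/3`, so the bid is at most `1/12`.
  calc uniform.bidIID .warOfAttrition (1 / 4)
      ≤ ∫⁻ z in Icc (0 : ℝ) (1 / 4), ENNReal.ofReal (1 / 3) := by
        refine setLIntegral_mono' measurableSet_Icc fun z hz => ENNReal.ofReal_le_ofReal ?_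
        rw [marginal_uniform, cdf_uniform ⟨hz.1, hz.2.trans (by norm_num)⟩,
          div_le_iff₀ (by linarith [hz.2])]
        linarith [hz.2]
    _ = ENNReal.ofReal (1 / 3 * (1 / 4)) := by
        rw [ENNReal.ofReal_mul (by norm_num)]
        simp
    _ < _ := (ENNReal.ofReal_lt_ofReal_iff (by norm_num)).2 (by norm_num)

theorem wscc_uniform_of_wsccUnderIID {X Y : Auction} (h : WSCCUnderIID X Y) :
    WSCC (uniform.transferIID X) (uniform.transferIID Y) :=
  h uniform isIID_uniform fun _ => weaklyIncreasingHazard_uniform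

end Belief

/-! ### The pairs that satisfy WSCC -/

open Belief

/-- The pairs of auctions that both conditions single out. -/
def Auction.IsRankedPair (X Y : Auction) : Prop :=
  (X = .firstPrice ∧ Y = .secondPrice) ∨
  (X = .firstPrice ∧ Y = .allPay) ∨
  (X = .allPay ∧ Y = .warOfAttrition) ∨
  (X = .secondPrice ∧ Y = .warOfAttrition) ∨
  (X = .firstPrice ∧ Y = .warOfAttrition)

theorem wsccUnderIID_iff {X Y : Auction} (hXY : X ≠ Y) :
    WSCCUnderIID X Y ↔ X.IsRankedPair Y := by
  constructor
  · intro h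
    have h := wscc_uniform_of_wsccUnderIID h
    by_contra hcon
    revert h
    have h0 := transferIID_warOfAttrition_uniform_zero
    have h1 := lt_transferIID_warOfAttrition_uniform_one
    have h1' : 0 < uniform.transferIID .warOfAttrition (1 / 2) 1 := pos_of_gt h1
    -- Type `1/2` refutes all remaining pairs: she bids `1/4` in I and `1/8` in A, pays `θ'` when
    -- she wins in II and nothing when she loses in I or II, and in W pays `0` against type 0, less
    -- than `1/4` against type `1/4` and more than `1/8` against type 1. Each pair of points `x < y`
    -- below exhibits a crossing in the wrong direction.
    have key : ∀ x y, x ∈ Icc (0 : ℝ) 1 → y ∈ Icc (0 : ℝ) 1 → x < y →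
      uniform.transferIID X (1 / 2) x < uniform.transferIID Y (1 / 2) x →
      uniform.transferIID Y (1 / 2) y < uniform.transferIID X (1 / 2) y →
      ¬ WSCC (uniform.transferIID X) (uniform.transferIID Y) := fun x y hx hy hxy =>
        not_wscc_of_lt (by norm_num) hx hy hxy
    cases X <;> cases Y <;> simp [Auction.IsRankedPair] at hXY hcon
    · refine key 0 (1 / 3) (by simp) (by norm_num) (by norm_num) ?_ ?_ <;>
        rw [transferIID_firstPrice_uniform, transferIID_secondPrice_uniform,
          if_pos (by norm_num), if_pos (by norm_num)] <;>
        exact (ENNReal.ofReal_lt_ofReal_iff (by norm_num)).2 (by norm_num)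
    · refine key 0 (1 / 4) (by simp) (by norm_num) (by norm_num) ?_ ?_ <;>
        rw [transferIID_allPay_uniform, transferIID_secondPrice_uniform,
          if_pos (by norm_num)] <;>
        exact (ENNReal.ofReal_lt_ofReal_iff (by norm_num)).2 (by norm_num)
    · refine key 0 1 (by simp) (by norm_num) (by norm_num) ?_ ?_ <;>
        rw [transferIID_firstPrice_uniform, transferIID_allPay_uniform]
      · rw [if_pos (by norm_num)]
        exact (ENNReal.ofReal_lt_ofReal_iff (by norm_num)).2 (by norm_num)
      · rw [if_neg (by norm_num), if_pos (by norm_num)]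
        simp
    · refine key (1 / 4) 1 (by norm_num) (by norm_num) (by norm_num) ?_ ?_ <;>
        rw [transferIID_secondPrice_uniform, transferIID_allPay_uniform]
      · rw [if_pos (by norm_num)]
        exact (ENNReal.ofReal_lt_ofReal_iff (by norm_num)).2 (by norm_num)
      · rw [if_neg (by norm_num), if_pos (by norm_num)]
        simp
    · refine key 0 1 (by simp) (by norm_num) (by norm_num) ?_ ?_ <;>
        rw [transferIID_firstPrice_uniform]
      · rw [if_pos (by norm_num), h0]
        simp
      · rwa [if_neg (by norm_num), if_pos (by norm_num)]
    · refine key (1 / 4) 1 (by norm_num) (by norm_num) (by norm_num) ?_ ?_ <;>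
        rw [transferIID_secondPrice_uniform]
      · rw [if_pos (by norm_num)]
        exact transferIID_warOfAttrition_uniform_lt
      · rwa [if_neg (by norm_num), if_pos (by norm_num)]
    · refine key 0 1 (by simp) (by norm_num) (by norm_num) ?_ ?_ <;>
        rw [transferIID_allPay_uniform]
      · rw [h0]
        simp
      · exact h1
  · have hf : ∀ A B : Auction, (A = .firstPrice ∨ A = .allPay) → ¬ IsSecondPriceWarPair A B := by
      rintro A B (rfl | rfl) <;> simp [IsSecondPriceWarPair]
    rintro (⟨rfl, rfl⟩ | ⟨rfl, rfl⟩ | ⟨rfl, rfl⟩ | ⟨rfl, rfl⟩ | ⟨rfl, rfl⟩) P - hP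
    · exact P.wscc_firstPrice_secondPrice
    · exact P.wscc_firstPrice_allPay
    · exact P.wscc_allPay_warOfAttrition
    · exact (hP (Or.inl ⟨rfl, rfl⟩)).wscc_secondPrice_warOfAttrition
    · exact P.wscc_firstPrice_warOfAttrition

/-! ### Interim payoffs as extended non-negative reals -/

/-- The payment `p` of the deviation may be infinite; then the left side is `⊥` and the right side
holds because its upper bound is `⊤`. This moves incentive constraints to `ℝ≥0∞`, without
subtraction. -/
theorem EReal.coe_ennreal_sub_le_sub_iff {x p x' p' : ℝ≥0∞} (hx : x ≠ ∞) (hx' : x' ≠ ∞)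
    (hp' : p' ≠ ∞) : ((x : EReal) - p ≤ (x' : EReal) - p') ↔ x + p' ≤ x' + p := by
  lift x to NNReal using hx
  lift x' to NNReal using hx'
  lift p' to NNReal using hp'
  induction p with
  | top => simp [EReal.sub_top]
  | coe p =>
    have h1 : ∀ a b : NNReal, (((a : ℝ≥0∞) : EReal) - ((b : ℝ≥0∞) : EReal))
        = (((a : ℝ) - (b : ℝ) : ℝ) : EReal) := fun a b => by
      rw [EReal.coe_sub, EReal.coe_nnreal_eq_coe_real, EReal.coe_nnreal_eq_coe_real]
    rw [h1, h1, EReal.coe_le_coe_iff]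
    norm_cast
    rw [← NNReal.coe_le_coe]
    push_cast
    constructor <;> intro h <;> linarith

theorem measurable_winShare (a : ℝ≥0∞) : Measurable (winShare a) :=
  Measurable.ite measurableSet_Iio measurable_const
    (Measurable.ite (measurableSet_eq_fun measurable_const measurable_id)
      measurable_const measurable_const)

namespace Auction

theorem measurable_payment (X : Auction) (a : ℝ≥0∞) : Measurable (X.payment a) := by
  cases X
  · exact (measurable_winShare a).const_mul a
  · exact measurable_id.mul (measurable_winShare a)
  · exact measurable_const
  · exact measurable_const.min measurable_id

/-- The bid `0` is the outside option: it costs nothing in any of the auctions, so equilibrium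
payoffs are non-negative. -/
theorem payment_zero_left (X : Auction) (b : ℝ≥0∞) : X.payment 0 b = 0 := by
  cases X
  · simp [payment]
  · rcases eq_or_ne b 0 with rfl | h
    · simp [payment]
    · simp [payment, winShare_of_gt (pos_iff_ne_zero.2 h)]
  · rfl
  · simp [payment]

end Auction

namespace Belief

variable {P : Belief}

theorem measurable_density_right (P : Belief) (θ : ℝ) : Measurable (P.density θ) :=
  P.measurable_density.comp measurable_prodMk_left

/-! ### Beliefs with a continuous density -/

theorem IsC1.continuousOn (hP : P.IsC1) :
    ContinuousOn (fun p : ℝ × ℝ => P.density p.1 p.2) (Icc (0 : ℝ) 1 ×ˢ Icc (0 : ℝ) 1) :=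
  ContDiffOn.continuousOn hP

theorem IsC1.continuousOn_right (hP : P.IsC1) {θ : ℝ} (hθ : θ ∈ Icc (0 : ℝ) 1) :
    ContinuousOn (P.density θ) (Icc (0 : ℝ) 1) :=
  hP.continuousOn.comp (f := fun z => (θ, z)) (by fun_prop) fun _ hz => ⟨hθ, hz⟩

theorem IsC1.integrableOn (hP : P.IsC1) {θ : ℝ} (hθ : θ ∈ Icc (0 : ℝ) 1) {s : Set ℝ}
    (hs : s ⊆ Icc 0 1) : IntegrableOn (P.density θ) s :=
  (hP.continuousOn_right hθ).integrableOn_Icc.mono_set hs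

theorem IsC1.exists_bounds (hP : P.IsC1) : ∃ m M : ℝ, 0 < m ∧ 0 < M ∧
    ∀ θ ∈ Icc (0 : ℝ) 1, ∀ z ∈ Icc (0 : ℝ) 1, m ≤ P.density θ z ∧ P.density θ z ≤ M := by
  have hK : IsCompact (Icc (0 : ℝ) 1 ×ˢ Icc (0 : ℝ) 1) := isCompact_Icc.prod isCompact_Icc
  have hne : (Icc (0 : ℝ) 1 ×ˢ Icc (0 : ℝ) 1).Nonempty := ⟨(0, 0), by simp⟩
  obtain ⟨p, hp, hmin⟩ := hK.exists_isMinOn hne hP.continuousOn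
  obtain ⟨q, hq, hmax⟩ := hK.exists_isMaxOn hne hP.continuousOn
  exact ⟨_, _, P.density_pos p.1 hp.1 p.2 hp.2, P.density_pos q.1 hq.1 q.2 hq.2,
    fun θ hθ z hz => ⟨hmin (show (θ, z) ∈ _ from ⟨hθ, hz⟩), hmax (show (θ, z) ∈ _ from ⟨hθ, hz⟩)⟩⟩

theorem IsC1.setIntegral_pos (hP : P.IsC1) {θ : ℝ} (hθ : θ ∈ Icc (0 : ℝ) 1) {s : Set ℝ}
    (hm : MeasurableSet s) (hs : s ⊆ Icc 0 1) (hpos : 0 < volume s) :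
    0 < ∫ z in s, P.density θ z := by
  rw [setIntegral_pos_iff_support_of_nonneg_ae]
  · refine hpos.trans_le (measure_mono fun z hz => ⟨(P.density_pos θ hθ z (hs hz)).ne', hz⟩)
  · filter_upwards [self_mem_ae_restrict hm] with z hz using (P.density_pos θ hθ z (hs hz)).le
  · exact hP.integrableOn hθ hs

theorem IsC1.integral_Icc_pos (hP : P.IsC1) {θ : ℝ} (hθ : θ ∈ Icc (0 : ℝ) 1) {x y : ℝ}
    (hx : 0 ≤ x) (hxy : x < y) (hy : y ≤ 1) : 0 < ∫ z in Icc x y, P.density θ z :=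
  hP.setIntegral_pos hθ measurableSet_Icc (Icc_subset_Icc hx hy) (by simpa using hxy)

theorem IsC1.marginal_pos (hP : P.IsC1) {θ : ℝ} (hθ : θ ∈ Icc (0 : ℝ) 1) : 0 < P.marginal θ :=
  hP.integral_Icc_pos hθ le_rfl one_pos le_rfl

/-! ### Conditional laws -/

theorem lintegral_condLaw (P : Belief) (θ : ℝ) (g : ℝ → ℝ≥0∞) :
    ∫⁻ z, g z ∂(P.condLaw θ)
      = ∫⁻ z in Icc (0 : ℝ) 1, ENNReal.ofReal (P.density θ z / P.marginal θ) * g z := by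
  rw [condLaw, lintegral_withDensity_eq_lintegral_mul_non_measurable]
  · rfl
  · exact ((P.measurable_density_right θ).div_const _).ennreal_ofReal
  · simp

theorem setLIntegral_condLaw (P : Belief) (θ : ℝ) (g : ℝ → ℝ≥0∞) {s : Set ℝ}
    (hs : MeasurableSet s) (hs' : s ⊆ Icc 0 1) :
    ∫⁻ z in s, g z ∂(P.condLaw θ)
      = ∫⁻ z in s, ENNReal.ofReal (P.density θ z / P.marginal θ) * g z := by
  rw [condLaw, setLIntegral_withDensity_eq_setLIntegral_mul_non_measurable _ _ _ hs,
    Measure.restrict_restrict hs, inter_eq_left.2 hs']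
  · rfl
  · exact Filter.Eventually.of_forall fun _ => ENNReal.ofReal_lt_top
  · exact ((P.measurable_density_right θ).div_const _).ennreal_ofReal

theorem condLaw_apply (P : Belief) (θ : ℝ) {s : Set ℝ} (hs : MeasurableSet s)
    (hs' : s ⊆ Icc 0 1) :
    P.condLaw θ s = ∫⁻ z in s, ENNReal.ofReal (P.density θ z / P.marginal θ) := by
  rw [← setLIntegral_one, setLIntegral_condLaw P θ _ hs hs']
  simp

theorem condLaw_absolutelyContinuous (P : Belief) (θ : ℝ) :
    P.condLaw θ ≪ volume.restrict (Icc (0 : ℝ) 1) :=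
  withDensity_absolutelyContinuous _ _

theorem IsC1.condLaw_eq_ofReal (hP : P.IsC1) {θ : ℝ} (hθ : θ ∈ Icc (0 : ℝ) 1) {s : Set ℝ}
    (hs : MeasurableSet s) (hs' : s ⊆ Icc 0 1) :
    P.condLaw θ s = ENNReal.ofReal ((∫ z in s, P.density θ z) / P.marginal θ) := by
  rw [condLaw_apply P θ hs hs', ← integral_div, ofReal_integral_eq_lintegral_ofReal]
  · exact (hP.integrableOn hθ hs').div_const _
  · filter_upwards [self_mem_ae_restrict hs] with z hz
    exact div_nonneg (P.density_pos θ hθ z (hs' hz)).le (hP.marginal_pos hθ).le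

theorem IsC1.isProbabilityMeasure_condLaw (hP : P.IsC1) {θ : ℝ} (hθ : θ ∈ Icc (0 : ℝ) 1) :
    IsProbabilityMeasure (P.condLaw θ) := by
  constructor
  have h := hP.condLaw_eq_ofReal hθ measurableSet_Icc Subset.rfl
  have h' : P.condLaw θ (Icc 0 1)ᶜ = 0 :=
    condLaw_absolutelyContinuous P θ (by simp [Measure.restrict_apply measurableSet_Icc.compl])
  rw [← measure_add_measure_compl (measurableSet_Icc (a := (0 : ℝ)) (b := 1)), h, h']
  rw [show (∫ z in Icc (0 : ℝ) 1, P.density θ z) = P.marginal θ from rfl,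
    div_self (hP.marginal_pos hθ).ne']
  simp

theorem IsC1.absolutelyContinuous_condLaw (hP : P.IsC1) {θ : ℝ} (hθ : θ ∈ Icc (0 : ℝ) 1) :
    volume.restrict (Icc (0 : ℝ) 1) ≪ P.condLaw θ := by
  refine withDensity_absolutelyContinuous' ?_ ?_
  · exact ((P.measurable_density_right θ).div_const _).ennreal_ofReal.aemeasurable
  · filter_upwards [self_mem_ae_restrict measurableSet_Icc] with z hz
    exact (ENNReal.ofReal_pos.2 (div_pos (P.density_pos θ hθ z hz) (hP.marginal_pos hθ))).ne'

theorem IsC1.condLaw_Icc_pos (hP : P.IsC1) {θ : ℝ} (hθ : θ ∈ Icc (0 : ℝ) 1) {x y : ℝ}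
    (hx : 0 ≤ x) (hxy : x < y) (hy : y ≤ 1) : 0 < P.condLaw θ (Icc x y) := by
  rw [hP.condLaw_eq_ofReal hθ measurableSet_Icc (Icc_subset_Icc hx hy)]
  exact ENNReal.ofReal_pos.2 (div_pos (hP.integral_Icc_pos hθ hx hxy hy) (hP.marginal_pos hθ))

theorem ae_mem_Ioo_condLaw (P : Belief) (θ : ℝ) : ∀ᵐ z ∂(P.condLaw θ), z ∈ Ioo (0 : ℝ) 1 := by
  refine condLaw_absolutelyContinuous P θ ?_
  rw [← restrict_Ioo_eq_restrict_Icc]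
  exact self_mem_ae_restrict measurableSet_Ioo

theorem ae_ne_condLaw (P : Belief) (θ x : ℝ) : ∀ᵐ z ∂(P.condLaw θ), z ≠ x := by
  refine condLaw_absolutelyContinuous P θ (ae_restrict_of_ae ?_)
  exact Measure.ae_ne volume x

theorem aemeasurable_condLaw (P : Belief) (θ : ℝ) {β : ℝ → ℝ≥0∞} (hβ : MonotoneOn β (Icc 0 1)) :
    AEMeasurable β (P.condLaw θ) :=
  (aemeasurable_restrict_of_monotoneOn measurableSet_Icc hβ).mono_ac
    (condLaw_absolutelyContinuous P θ)

end Belief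

/-! ### Incentive constraints -/

namespace IsSymmetricIncreasingEquilibrium

variable {P : Belief} {X : Auction} {β : ℝ → ℝ≥0∞}

theorem monotoneOn (h : IsSymmetricIncreasingEquilibrium P X β) : MonotoneOn β (Icc 0 1) := h.1

theorem aemeasurable (h : IsSymmetricIncreasingEquilibrium P X β) (θ : ℝ) :
    AEMeasurable β (P.condLaw θ) := P.aemeasurable_condLaw θ h.1

theorem aemeasurable_winShare (h : IsSymmetricIncreasingEquilibrium P X β) (θ : ℝ) (a : ℝ≥0∞) :
    AEMeasurable (fun z => winShare a (β z)) (P.condLaw θ) :=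
  (measurable_winShare a).comp_aemeasurable (h.aemeasurable θ)

theorem aemeasurable_payment (h : IsSymmetricIncreasingEquilibrium P X β) (θ : ℝ) (a : ℝ≥0∞) :
    AEMeasurable (fun z => X.payment a (β z)) (P.condLaw θ) :=
  (X.measurable_payment a).comp_aemeasurable (h.aemeasurable θ)

end IsSymmetricIncreasingEquilibrium

theorem lintegral_winShare_le_one {P : Belief} (hP : P.IsC1) {θ : ℝ} (hθ : θ ∈ Icc (0 : ℝ) 1)
    (β : ℝ → ℝ≥0∞) (a : ℝ≥0∞) : ∫⁻ z, winShare a (β z) ∂(P.condLaw θ) ≤ 1 := by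
  have := hP.isProbabilityMeasure_condLaw hθ
  calc _ ≤ ∫⁻ z, 1 ∂(P.condLaw θ) := lintegral_mono fun z => winShare_le_one _ _
    _ = 1 := by simp

theorem ofReal_mul_lintegral_winShare_ne_top {P : Belief} (hP : P.IsC1) {θ : ℝ}
    (hθ : θ ∈ Icc (0 : ℝ) 1) (β : ℝ → ℝ≥0∞) (a : ℝ≥0∞) :
    ENNReal.ofReal θ * ∫⁻ z, winShare a (β z) ∂(P.condLaw θ) ≠ ∞ :=
  ENNReal.mul_ne_top ENNReal.ofReal_ne_top
    ((lintegral_winShare_le_one hP hθ β a).trans_lt ENNReal.one_lt_top).ne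

theorem interimPayoff_le_iff {P : Belief} (hP : P.IsC1) {X : Auction} {β : ℝ → ℝ≥0∞} {θ : ℝ}
    (hθ : θ ∈ Icc (0 : ℝ) 1) {a b : ℝ≥0∞} (hb : ∫⁻ z, X.payment b (β z) ∂(P.condLaw θ) ≠ ∞) :
    interimPayoff P X β θ a ≤ interimPayoff P X β θ b ↔
      ENNReal.ofReal θ * (∫⁻ z, winShare a (β z) ∂(P.condLaw θ))
          + ∫⁻ z, X.payment b (β z) ∂(P.condLaw θ)
        ≤ ENNReal.ofReal θ * (∫⁻ z, winShare b (β z) ∂(P.condLaw θ))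
          + ∫⁻ z, X.payment a (β z) ∂(P.condLaw θ) :=
  EReal.coe_ennreal_sub_le_sub_iff (ofReal_mul_lintegral_winShare_ne_top hP hθ β a)
    (ofReal_mul_lintegral_winShare_ne_top hP hθ β b) hb

namespace IsSymmetricIncreasingEquilibrium

variable {P : Belief} {X : Auction} {β : ℝ → ℝ≥0∞} {θ : ℝ}

/-- Individual rationality, from the deviation to the bid `0`. It also makes all equilibrium
payments finite. -/
theorem lintegral_payment_le (h : IsSymmetricIncreasingEquilibrium P X β) (hP : P.IsC1)
    (hθ : θ ∈ Icc (0 : ℝ) 1) : ∫⁻ z, X.payment (β θ) (β z) ∂(P.condLaw θ)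
      ≤ ENNReal.ofReal θ * ∫⁻ z, winShare (β θ) (β z) ∂(P.condLaw θ) := by
  have h0 := h.2 θ hθ 0
  have hx := ofReal_mul_lintegral_winShare_ne_top hP hθ β (β θ)
  unfold interimPayoff at h0
  simp only [Auction.payment_zero_left, lintegral_zero, EReal.coe_ennreal_zero, sub_zero] at h0
  have h1 := (EReal.coe_ennreal_nonneg _).trans h0
  rw [EReal.sub_nonneg (Or.inl (EReal.coe_ennreal_eq_top_iff.not.2 hx))
    (Or.inl (EReal.coe_ennreal_ne_bot _))] at h1
  exact_mod_cast h1

theorem lintegral_payment_ne_top (h : IsSymmetricIncreasingEquilibrium P X β) (hP : P.IsC1)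
    (hθ : θ ∈ Icc (0 : ℝ) 1) : ∫⁻ z, X.payment (β θ) (β z) ∂(P.condLaw θ) ≠ ∞ :=
  ((h.lintegral_payment_le hP hθ).trans_lt
    (ofReal_mul_lintegral_winShare_ne_top hP hθ β (β θ)).lt_top).ne

theorem incentive (h : IsSymmetricIncreasingEquilibrium P X β) (hP : P.IsC1)
    (hθ : θ ∈ Icc (0 : ℝ) 1) (a : ℝ≥0∞) :
    ENNReal.ofReal θ * (∫⁻ z, winShare a (β z) ∂(P.condLaw θ))
          + ∫⁻ z, X.payment (β θ) (β z) ∂(P.condLaw θ)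
        ≤ ENNReal.ofReal θ * (∫⁻ z, winShare (β θ) (β z) ∂(P.condLaw θ))
          + ∫⁻ z, X.payment a (β z) ∂(P.condLaw θ) :=
  (interimPayoff_le_iff hP hθ (h.lintegral_payment_ne_top hP hθ)).1 (h.2 θ hθ a)

end IsSymmetricIncreasingEquilibrium

/-! ### Comparison of bids, and strict monotonicity of equilibrium strategies -/

theorem winShare_mono_left {α : Type*} [LinearOrder α] {a a' : α} (h : a ≤ a') (b : α) :
    winShare a b ≤ winShare a' b := by
  rcases lt_trichotomy a b with h' | rfl | h'
  · rw [winShare_of_gt h']; exact zero_le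
  · rcases h.eq_or_lt with rfl | h
    · exact le_rfl
    · rw [winShare_of_lt h]; exact winShare_le_one _ _
  · rw [winShare_of_lt h', winShare_of_lt (h'.trans_le h)]

theorem inv_two_le_winShare_top (b : ℝ≥0∞) : 2⁻¹ ≤ winShare ∞ b := by
  rcases eq_or_ne b ∞ with rfl | h
  · rw [winShare_self]
  · rw [winShare_of_lt h.lt_top]; simp

/-- In the second-price auction, with value `c` and competing bid `b`, a bid `B` yields `(c - b)
s(B,b)`. If `b` lies between `c` and `B`, then `B` wins at a loss or forgoes a gain, at least with
probability one half. The inequality is stated without subtraction. -/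
theorem mul_winShare_add_lt {c B b : ℝ≥0∞} (hc : c ≠ ∞) (h : c < b ∧ b ≤ B ∨ B ≤ b ∧ b < c) :
    c * winShare B b + b * winShare c b < c * winShare c b + b * winShare B b := by
  rcases h with ⟨h, hB⟩ | ⟨hB, h⟩
  · rw [winShare_of_gt h, mul_zero, mul_zero, add_zero, zero_add]
    refine (ENNReal.mul_lt_mul_iff_left ?_ ?_).2 h
    · rcases hB.eq_or_lt with rfl | hB
      · simp [winShare_self]
      · simp [winShare_of_lt hB]
    · exact ((winShare_le_one _ _).trans_lt ENNReal.one_lt_top).ne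
  · have hw : winShare B b < 1 := by
      rcases hB.eq_or_lt with rfl | hB
      · simp [winShare_self]
      · simp [winShare_of_gt hB]
    rw [winShare_of_lt h]
    generalize winShare B b = w at hw
    lift c to NNReal using hc
    lift b to NNReal using h.ne_top
    lift w to NNReal using hw.ne_top
    norm_cast at *
    rw [← NNReal.coe_lt_coe] at *
    push_cast at *
    nlinarith

theorem mul_winShare_add_le {c : ℝ≥0∞} (hc : c ≠ ∞) (B b : ℝ≥0∞) :
    c * winShare B b + b * winShare c b ≤ c * winShare c b + b * winShare B b := by
  by_cases h : c < b ∧ b ≤ B ∨ B ≤ b ∧ b < c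
  · exact (mul_winShare_add_lt hc h).le
  push Not at h
  rcases lt_trichotomy b c with hb | rfl | hb
  · have : b < B := by
      by_contra hcon
      exact absurd hb (not_lt.2 (h.2 (not_lt.1 hcon)))
    rw [winShare_of_lt hb, winShare_of_lt this]
  · rw [add_comm]
  · rw [winShare_of_gt hb, winShare_of_gt (h.1 hb)]

namespace IsSymmetricIncreasingEquilibrium

variable {P : Belief} {β : ℝ → ℝ≥0∞}

theorem ne_top_firstPrice (h : IsSymmetricIncreasingEquilibrium P .firstPrice β) (hP : P.IsC1)
    {θ : ℝ} (hθ : θ ∈ Icc (0 : ℝ) 1) : β θ ≠ ∞ := by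
  intro htop
  have := hP.isProbabilityMeasure_condLaw hθ
  refine h.lintegral_payment_ne_top hP hθ (top_le_iff.1 ?_)
  calc ∞ = ∫⁻ z, ∞ ∂(P.condLaw θ) := by simp
    _ ≤ _ := lintegral_mono fun z => by
      rw [htop, Auction.payment, ENNReal.top_mul]
      exact (lt_of_lt_of_le (by simp) (inv_two_le_winShare_top (β z))).ne'

/-- Bids are constant on `[x,y]`, so these competitors are tied with; any overbid turns the half
share against them into a full one. -/
theorem lintegral_winShare_add_le (hβ : MonotoneOn β (Icc 0 1)) {θ x y : ℝ}
    (hx : x ∈ Icc (0 : ℝ) 1) (hy : y ∈ Icc (0 : ℝ) 1) (hxy : β x = β y)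
    (hb : β x ≠ ∞) {ε : ℝ≥0∞} (hε : 0 < ε) :
    (∫⁻ z, winShare (β x) (β z) ∂(P.condLaw θ)) + 2⁻¹ * P.condLaw θ (Icc x y)
      ≤ ∫⁻ z, winShare (β x + ε) (β z) ∂(P.condLaw θ) := by
  have hlt : β x < β x + ε := ENNReal.lt_add_right hb hε.ne'
  rw [← setLIntegral_const, ← lintegral_indicator measurableSet_Icc,
    ← lintegral_add_right _ (measurable_const.indicator measurableSet_Icc)]
  refine lintegral_mono fun z => ?_
  by_cases hz : z ∈ Icc x y
  · have hz' : z ∈ Icc (0 : ℝ) 1 := ⟨hx.1.trans hz.1, hz.2.trans hy.2⟩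
    have : β z = β x := le_antisymm ((hβ hz' hy hz.2).trans hxy.ge) (hβ hx hz' hz.1)
    simp only [hz, indicator_of_mem, this, winShare_self, winShare_of_lt hlt]
    rw [ENNReal.inv_two_add_inv_two]
  · simp only [hz, not_false_eq_true, indicator_of_notMem, add_zero]
    exact winShare_mono_left hlt.le _

/-- A flat piece would be a tie of positive probability, broken at vanishing cost by the type at its
upper end, who makes a positive profit from winning. -/
theorem strictMonoOn_firstPrice (h : IsSymmetricIncreasingEquilibrium P .firstPrice β)
    (hP : P.IsC1) : StrictMonoOn β (Icc 0 1) := by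
  intro x hx y hy hxy
  refine lt_of_le_of_ne (h.1 hx hy hxy.le) fun heq => ?_
  have hb := h.ne_top_firstPrice hP hx
  have hm := hP.condLaw_Icc_pos hy hx.1 hxy hy.2
  have hpay : ∀ θ a, a ≠ ∞ → ∫⁻ z, Auction.firstPrice.payment a (β z) ∂(P.condLaw θ)
      = a * ∫⁻ z, winShare a (β z) ∂(P.condLaw θ) := fun θ a ha => lintegral_const_mul' _ _ ha
  -- the bid is at most the lower type, who would otherwise lose money
  have h1 : β x ≤ ENNReal.ofReal x := by
    have h1 := h.lintegral_payment_le hP hx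
    rw [hpay x _ hb] at h1
    refine (ENNReal.mul_le_mul_iff_left ?_ ?_).1 h1
    · refine (lt_of_lt_of_le ?_ (lintegral_mono (f := (Icc x y).indicator fun _ => 2⁻¹) ?_)).ne'
      · rw [lintegral_indicator measurableSet_Icc, setLIntegral_const]
        exact ENNReal.mul_pos (by simp) (hP.condLaw_Icc_pos hx hx.1 hxy hy.2).ne'
      · intro z
        by_cases hz : z ∈ Icc x y
        · have hz' : z ∈ Icc (0 : ℝ) 1 := ⟨hx.1.trans hz.1, hz.2.trans hy.2⟩
          have : β z = β x := le_antisymm ((h.1 hz' hy hz.2).trans heq.ge) (h.1 hx hz' hz.1)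
          simp [hz, this, winShare_self]
        · simp [hz]
    · exact ((lintegral_winShare_le_one hP hx β _).trans_lt ENNReal.one_lt_top).ne
  -- so the higher type gains by overbidding slightly
  have h2 : ∀ ε : ℝ, 0 < ε →
      (y - (β x).toReal) * (2⁻¹ * (P.condLaw y (Icc x y)).toReal) ≤ ε := by
    intro ε hε
    have hε' : 0 < ENNReal.ofReal ε := ENNReal.ofReal_pos.2 hε
    have hinc := h.incentive hP hy (β x + ENNReal.ofReal ε)
    have htie := lintegral_winShare_add_le (P := P) (θ := y) h.1 hx hy heq hb hε'
    have hw'1 := lintegral_winShare_le_one hP hy β (β x + ENNReal.ofReal ε)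
    have hw1 := lintegral_winShare_le_one hP hy β (β x)
    rw [hpay _ _ (ENNReal.add_ne_top.2 ⟨hb, ENNReal.ofReal_ne_top⟩), ← heq, hpay _ _ hb] at hinc
    have := hP.isProbabilityMeasure_condLaw hy
    have hm1 : P.condLaw y (Icc x y) ≠ ∞ := measure_ne_top _ _
    generalize (∫⁻ z, winShare (β x) (β z) ∂(P.condLaw y)) = w at *
    generalize (∫⁻ z, winShare (β x + ENNReal.ofReal ε) (β z) ∂(P.condLaw y)) = w' at *
    generalize P.condLaw y (Icc x y) = m at *
    have hyb : (β x).toReal ≤ y :=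
      (ENNReal.toReal_le_of_le_ofReal hx.1 h1).trans hxy.le
    generalize β x = b at *
    lift b to NNReal using hb
    lift w to NNReal using (hw1.trans_lt ENNReal.one_lt_top).ne
    lift w' to NNReal using (hw'1.trans_lt ENNReal.one_lt_top).ne
    lift m to NNReal using hm1
    have e1 : (w : ℝ) + 2⁻¹ * m ≤ w' := by
      have := ENNReal.toReal_mono (by simp) htie
      rw [ENNReal.toReal_add (by simp) (by finiteness)] at this
      simpa using this
    have e2 : y * w' + b * w ≤ y * w + (b + ε) * w' := by
      have := ENNReal.toReal_mono (by finiteness) hinc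
      rw [ENNReal.toReal_add (by finiteness) (by finiteness),
        ENNReal.toReal_add (by finiteness) (by finiteness)] at this
      simp only [ENNReal.toReal_mul, ENNReal.toReal_ofReal hy.1, ENNReal.coe_toReal] at this
      rw [ENNReal.toReal_add (by simp) (by simp), ENNReal.toReal_ofReal hε.le] at this
      simpa using this
    have e3 : (w' : ℝ) ≤ 1 := by exact_mod_cast hw'1
    -- With bid `b` and tie mass `m`: `(y - b) m/2 ≤ (y - b)(w' - w) ≤ ε w' ≤ ε`.
    simp only [ENNReal.coe_toReal] at *
    nlinarith [mul_le_mul_of_nonneg_left e1 (sub_nonneg.2 hyb), mul_le_mul_of_nonneg_left e3 hε.le]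
  have hyb : (β x).toReal < y := (ENNReal.toReal_le_of_le_ofReal hx.1 h1).trans_lt hxy
  have := hP.isProbabilityMeasure_condLaw hy
  have hpos : 0 < (y - (β x).toReal) * (2⁻¹ * (P.condLaw y (Icc x y)).toReal) :=
    mul_pos (sub_pos.2 hyb) (mul_pos (by norm_num) (ENNReal.toReal_pos hm.ne' (measure_ne_top _ _)))
  linarith [h2 _ (half_pos hpos)]

/-- Raising the bid by `ε` costs at most `ε` in the war of attrition, but breaks ties worth `y/2`
times their probability. No upper bound on the bid by the type is needed. -/
theorem strictMonoOn_warOfAttrition (h : IsSymmetricIncreasingEquilibrium P .warOfAttrition β)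
    (hP : P.IsC1) : StrictMonoOn β (Icc 0 1) := by
  intro x hx y hy hxy
  refine lt_of_le_of_ne (h.1 hx hy hxy.le) fun heq => ?_
  have := hP.isProbabilityMeasure_condLaw hy
  have hm := hP.condLaw_Icc_pos hy hx.1 hxy hy.2
  have hfin := h.lintegral_payment_ne_top hP hy
  -- A flat piece at `∞` would make type `y` pay `∞` with positive probability.
  have hb : β x ≠ ∞ := by
    intro htop
    refine hfin (top_le_iff.1 ?_)
    calc ∞ = ∫⁻ z, (Icc x y).indicator (fun _ => ∞) z ∂(P.condLaw y) := by
          rw [lintegral_indicator measurableSet_Icc, setLIntegral_const, ENNReal.top_mul hm.ne']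
      _ ≤ _ := lintegral_mono fun z => ?_
    by_cases hz : z ∈ Icc x y
    · have := h.1 hx ⟨hx.1.trans hz.1, hz.2.trans hy.2⟩ hz.1
      rw [htop, top_le_iff] at this
      simp [Auction.payment, ← heq, htop, this]
    · simp [hz]
  have h2 : ∀ ε : ℝ≥0∞, 0 < ε →
      ENNReal.ofReal y * (2⁻¹ * P.condLaw y (Icc x y)) ≤ ε := by
    intro ε hε
    have hinc := h.incentive hP hy (β x + ε)
    have htie := lintegral_winShare_add_le (P := P) (θ := y) h.1 hx hy heq hb hε
    have hpay : ∫⁻ z, Auction.warOfAttrition.payment (β x + ε) (β z) ∂(P.condLaw y)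
        ≤ (∫⁻ z, Auction.warOfAttrition.payment (β x) (β z) ∂(P.condLaw y)) + ε := by
      calc _ ≤ ∫⁻ z, (Auction.warOfAttrition.payment (β x) (β z) + ε) ∂(P.condLaw y) := by
            refine lintegral_mono fun z => ?_
            simp only [Auction.payment]
            rw [min_add]
            exact min_le_min_left _ le_self_add
        _ = _ := by rw [lintegral_add_right _ measurable_const]; simp
    rw [← heq] at hinc hfin
    refine (ENNReal.add_le_add_iff_left (ENNReal.add_ne_top.2
      ⟨ofReal_mul_lintegral_winShare_ne_top hP hy β (β x), hfin⟩)).1 ?_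
    calc _ = ENNReal.ofReal y * ((∫⁻ z, winShare (β x) (β z) ∂(P.condLaw y))
              + 2⁻¹ * P.condLaw y (Icc x y))
            + ∫⁻ z, Auction.warOfAttrition.payment (β x) (β z) ∂(P.condLaw y) := by ring
      _ ≤ _ := by gcongr
      _ ≤ _ := hinc
      _ ≤ _ := add_le_add le_rfl hpay
      _ = _ := by ring
  have hpos : ENNReal.ofReal y * (2⁻¹ * P.condLaw y (Icc x y)) ≠ 0 :=
    mul_ne_zero (ENNReal.ofReal_pos.2 (hx.1.trans_lt hxy)).ne' (mul_ne_zero (by simp) hm.ne')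
  have hfin₂ : ENNReal.ofReal y * (2⁻¹ * P.condLaw y (Icc x y)) ≠ ∞ := by
    have := measure_ne_top (P.condLaw y) (Icc x y)
    finiteness
  exact absurd (h2 _ (ENNReal.half_pos hpos)) (not_le.2 (ENNReal.half_lt_self hpos hfin₂))

/-! ### Truthful bidding in the second-price auction -/

/-- Bidding one's type is weakly better against every competing bid, yet not better on average than
`β z`. Hence it is almost surely not strictly better, and competing bids almost surely avoid the gap
between type and bid. -/
theorem ae_secondPrice (h : IsSymmetricIncreasingEquilibrium P .secondPrice β) (hP : P.IsC1)
    {z : ℝ} (hz : z ∈ Icc (0 : ℝ) 1) : ∀ᵐ y ∂(P.condLaw z),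
      ¬ (ENNReal.ofReal z < β y ∧ β y ≤ β z ∨ β z ≤ β y ∧ β y < ENNReal.ofReal z) := by
  have := hP.isProbabilityMeasure_condLaw hz
  have hm := h.aemeasurable_winShare z
  have hm' := h.aemeasurable_payment z
  have hinc := h.incentive hP hz (ENNReal.ofReal z)
  rw [← lintegral_const_mul'' _ (hm _), ← lintegral_const_mul'' _ (hm _),
    ← lintegral_add_left' ((hm _).const_mul _), ← lintegral_add_left' ((hm _).const_mul _)] at hinc
  have heq := ae_eq_of_ae_le_of_lintegral_le
    (Filter.Eventually.of_forall fun y => mul_winShare_add_le (ENNReal.ofReal_ne_top (r := z))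
      (β z) (β y)) ?_ (((hm _).const_mul _).add (hm' _)) hinc
  · filter_upwards [heq] with y hy hcon
    exact (mul_winShare_add_lt ENNReal.ofReal_ne_top hcon).ne hy
  · refine (lt_of_le_of_lt (b := ∫⁻ _, (ENNReal.ofReal z + ENNReal.ofReal z) ∂(P.condLaw z))
      (lintegral_mono fun y => ?_) ?_).ne
    · gcongr
      · calc _ ≤ ENNReal.ofReal z * 1 := by gcongr; exact winShare_le_one _ _
          _ = _ := mul_one _
      · rcases le_or_gt (β y) (ENNReal.ofReal z) with hy | hy
        · calc _ ≤ ENNReal.ofReal z * 1 := by gcongr; exact winShare_le_one _ _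
            _ = _ := mul_one _
        · simp [winShare_of_gt hy]
    · simp

/-- The density is positive, so an almost sure event meets every interval of types. -/
theorem exists_mem_Ioo_of_ae_condLaw (hP : P.IsC1) {θ : ℝ} (hθ : θ ∈ Icc (0 : ℝ) 1)
    {p : ℝ → Prop} (h : ∀ᵐ y ∂(P.condLaw θ), p y) {x y : ℝ} (hx : 0 ≤ x) (hxy : x < y)
    (hy : y ≤ 1) : ∃ z ∈ Ioo x y, p z := by
  have h1 : ∀ᵐ z ∂(volume.restrict (Ioo x y)), p z :=
    ae_restrict_of_ae_restrict_of_subset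
      (Ioo_subset_Icc_self.trans (Icc_subset_Icc hx hy))
      ((hP.absolutelyContinuous_condLaw hθ).ae_le h)
  have : (ae (volume.restrict (Ioo x y))).NeBot := by
    rw [ae_neBot, Ne, Measure.restrict_eq_zero]
    simpa using hxy
  have h0 : ∀ᵐ z ∂(volume.restrict (Ioo x y)), z ∈ Ioo x y := self_mem_ae_restrict measurableSet_Ioo
  exact (h0.and h1).exists

/-- Some type `x` between `y` and `z` bids outside `(z, β z]`. By monotonicity `β x ≤ β z`, so `β x
≤ z`, and `y` bids no more than `x`. -/
theorem le_of_lt_secondPrice (h : IsSymmetricIncreasingEquilibrium P .secondPrice β)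
    (hP : P.IsC1) {y z : ℝ} (hy : y ∈ Icc (0 : ℝ) 1) (hz : z ∈ Icc (0 : ℝ) 1) (hyz : y < z) :
    β y ≤ ENNReal.ofReal z := by
  obtain ⟨x, hx, hxn⟩ := exists_mem_Ioo_of_ae_condLaw hP hz (h.ae_secondPrice hP hz) hy.1 hyz hz.2
  push Not at hxn
  have hx' : x ∈ Icc (0 : ℝ) 1 := ⟨hy.1.trans hx.1.le, hx.2.le.trans hz.2⟩
  refine (h.1 hy hx' hx.1.le).trans (not_lt.1 fun hcon => ?_)
  exact absurd (h.1 hx' hz hx.2.le) (not_le.2 (hxn.1 hcon))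

theorem le_of_gt_secondPrice (h : IsSymmetricIncreasingEquilibrium P .secondPrice β)
    (hP : P.IsC1) {y z : ℝ} (hy : y ∈ Icc (0 : ℝ) 1) (hz : z ∈ Icc (0 : ℝ) 1) (hyz : z < y) :
    ENNReal.ofReal z ≤ β y := by
  obtain ⟨x, hx, hxn⟩ := exists_mem_Ioo_of_ae_condLaw hP hz (h.ae_secondPrice hP hz) hz.1 hyz hy.2
  push Not at hxn
  have hx' : x ∈ Icc (0 : ℝ) 1 := ⟨hz.1.trans hx.1.le, hx.2.le.trans hy.2⟩
  exact (hxn.2 (h.1 hz hx' hx.1.le)).trans (h.1 hx' hy hx.2.le)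

theorem ofReal_le_secondPrice (h : IsSymmetricIncreasingEquilibrium P .secondPrice β)
    (hP : P.IsC1) {z : ℝ} (hz : z ∈ Icc (0 : ℝ) 1) : ENNReal.ofReal z ≤ β z := by
  by_contra! hcon
  obtain ⟨c, hc, hcz⟩ := exists_between hcon
  lift c to NNReal using hcz.ne_top
  have hcz' : (c : ℝ) < z := by
    rw [← ENNReal.ofReal_coe_nnreal] at hcz
    exact (ENNReal.ofReal_lt_ofReal_iff_of_nonneg c.coe_nonneg).1 hcz
  have := h.le_of_gt_secondPrice hP hz ⟨c.coe_nonneg, hcz'.le.trans hz.2⟩ hcz'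
  rw [ENNReal.ofReal_coe_nnreal] at this
  exact absurd hc (not_lt.2 this)

/-- Type 1 is excluded: no type lies above her, so nothing rules out that she bids more than 1. -/
theorem eq_ofReal_secondPrice (h : IsSymmetricIncreasingEquilibrium P .secondPrice β)
    (hP : P.IsC1) {z : ℝ} (hz : z ∈ Ico (0 : ℝ) 1) : β z = ENNReal.ofReal z := by
  refine le_antisymm ?_ (h.ofReal_le_secondPrice hP ⟨hz.1, hz.2.le⟩)
  by_contra! hcon
  obtain ⟨c, hc, hcz⟩ := exists_between (lt_min hcon
    ((ENNReal.ofReal_lt_ofReal_iff one_pos).2 hz.2))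
  lift c to NNReal using hcz.ne_top
  rw [lt_min_iff] at hcz
  rw [← ENNReal.ofReal_coe_nnreal, ENNReal.ofReal_lt_ofReal_iff_of_nonneg hz.1] at hc
  have hc1 : (c : ℝ) < 1 := by
    have := hcz.2
    rw [← ENNReal.ofReal_coe_nnreal] at this
    exact (ENNReal.ofReal_lt_ofReal_iff_of_nonneg c.coe_nonneg).1 this
  have := h.le_of_lt_secondPrice hP ⟨hz.1, hz.2.le⟩ ⟨c.coe_nonneg, hc1.le⟩ hc
  rw [ENNReal.ofReal_coe_nnreal] at this
  exact absurd hcz.1 (not_lt.2 this)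

/-! ### Growth of the bids in the war of attrition -/

/-- Type `x` must not gain by imitating `y`. She would win against the types between them and pay at
most `β y - β x` more, and only against types above `x`. This is a discrete form of `β'(x) ≥ x
f(x|x) / (1 - F(x|x))`, without assuming differentiability. -/
theorem mul_integral_le_warOfAttrition (h : IsSymmetricIncreasingEquilibrium P .warOfAttrition β)
    (hP : P.IsC1) {x y : ℝ} (hx : 0 ≤ x) (hxy : x < y) (hy : y < 1) :
    x * ∫ z in Icc x y, P.density x z
      ≤ ((β y).toReal - (β x).toReal) * ∫ z in Icc x 1, P.density x z := by
  have hβ := h.strictMonoOn_warOfAttrition hP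
  have hx' : x ∈ Icc (0 : ℝ) 1 := ⟨hx, hxy.le.trans hy.le⟩
  have hy' : y ∈ Icc (0 : ℝ) 1 := ⟨hx.trans hxy.le, hy.le⟩
  have := hP.isProbabilityMeasure_condLaw hx'
  have hinc := h.incentive hP hx' (β y)
  have hby : β y ≠ ∞ := (hβ hy' ⟨zero_le_one, le_rfl⟩ hy).ne_top
  have hwin : (∫⁻ z, winShare (β x) (β z) ∂(P.condLaw x)) + P.condLaw x (Icc x y)
      ≤ ∫⁻ z, winShare (β y) (β z) ∂(P.condLaw x) := by
    rw [← setLIntegral_one, ← lintegral_indicator measurableSet_Icc,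
      ← lintegral_add_right _ (measurable_const.indicator measurableSet_Icc)]
    refine lintegral_mono_ae ?_
    filter_upwards [P.ae_mem_Ioo_condLaw x, P.ae_ne_condLaw x x, P.ae_ne_condLaw x y]
      with z hz hzx hzy
    have hz' : z ∈ Icc (0 : ℝ) 1 := Ioo_subset_Icc_self hz
    rcases lt_or_gt_of_ne hzx with hzx | hzx
    · rw [indicator_of_notMem (fun hcon => not_le.2 hzx hcon.1), add_zero]
      exact winShare_mono_left (hβ hx' hy' hxy).le _
    · rw [winShare_of_gt (hβ hx' hz' hzx), zero_add]
      rcases lt_or_gt_of_ne hzy with hzy | hzy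
      · rw [winShare_of_lt (hβ hz' hy' hzy)]
        exact indicator_le_self' (fun _ _ => zero_le) z
      · rw [indicator_of_notMem (fun hcon => not_le.2 hzy hcon.2)]
        exact zero_le
  have hpay : ∫⁻ z, Auction.warOfAttrition.payment (β y) (β z) ∂(P.condLaw x)
      ≤ (∫⁻ z, Auction.warOfAttrition.payment (β x) (β z) ∂(P.condLaw x))
        + (β y - β x) * P.condLaw x (Icc x 1) := by
    rw [← setLIntegral_const, ← lintegral_indicator measurableSet_Icc,
      ← lintegral_add_right _ (measurable_const.indicator measurableSet_Icc)]
    refine lintegral_mono_ae ?_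
    filter_upwards [P.ae_mem_Ioo_condLaw x] with z hz
    have hz' : z ∈ Icc (0 : ℝ) 1 := Ioo_subset_Icc_self hz
    simp only [Auction.payment]
    rcases lt_or_ge z x with hzx | hzx
    · rw [min_eq_right (hβ hz' hx' hzx).le]
      exact (min_le_right _ _).trans le_self_add
    · rw [min_eq_left (h.1 hx' hz' hzx), indicator_of_mem (show z ∈ Icc x 1 from ⟨hzx, hz'.2⟩),
        add_tsub_cancel_of_le (hβ hx' hy' hxy).le]
      exact min_le_left _ _
  have key : ENNReal.ofReal x * P.condLaw x (Icc x y) ≤ (β y - β x) * P.condLaw x (Icc x 1) := by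
    refine (ENNReal.add_le_add_iff_left (ENNReal.add_ne_top.2
      ⟨ofReal_mul_lintegral_winShare_ne_top hP hx' β (β x),
        h.lintegral_payment_ne_top hP hx'⟩)).1 ?_
    calc _ = ENNReal.ofReal x * ((∫⁻ z, winShare (β x) (β z) ∂(P.condLaw x))
              + P.condLaw x (Icc x y))
            + ∫⁻ z, Auction.warOfAttrition.payment (β x) (β z) ∂(P.condLaw x) := by ring
      _ ≤ _ := by gcongr
      _ ≤ _ := hinc
      _ ≤ _ := add_le_add le_rfl hpay
      _ = _ := by ring
  have hpos := hP.marginal_pos hx'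
  rw [hP.condLaw_eq_ofReal hx' measurableSet_Icc (Icc_subset_Icc hx hy.le),
    hP.condLaw_eq_ofReal hx' measurableSet_Icc (Icc_subset_Icc hx le_rfl)] at key
  have key := ENNReal.toReal_mono (by finiteness) key
  have hnn : ∀ t ≤ 1, 0 ≤ ∫ z in Icc x t, P.density x z := fun t ht =>
    setIntegral_nonneg measurableSet_Icc fun z hz =>
      (P.density_pos x hx' z ⟨hx.trans hz.1, hz.2.trans ht⟩).le
  rw [ENNReal.toReal_mul, ENNReal.toReal_mul, ENNReal.toReal_ofReal hx,
    ENNReal.toReal_ofReal (div_nonneg (hnn _ hy.le) hpos.le),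
    ENNReal.toReal_ofReal (div_nonneg (hnn _ le_rfl) hpos.le),
    ENNReal.toReal_sub_of_le (hβ hx' hy' hxy).le hby, ← mul_div_assoc, ← mul_div_assoc,
    div_le_div_iff_of_pos_right hpos] at key
  exact key

end IsSymmetricIncreasingEquilibrium

/-! ### Signs of derivatives and Chebyshev's inequality -/

open Filter Topology in
/-- A real function whose increments from `θ` have the sign of `φ - θ` has a non-negative
derivative at `θ`. -/
theorem HasDerivWithinAt.nonneg_of_increment {K : ℝ → ℝ} {d θ : ℝ} (hθ : θ ∈ Icc (0 : ℝ) 1)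
    (hd : HasDerivWithinAt K d (Icc 0 1) θ)
    (h : ∀ φ ∈ Icc (0 : ℝ) 1, 0 ≤ (φ - θ) * (K φ - K θ)) : 0 ≤ d := by
  rw [hasDerivWithinAt_iff_tendsto_slope] at hd
  have : (𝓝[Icc (0 : ℝ) 1 \ {θ}] θ).NeBot :=
    accPt_principal_iff_nhdsWithin.1
      (uniqueDiffWithinAt_iff_accPt.1 (uniqueDiffOn_Icc one_pos θ hθ))
  refine ge_of_tendsto hd ?_
  filter_upwards [self_mem_nhdsWithin] with φ hφ
  have hne : φ - θ ≠ 0 := sub_ne_zero.2 hφ.2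
  rw [slope_def_field]
  have := div_nonneg (h φ hφ.1) (sq_nonneg (φ - θ))
  rwa [sq, mul_div_mul_left _ _ hne] at this

/-- Chebyshev's integral inequality for a pair of weights whose ratio is ordered like `h`. -/
theorem integral_mul_integral_le_of_ratio {s : Set ℝ} (hs : MeasurableSet s) {h p q : ℝ → ℝ}
    (hp : IntegrableOn p s) (hq : IntegrableOn q s) (hhp : IntegrableOn (fun z => h z * p z) s)
    (hhq : IntegrableOn (fun z => h z * q z) s)
    (hsign : ∀ z ∈ s, ∀ y ∈ s, 0 ≤ (h z - h y) * (q z * p y - p z * q y)) :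
    (∫ z in s, h z * p z) * (∫ z in s, q z) ≤ (∫ z in s, h z * q z) * ∫ z in s, p z := by
  -- The integral over `s × s` of `(h z - h y)(q z p y - p z q y)` is twice the difference of the
  -- two sides.
  have key : 0 ≤ ∫ w in s ×ˢ s, ((h w.1 * q w.1) * p w.2 - (h w.1 * p w.1) * q w.2
      - (q w.1 * (h w.2 * p w.2) - p w.1 * (h w.2 * q w.2))) := by
    refine setIntegral_nonneg (hs.prod hs) fun w hw => ?_
    have := hsign w.1 hw.1 w.2 hw.2
    linarith
  rw [Measure.volume_eq_prod, ← Measure.prod_restrict, integral_sub, integral_sub, integral_sub,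
    integral_prod_mul (fun z => h z * q z) p, integral_prod_mul (fun z => h z * p z) q,
    integral_prod_mul q (fun z => h z * p z), integral_prod_mul p (fun z => h z * q z)] at key
  · linarith
  · exact hq.mul_prod hhp
  · exact hp.mul_prod hhq
  · exact hhq.mul_prod hp
  · exact hhp.mul_prod hq
  · exact (hhq.mul_prod hp).sub (hhp.mul_prod hq)
  · exact (hq.mul_prod hhp).sub (hp.mul_prod hhq)

namespace Belief

variable {P : Belief}

/-- The form in which affiliation is used: a monotone likelihood ratio between the beliefs of a
lower and a higher type. -/
theorem IsAffiliated.mul_le_mul (hA : P.IsAffiliated) {θ φ y z : ℝ} (hθ : θ ∈ Icc (0 : ℝ) 1)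
    (hφ : φ ∈ Icc (0 : ℝ) 1) (hy : y ∈ Icc (0 : ℝ) 1) (hz : z ∈ Icc (0 : ℝ) 1) (hθφ : θ ≤ φ)
    (hyz : y ≤ z) : P.density θ z * P.density φ y ≤ P.density φ z * P.density θ y := by
  have := hA θ hθ z hz φ hφ y hy
  rwa [max_eq_right hθφ, max_eq_left hyz, min_eq_left hθφ, min_eq_right hyz] at this

/-! ### Conditional means given that the competitor's type is below a threshold -/

/-- The mean of `h` under the belief of type `φ`, given that the competitor's type is at most `c`. -/
def condMean (P : Belief) (c : ℝ) (h : ℝ → ℝ) (φ : ℝ) : ℝ :=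
  (∫ z in Icc 0 c, h z * P.density φ z) / ∫ z in Icc 0 c, P.density φ z

/-- The conditional mean of an extended non-negative function. -/
def condLmean (P : Belief) (c : ℝ) (g : ℝ → ℝ≥0∞) (φ : ℝ) : ℝ≥0∞ :=
  (∫⁻ z in Icc 0 c, g z ∂(P.condLaw φ)) / P.condLaw φ (Icc 0 c)

theorem IsC1.integrableOn_mul (hP : P.IsC1) {c : ℝ} (hc : c ≤ 1) {h : ℝ → ℝ}
    (hh : IntegrableOn h (Icc 0 c)) {φ : ℝ} (hφ : φ ∈ Icc (0 : ℝ) 1) :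
    IntegrableOn (fun z => h z * P.density φ z) (Icc 0 c) := by
  obtain ⟨m, M, hm, -, hmM⟩ := hP.exists_bounds
  refine Integrable.mul_bdd (c := M) hh (P.measurable_density_right φ).aestronglyMeasurable ?_
  filter_upwards [self_mem_ae_restrict measurableSet_Icc] with z hz
  have := hmM φ hφ z ⟨hz.1, hz.2.trans hc⟩
  rw [Real.norm_of_nonneg (hm.le.trans this.1)]
  exact this.2

/-- Likelihood ratio order survives truncation to `[0,c]`, so Chebyshev's inequality applies.
Monotonicity of `h` matters on the open interval only; this discards ties and the possibly infinite
bid of type 1. -/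
theorem IsC1.condMean_mono (hP : P.IsC1) (hA : P.IsAffiliated) {c : ℝ} (hc0 : 0 < c) (hc : c ≤ 1)
    {h : ℝ → ℝ} (hh : IntegrableOn h (Icc 0 c)) (hmono : MonotoneOn h (Ioo 0 c)) {φ φ' : ℝ}
    (hφ : φ ∈ Icc (0 : ℝ) 1) (hφ' : φ' ∈ Icc (0 : ℝ) 1) (hle : φ ≤ φ') :
    P.condMean c h φ ≤ P.condMean c h φ' := by
  rw [condMean, condMean, div_le_div_iff₀ (hP.integral_Icc_pos hφ le_rfl hc0 hc)
    (hP.integral_Icc_pos hφ' le_rfl hc0 hc)]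
  have hsub : Ioo 0 c ⊆ Icc 0 c := Ioo_subset_Icc_self
  have hI : ∀ ψ ∈ Icc (0 : ℝ) 1, IntegrableOn (P.density ψ) (Ioo 0 c) := fun ψ hψ =>
    hP.integrableOn hψ (hsub.trans (Icc_subset_Icc_right hc))
  simp only [integral_Icc_eq_integral_Ioo]
  refine integral_mul_integral_le_of_ratio measurableSet_Ioo (hI φ hφ) (hI φ' hφ')
    ((hP.integrableOn_mul hc hh hφ).mono_set hsub) ((hP.integrableOn_mul hc hh hφ').mono_set hsub)
    fun z hz y hy => ?_
  have hz' : z ∈ Icc (0 : ℝ) 1 := ⟨hz.1.le, hz.2.le.trans hc⟩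
  have hy' : y ∈ Icc (0 : ℝ) 1 := ⟨hy.1.le, hy.2.le.trans hc⟩
  rcases le_total y z with h | h
  · refine mul_nonneg (sub_nonneg.2 (hmono hy hz h)) ?_
    linarith [hA.mul_le_mul hφ hφ' hy' hz' hle h]
  · refine mul_nonneg_of_nonpos_of_nonpos (sub_nonpos.2 (hmono hz hy h)) ?_
    linarith [hA.mul_le_mul hφ hφ' hz' hy' hle h]

-- Differentiation under the integral sign within the closed square. The density has a bounded
-- derivative there, so by the mean value inequality its difference quotients are dominated by a
-- constant, and `h` need only be integrable.
open Filter Topology in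
theorem IsC1.differentiableWithinAt_integral (hP : P.IsC1) {c : ℝ} (hc : c ≤ 1) {h : ℝ → ℝ}
    (hh : IntegrableOn h (Icc 0 c)) {θ : ℝ} (hθ : θ ∈ Icc (0 : ℝ) 1) :
    DifferentiableWithinAt ℝ (fun φ => ∫ z in Icc 0 c, h z * P.density φ z) (Icc 0 1) θ := by
  set S := Icc (0 : ℝ) 1 ×ˢ Icc (0 : ℝ) 1 with hS
  set f : ℝ × ℝ → ℝ := fun p => P.density p.1 p.2 with hf
  have huniq : UniqueDiffOn ℝ S := (uniqueDiffOn_Icc one_pos).prod (uniqueDiffOn_Icc one_pos)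
  have hcont : ContinuousOn (fderivWithin ℝ f S) S := ContDiffOn.continuousOn_fderivWithin hP huniq le_rfl
  have hdiff : DifferentiableOn ℝ f S := ContDiffOn.differentiableOn hP one_ne_zero
  obtain ⟨C, hC⟩ := (isCompact_Icc.prod isCompact_Icc : IsCompact S).exists_bound_of_continuousOn
    hcont
  set D : ℝ → ℝ → ℝ := fun φ z => fderivWithin ℝ f S (φ, z) (1, 0) with hD
  have hDer : ∀ z ∈ Icc (0 : ℝ) 1, ∀ φ ∈ Icc (0 : ℝ) 1,
      HasDerivWithinAt (fun φ => P.density φ z) (D φ z) (Icc 0 1) φ := by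
    intro z hz φ hφ
    have h1 : HasFDerivWithinAt f (fderivWithin ℝ f S (φ, z)) S (φ, z) :=
      (hdiff (φ, z) ⟨hφ, hz⟩).hasFDerivWithinAt
    have h2 : HasDerivWithinAt (fun φ : ℝ => (φ, z)) ((1 : ℝ), (0 : ℝ)) (Icc 0 1) φ :=
      (hasDerivWithinAt_id φ _).prodMk (hasDerivWithinAt_const φ _ z)
    have h3 : MapsTo (fun φ : ℝ => (φ, z)) (Icc 0 1) S := fun ψ hψ => ⟨hψ, hz⟩
    exact h1.comp_hasDerivWithinAt φ h2 h3
  have hDb : ∀ z ∈ Icc (0 : ℝ) 1, ∀ φ ∈ Icc (0 : ℝ) 1, ‖D φ z‖ ≤ C := by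
    intro z hz φ hφ
    calc ‖D φ z‖ ≤ ‖fderivWithin ℝ f S (φ, z)‖ * ‖((1 : ℝ), (0 : ℝ))‖ :=
          ContinuousLinearMap.le_opNorm _ _
      _ ≤ C * 1 := by
          gcongr
          · exact (norm_nonneg _).trans (hC (φ, z) ⟨hφ, hz⟩)
          · exact hC (φ, z) ⟨hφ, hz⟩
          · simp [Prod.norm_def]
      _ = C := mul_one C
  have hLip : ∀ z ∈ Icc (0 : ℝ) 1, ∀ φ ∈ Icc (0 : ℝ) 1,
      ‖P.density φ z - P.density θ z‖ ≤ C * ‖φ - θ‖ := fun z hz φ hφ =>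
    (convex_Icc 0 1).norm_image_sub_le_of_norm_hasDerivWithin_le (hDer z hz) (hDb z hz) hθ hφ
  refine (HasDerivWithinAt.differentiableWithinAt (f' := ∫ z in Icc 0 c, h z * D θ z) ?_)
  rw [hasDerivWithinAt_iff_tendsto_slope]
  have heq : ∀ φ ∈ Icc (0 : ℝ) 1 \ {θ},
      slope (fun φ => ∫ z in Icc 0 c, h z * P.density φ z) θ φ
        = ∫ z in Icc 0 c, h z * slope (fun φ => P.density φ z) θ φ := by
    intro φ hφ
    simp only [slope_def_field]
    rw [← integral_sub (hP.integrableOn_mul hc hh hφ.1) (hP.integrableOn_mul hc hh hθ),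
      ← integral_div]
    congr 1
    ext z
    ring
  refine Tendsto.congr' (f₁ := fun φ => ∫ z in Icc 0 c, h z * slope (fun φ => P.density φ z) θ φ)
    ?_ ?_
  · filter_upwards [self_mem_nhdsWithin] with φ hφ using (heq φ hφ).symm
  refine tendsto_integral_filter_of_dominated_convergence (fun z => ‖h z‖ * C) ?_ ?_ ?_ ?_
  · refine Eventually.of_forall fun φ => hh.aestronglyMeasurable.mul ?_
    simp only [slope_def_field]
    exact (((P.measurable_density_right φ).sub
      (P.measurable_density_right θ)).div_const _).aestronglyMeasurable
  · filter_upwards [self_mem_nhdsWithin] with φ hφ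
    filter_upwards [self_mem_ae_restrict measurableSet_Icc] with z hz
    have hne : 0 < ‖φ - θ‖ := norm_pos_iff.2 (sub_ne_zero.2 hφ.2)
    rw [norm_mul, slope_def_field, norm_div]
    gcongr
    rw [div_le_iff₀ hne]
    exact hLip z ⟨hz.1, hz.2.trans hc⟩ φ hφ.1
  · exact hh.norm.mul_const C
  · filter_upwards [self_mem_ae_restrict measurableSet_Icc] with z hz
    exact (hasDerivWithinAt_iff_tendsto_slope.1 (hDer z ⟨hz.1, hz.2.trans hc⟩ θ hθ)).const_mul _

theorem IsC1.differentiableWithinAt_condMean (hP : P.IsC1) {c : ℝ} (hc0 : 0 < c) (hc : c ≤ 1)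
    {h : ℝ → ℝ} (hh : IntegrableOn h (Icc 0 c)) {θ : ℝ} (hθ : θ ∈ Icc (0 : ℝ) 1) :
    DifferentiableWithinAt ℝ (P.condMean c h) (Icc 0 1) θ := by
  have h1 := hP.differentiableWithinAt_integral hc (h := fun _ => 1) (by simp) hθ
  simp only [one_mul] at h1
  exact (hP.differentiableWithinAt_integral hc hh hθ).div h1
    (hP.integral_Icc_pos hθ le_rfl hc0 hc).ne'

/-- The marginal density cancels between numerator and denominator, so only integrals against the
joint density need to be differentiated. -/
theorem IsC1.condLmean_eq (hP : P.IsC1) {c : ℝ} (hc0 : 0 < c) (hc : c ≤ 1) {g : ℝ → ℝ≥0∞}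
    (hg : AEMeasurable g (volume.restrict (Icc 0 c))) (hfin : ∫⁻ z in Icc 0 c, g z ≠ ∞) {φ : ℝ}
    (hφ : φ ∈ Icc (0 : ℝ) 1) :
    P.condLmean c g φ = ENNReal.ofReal (P.condMean c (fun z => (g z).toReal) φ) := by
  have hsub : Icc 0 c ⊆ Icc (0 : ℝ) 1 := Icc_subset_Icc_right hc
  have hm := hP.marginal_pos hφ
  have hint : IntegrableOn (fun z => (g z).toReal) (Icc 0 c) :=
    integrable_toReal_of_lintegral_ne_top hg hfin
  have hnum : ∫⁻ z in Icc 0 c, g z ∂(P.condLaw φ)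
      = ENNReal.ofReal ((∫ z in Icc 0 c, (g z).toReal * P.density φ z) / P.marginal φ) := by
    rw [setLIntegral_condLaw P φ _ measurableSet_Icc hsub, ← integral_div,
      ofReal_integral_eq_lintegral_ofReal]
    · refine lintegral_congr_ae ?_
      filter_upwards [ae_lt_top' hg hfin, self_mem_ae_restrict measurableSet_Icc] with z hz hz'
      have := P.density_pos φ hφ z (hsub hz')
      rw [mul_div_assoc, ENNReal.ofReal_mul ENNReal.toReal_nonneg, ENNReal.ofReal_toReal hz.ne,
        mul_comm]
    · exact (hP.integrableOn_mul hc hint hφ).div_const _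
    · filter_upwards [self_mem_ae_restrict measurableSet_Icc] with z hz
      have := P.density_pos φ hφ z (hsub hz)
      positivity
  have hden := hP.integral_Icc_pos hφ le_rfl hc0 hc
  rw [condLmean, hnum, hP.condLaw_eq_ofReal hφ measurableSet_Icc hsub,
    ← ENNReal.ofReal_div_of_pos (div_pos hden hm), div_div_div_cancel_right₀ hm.ne', condMean]

theorem condMean_nonneg (P : Belief) {c : ℝ} (hc : c ≤ 1) (g : ℝ → ℝ≥0∞) {φ : ℝ}
    (hφ : φ ∈ Icc (0 : ℝ) 1) : 0 ≤ P.condMean c (fun z => (g z).toReal) φ := by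
  have : ∀ z ∈ Icc 0 c, 0 ≤ P.density φ z := fun z hz =>
    (P.density_pos φ hφ z ⟨hz.1, hz.2.trans hc⟩).le
  exact div_nonneg (setIntegral_nonneg measurableSet_Icc fun z hz =>
    mul_nonneg ENNReal.toReal_nonneg (this z hz)) (setIntegral_nonneg measurableSet_Icc this)

theorem IsC1.toReal_condLmean (hP : P.IsC1) {c : ℝ} (hc0 : 0 < c) (hc : c ≤ 1) {g : ℝ → ℝ≥0∞}
    (hg : AEMeasurable g (volume.restrict (Icc 0 c))) (hfin : ∫⁻ z in Icc 0 c, g z ≠ ∞) {φ : ℝ}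
    (hφ : φ ∈ Icc (0 : ℝ) 1) :
    (P.condLmean c g φ).toReal = P.condMean c (fun z => (g z).toReal) φ := by
  rw [hP.condLmean_eq hc0 hc hg hfin hφ, ENNReal.toReal_ofReal (P.condMean_nonneg hc g hφ)]

theorem IsC1.condMean_sub (hP : P.IsC1) {c : ℝ} (hc : c ≤ 1) {h k : ℝ → ℝ}
    (hh : IntegrableOn h (Icc 0 c)) (hk : IntegrableOn k (Icc 0 c)) {φ : ℝ}
    (hφ : φ ∈ Icc (0 : ℝ) 1) :
    P.condMean c (fun z => h z - k z) φ = P.condMean c h φ - P.condMean c k φ := by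
  simp only [condMean, sub_mul]
  rw [integral_sub (hP.integrableOn_mul hc hh hφ) (hP.integrableOn_mul hc hk hφ), sub_div]

/-- The partial derivatives are ordered if the increments of the conditional mean of the
difference have the right sign. -/
theorem IsC1.partialDerivLE (hP : P.IsC1) {c : ℝ} (hc0 : 0 < c) (hc : c ≤ 1)
    {GX GY : ℝ → ℝ → ℝ≥0∞} {gX gY : ℝ → ℝ≥0∞} {θ : ℝ} (hθ : θ ∈ Icc (0 : ℝ) 1)
    (hGX : ∀ φ ∈ Icc (0 : ℝ) 1, GX θ φ = P.condLmean c gX φ)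
    (hGY : ∀ φ ∈ Icc (0 : ℝ) 1, GY θ φ = P.condLmean c gY φ)
    (hgX : AEMeasurable gX (volume.restrict (Icc 0 c))) (hfX : ∫⁻ z in Icc 0 c, gX z ≠ ∞)
    (hgY : AEMeasurable gY (volume.restrict (Icc 0 c))) (hfY : ∫⁻ z in Icc 0 c, gY z ≠ ∞)
    (hsign : ∀ φ ∈ Icc (0 : ℝ) 1,
      0 ≤ (φ - θ) * (P.condMean c (fun z => (gY z).toReal - (gX z).toReal) φ
        - P.condMean c (fun z => (gY z).toReal - (gX z).toReal) θ)) :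
    PartialDerivLE GX GY θ := by
  have hiX : IntegrableOn (fun z => (gX z).toReal) (Icc 0 c) :=
    integrable_toReal_of_lintegral_ne_top hgX hfX
  have hiY : IntegrableOn (fun z => (gY z).toReal) (Icc 0 c) :=
    integrable_toReal_of_lintegral_ne_top hgY hfY
  have hX := (hP.differentiableWithinAt_condMean hc0 hc hiX hθ).hasDerivWithinAt
  have hY := (hP.differentiableWithinAt_condMean hc0 hc hiY hθ).hasDerivWithinAt
  have hXeq : ∀ φ ∈ Icc (0 : ℝ) 1, (GX θ φ).toReal = P.condMean c (fun z => (gX z).toReal) φ :=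
    fun φ hφ => by rw [hGX φ hφ, hP.toReal_condLmean hc0 hc hgX hfX hφ]
  have hYeq : ∀ φ ∈ Icc (0 : ℝ) 1, (GY θ φ).toReal = P.condMean c (fun z => (gY z).toReal) φ :=
    fun φ hφ => by rw [hGY φ hφ, hP.toReal_condLmean hc0 hc hgY hfY hφ]
  refine ⟨fun φ hφ => ⟨?_, ?_⟩, _, _, hX.congr hXeq (hXeq θ hθ), hY.congr hYeq (hYeq θ hθ), ?_⟩
  · rw [hGX φ hφ, hP.condLmean_eq hc0 hc hgX hfX hφ]
    exact ENNReal.ofReal_ne_top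
  · rw [hGY φ hφ, hP.condLmean_eq hc0 hc hgY hfY hφ]
    exact ENNReal.ofReal_ne_top
  · refine sub_nonneg.1 ((hY.sub hX).nonneg_of_increment hθ fun φ hφ => ?_)
    have := hsign φ hφ
    rwa [hP.condMean_sub hc hiY hiX hφ, hP.condMean_sub hc hiY hiX hθ] at this

/-- Conditioning on `[0,1]` is void. Thus LC1 concerns conditional means with `c = 1` and LC2 those
with `c = θ`. -/
theorem IsC1.expectedPayment_eq_condLmean (hP : P.IsC1) (t : ℝ → ℝ → ℝ≥0∞) (θ : ℝ) {φ : ℝ}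
    (hφ : φ ∈ Icc (0 : ℝ) 1) : expectedPayment P t θ φ = P.condLmean 1 (t θ) φ := by
  have hae : ∀ᵐ z ∂(P.condLaw φ), z ∈ Icc (0 : ℝ) 1 :=
    (P.ae_mem_Ioo_condLaw φ).mono fun z hz => Ioo_subset_Icc_self hz
  have := hP.isProbabilityMeasure_condLaw hφ
  rw [expectedPayment, condLmean, Measure.restrict_eq_self_of_ae_mem hae,
    (prob_compl_eq_zero_iff measurableSet_Icc).1 hae, div_one]

/-- Finite conditional means are finite with respect to Lebesgue measure. -/
theorem IsC1.lintegral_ne_top (hP : P.IsC1) {g : ℝ → ℝ≥0∞} {θ : ℝ} (hθ : θ ∈ Icc (0 : ℝ) 1)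
    (hg : ∫⁻ z, g z ∂(P.condLaw θ) ≠ ∞) : ∫⁻ z in Icc 0 1, g z ≠ ∞ := by
  obtain ⟨m, M, hm, -, hmM⟩ := hP.exists_bounds
  have hpos := hP.marginal_pos hθ
  have hk : ENNReal.ofReal (m / P.marginal θ) ≠ 0 := (ENNReal.ofReal_pos.2 (div_pos hm hpos)).ne'
  have h1 : ENNReal.ofReal (m / P.marginal θ) * ∫⁻ z in Icc 0 1, g z
      ≤ ∫⁻ z, g z ∂(P.condLaw θ) := by
    rw [lintegral_condLaw, ← lintegral_const_mul' _ _ ENNReal.ofReal_ne_top]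
    refine setLIntegral_mono' measurableSet_Icc fun z hz => ?_
    gcongr
    exact (hmM θ hθ z hz).1
  intro htop
  rw [htop, ENNReal.mul_top hk, top_le_iff] at h1
  exact hg h1

end Belief

/-! ### Linkage for pairs whose transfers differ by a monotone function -/

section Linkage

variable {P : Belief} {X Y : Auction} {β βX βY : ℝ → ℝ≥0∞}

theorem IsSymmetricIncreasingEquilibrium.aemeasurable_transfer
    (h : IsSymmetricIncreasingEquilibrium P X β) (θ : ℝ) {c : ℝ} (hc : c ≤ 1) :
    AEMeasurable (X.transfer β θ) (volume.restrict (Icc 0 c)) :=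
  (X.measurable_payment (β θ)).comp_aemeasurable
    ((aemeasurable_restrict_of_monotoneOn measurableSet_Icc h.1).mono_set (Icc_subset_Icc_right hc))

theorem IsSymmetricIncreasingEquilibrium.lintegral_transfer_ne_top
    (h : IsSymmetricIncreasingEquilibrium P X β) (hP : P.IsC1) {θ : ℝ} (hθ : θ ∈ Icc (0 : ℝ) 1)
    {c : ℝ} (hc : c ≤ 1) : ∫⁻ z in Icc 0 c, X.transfer β θ z ≠ ∞ :=
  ne_top_of_le_ne_top (hP.lintegral_ne_top hθ (h.lintegral_payment_ne_top hP hθ))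
    (lintegral_mono_set (Icc_subset_Icc_right hc))

theorem partialDerivLE_of_monotoneOn (hP : P.IsC1) (hA : P.IsAffiliated)
    (hX : IsSymmetricIncreasingEquilibrium P X βX) (hY : IsSymmetricIncreasingEquilibrium P Y βY)
    {c θ : ℝ} (hc0 : 0 < c) (hc : c ≤ 1) (hθ : θ ∈ Icc (0 : ℝ) 1) {GX GY : ℝ → ℝ → ℝ≥0∞}
    (hGX : ∀ φ ∈ Icc (0 : ℝ) 1, GX θ φ = P.condLmean c (X.transfer βX θ) φ)
    (hGY : ∀ φ ∈ Icc (0 : ℝ) 1, GY θ φ = P.condLmean c (Y.transfer βY θ) φ)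
    (hmono : MonotoneOn (fun z => (Y.transfer βY θ z).toReal - (X.transfer βX θ z).toReal)
      (Ioo 0 c)) : PartialDerivLE GX GY θ := by
  refine hP.partialDerivLE hc0 hc hθ hGX hGY (hX.aemeasurable_transfer θ hc)
    (hX.lintegral_transfer_ne_top hP hθ hc) (hY.aemeasurable_transfer θ hc)
    (hY.lintegral_transfer_ne_top hP hθ hc) fun φ hφ => ?_
  have hint : IntegrableOn (fun z => (Y.transfer βY θ z).toReal - (X.transfer βX θ z).toReal)
      (Icc 0 c) :=
    (integrable_toReal_of_lintegral_ne_top (hY.aemeasurable_transfer θ hc)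
      (hY.lintegral_transfer_ne_top hP hθ hc)).sub
    (integrable_toReal_of_lintegral_ne_top (hX.aemeasurable_transfer θ hc)
      (hX.lintegral_transfer_ne_top hP hθ hc))
  rcases le_total θ φ with h | h
  · exact mul_nonneg (sub_nonneg.2 h)
      (sub_nonneg.2 (hP.condMean_mono hA hc0 hc hint hmono hθ hφ h))
  · exact mul_nonneg_of_nonpos_of_nonpos (sub_nonpos.2 h)
      (sub_nonpos.2 (hP.condMean_mono hA hc0 hc hint hmono hφ hθ h))

theorem lc1_of_monotoneOn (hP : P.IsC1) (hA : P.IsAffiliated)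
    (hX : IsSymmetricIncreasingEquilibrium P X βX) (hY : IsSymmetricIncreasingEquilibrium P Y βY)
    (hXm : ∀ θ ∈ Icc (0 : ℝ) 1, AntitoneOn (fun z => (X.transfer βX θ z).toReal) (Ioo 0 1))
    (hYm : ∀ θ ∈ Icc (0 : ℝ) 1, MonotoneOn (fun z => (Y.transfer βY θ z).toReal) (Ioo 0 1)) :
    LC1 P (X.transfer βX) (Y.transfer βY) := fun θ hθ =>
  partialDerivLE_of_monotoneOn hP hA hX hY one_pos le_rfl hθ
    (fun _ hφ => hP.expectedPayment_eq_condLmean _ _ hφ)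
    (fun _ hφ => hP.expectedPayment_eq_condLmean _ _ hφ)
    fun _ hz _ hz' h => sub_le_sub (hYm θ hθ hz hz' h) (hXm θ hθ hz hz' h)

theorem IsSymmetricIncreasingEquilibrium.antitoneOn_transfer_firstPrice
    (h : IsSymmetricIncreasingEquilibrium P .firstPrice β) (hP : P.IsC1) {θ : ℝ}
    (hθ : θ ∈ Icc (0 : ℝ) 1) :
    AntitoneOn (fun z => (Auction.firstPrice.transfer β θ z).toReal) (Ioo 0 1) := by
  intro z hz z' hz' hle
  refine ENNReal.toReal_mono (ENNReal.mul_ne_top (h.ne_top_firstPrice hP hθ)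
    ((winShare_le_one _ _).trans_lt ENNReal.one_lt_top).ne) (mul_le_mul_right ?_ _)
  exact winShare_antitone _ (h.1 (Ioo_subset_Icc_self hz) (Ioo_subset_Icc_self hz') hle)

theorem IsSymmetricIncreasingEquilibrium.ne_top_warOfAttrition
    (h : IsSymmetricIncreasingEquilibrium P .warOfAttrition β) (hP : P.IsC1) {z : ℝ}
    (hz : z ∈ Ico (0 : ℝ) 1) : β z ≠ ∞ :=
  (h.strictMonoOn_warOfAttrition hP ⟨hz.1, hz.2.le⟩ (right_mem_Icc.2 zero_le_one) hz.2).ne_top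

theorem IsSymmetricIncreasingEquilibrium.monotoneOn_transfer_warOfAttrition
    (h : IsSymmetricIncreasingEquilibrium P .warOfAttrition β) (hP : P.IsC1) (θ : ℝ) :
    MonotoneOn (fun z => (Auction.warOfAttrition.transfer β θ z).toReal) (Ioo 0 1) := by
  intro z hz z' hz' hle
  refine ENNReal.toReal_mono ?_
    (min_le_min_left _ (h.1 (Ioo_subset_Icc_self hz) (Ioo_subset_Icc_self hz') hle))
  exact ne_top_of_le_ne_top (h.ne_top_warOfAttrition hP ⟨hz'.1.le, hz'.2⟩) (min_le_right _ _)

theorem linkageUnderAffiliation_firstPrice_allPay :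
    LinkageUnderAffiliation .firstPrice .allPay := fun _ _ hA hP _ _ hX hY =>
  Or.inl (lc1_of_monotoneOn hP hA hX hY (fun _ hθ => hX.antitoneOn_transfer_firstPrice hP hθ)
    fun _ _ _ _ _ _ _ => le_rfl)

theorem linkageUnderAffiliation_firstPrice_warOfAttrition :
    LinkageUnderAffiliation .firstPrice .warOfAttrition := fun _ _ hA hP _ _ hX hY =>
  Or.inl (lc1_of_monotoneOn hP hA hX hY (fun _ hθ => hX.antitoneOn_transfer_firstPrice hP hθ)
    fun θ _ => hY.monotoneOn_transfer_warOfAttrition hP θ)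

theorem linkageUnderAffiliation_allPay_warOfAttrition :
    LinkageUnderAffiliation .allPay .warOfAttrition := fun _ _ hA hP _ _ hX hY =>
  Or.inl (lc1_of_monotoneOn hP hA hX hY (fun _ _ _ _ _ _ _ => le_rfl)
    fun θ _ => hY.monotoneOn_transfer_warOfAttrition hP θ)

theorem IsSymmetricIncreasingEquilibrium.transfer_secondPrice_of_lt
    (h : IsSymmetricIncreasingEquilibrium P .secondPrice β) (hP : P.IsC1) {θ z : ℝ}
    (hθ : θ ∈ Icc (0 : ℝ) 1) (hz : 0 ≤ z) (hlt : z < θ) :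
    Auction.secondPrice.transfer β θ z = ENNReal.ofReal z := by
  have hb := h.eq_ofReal_secondPrice hP ⟨hz, hlt.trans_le hθ.2⟩
  have : β z < β θ := by
    rw [hb]
    exact lt_of_lt_of_le ((ENNReal.ofReal_lt_ofReal_iff (hz.trans_lt hlt)).2 hlt)
      (h.ofReal_le_secondPrice hP hθ)
  rw [Auction.transfer, Auction.payment, winShare_of_lt this, hb, mul_one]

theorem IsSymmetricIncreasingEquilibrium.transfer_secondPrice_of_gt
    (h : IsSymmetricIncreasingEquilibrium P .secondPrice β) (hP : P.IsC1) {θ z : ℝ}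
    (hθ : 0 ≤ θ) (hlt : θ < z) (hz : z ≤ 1) : Auction.secondPrice.transfer β θ z = 0 := by
  have hb := h.eq_ofReal_secondPrice hP ⟨hθ, hlt.trans_le hz⟩
  have : β θ < β z := by
    rw [hb]
    exact lt_of_lt_of_le ((ENNReal.ofReal_lt_ofReal_iff (hθ.trans_lt hlt)).2 hlt)
      (h.ofReal_le_secondPrice hP ⟨hθ.trans hlt.le, hz⟩)
  rw [Auction.transfer, Auction.payment, winShare_of_gt this, mul_zero]

/-- LC2 confines the comparison to competitors below `θ`, where the payments are the constant `βX θ`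
in I and the increasing `z` in II. -/
theorem linkageUnderAffiliation_firstPrice_secondPrice :
    LinkageUnderAffiliation .firstPrice .secondPrice := by
  intro P _ hA hP βX βY hX hY
  have hs := hX.strictMonoOn_firstPrice hP
  refine Or.inr ⟨fun θ hθ z hz hlt => ?_, fun θ hθ z hz hlt =>
    hY.transfer_secondPrice_of_gt hP hθ.1 hlt hz.2, fun θ hθ => ?_⟩
  · rw [Auction.transfer, Auction.payment, winShare_of_gt (hs hθ hz hlt), mul_zero]
  · have hθ' : θ ∈ Icc (0 : ℝ) 1 := Ioc_subset_Icc_self hθ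
    refine partialDerivLE_of_monotoneOn hP hA hX hY hθ.1 hθ.2 hθ' (fun _ _ => rfl)
      (fun _ _ => rfl) ?_
    have hXeq : ∀ z ∈ Ioo 0 θ, Auction.firstPrice.transfer βX θ z = βX θ := fun z hz => by
      rw [Auction.transfer, Auction.payment,
        winShare_of_lt (hs ⟨hz.1.le, hz.2.le.trans hθ.2⟩ hθ' hz.2), mul_one]
    intro z hz z' hz' hle
    simp only [hXeq z hz, hXeq z' hz', hY.transfer_secondPrice_of_lt hP hθ' hz.1.le hz.2,
      hY.transfer_secondPrice_of_lt hP hθ' hz'.1.le hz'.2, ENNReal.toReal_ofReal hz.1.le,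
      ENNReal.toReal_ofReal hz'.1.le]
    linarith

end Linkage

/-! ### The second-price auction and the war of attrition -/

/-- The allowed decrease is of second order: over `n` equal steps it telescopes to `C (ψ b - ψ a)(b
- a) / n`, which vanishes as `n` grows. No derivative of `g` is involved. -/
theorem le_of_forall_increment_ge {g ψ : ℝ → ℝ} {a b C : ℝ} (hab : a < b)
    (h : ∀ x y, a ≤ x → x < y → y ≤ b → -(C * (ψ y - ψ x) * (y - x)) ≤ g y - g x) :
    g a ≤ g b := by
  by_contra! hcon
  have hbound : ∀ n : ℕ, 0 < n → n * (g a - g b) ≤ C * (ψ b - ψ a) * (b - a) := by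
    intro n hn
    have hn' : (0 : ℝ) < n := by exact_mod_cast hn
    set x : ℕ → ℝ := fun k => a + k * ((b - a) / n) with hx
    have hd : 0 < (b - a) / n := div_pos (sub_pos.2 hab) hn'
    have h0 : x 0 = a := by simp [hx]
    have hxn : x n = b := by simp only [hx]; field_simp; ring
    have hstep : ∀ k, x (k + 1) - x k = (b - a) / n := fun k => by
      simp only [hx]; push_cast; ring
    have hmono : Monotone x := monotone_nat_of_le_succ fun k => by linarith [hstep k]
    have hsum : ∑ k ∈ Finset.range n, -(C * (ψ (x (k + 1)) - ψ (x k)) * ((b - a) / n))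
        ≤ ∑ k ∈ Finset.range n, (g (x (k + 1)) - g (x k)) := by
      refine Finset.sum_le_sum fun k hk => ?_
      have hk' := Finset.mem_range.1 hk
      rw [← hstep k]
      refine h _ _ ?_ (by linarith [hstep k]) ?_
      · rw [← h0]; exact hmono (Nat.zero_le k)
      · rw [← hxn]; exact hmono hk'
    rw [Finset.sum_range_sub (fun k => g (x k)), Finset.sum_neg_distrib, ← Finset.sum_mul,
      ← Finset.mul_sum, Finset.sum_range_sub (fun k => ψ (x k)), h0, hxn] at hsum
    have h2 : g a - g b ≤ C * (ψ b - ψ a) * ((b - a) / n) := by linarith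
    calc n * (g a - g b) ≤ n * (C * (ψ b - ψ a) * ((b - a) / n)) := by gcongr
      _ = _ := by field_simp
  obtain ⟨n, hn⟩ := exists_nat_gt (C * (ψ b - ψ a) * (b - a) / (g a - g b))
  rw [div_lt_iff₀ (sub_pos.2 hcon)] at hn
  have h1 := hbound (n + 1) n.succ_pos
  push_cast at h1
  linarith

/-- By Tonelli: the amount `b y` is paid at `y` precisely if the competitor has not dropped out
before `y`. -/
theorem lintegral_lintegral_Icc_min {μ : Measure ℝ} [SFinite μ] {b : ℝ → ℝ≥0∞}
    (hb : Measurable b) (x : ℝ) :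
    ∫⁻ z, (∫⁻ y in Icc 0 (min x z), b y) ∂μ = ∫⁻ y in Icc 0 x, b y * μ (Ici y) := by
  have hm : MeasurableSet {p : ℝ × ℝ | p.2 ≤ p.1} := measurableSet_le measurable_snd measurable_fst
  calc ∫⁻ z, (∫⁻ y in Icc 0 (min x z), b y) ∂μ
      = ∫⁻ z, (∫⁻ y in Icc 0 x, {p : ℝ × ℝ | p.2 ≤ p.1}.indicator (fun p => b p.2) (z, y)) ∂μ := by
        refine lintegral_congr fun z => ?_
        have : ∀ y, {p : ℝ × ℝ | p.2 ≤ p.1}.indicator (fun p => b p.2) (z, y)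
            = (Iic z).indicator b y := fun y => by
          simp [indicator]
        simp only [this]
        rw [lintegral_indicator measurableSet_Iic, Measure.restrict_restrict measurableSet_Iic]
        congr 2
        ext y
        simp only [mem_Icc, le_min_iff, mem_inter_iff, mem_Iic]
        tauto
    _ = ∫⁻ y in Icc 0 x, (∫⁻ z, {p : ℝ × ℝ | p.2 ≤ p.1}.indicator (fun p => b p.2) (z, y) ∂μ) :=
        lintegral_lintegral_swap
          (((hb.comp measurable_snd).indicator hm).aemeasurable)
    _ = _ := by
        refine lintegral_congr fun y => ?_
        have : ∀ z, {p : ℝ × ℝ | p.2 ≤ p.1}.indicator (fun p => b p.2) (z, y)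
            = (Ici y).indicator (fun _ => b y) z := fun z => by
          simp [indicator]
        simp only [this]
        rw [lintegral_indicator measurableSet_Ici, setLIntegral_const]

namespace Belief

variable {P : Belief}

/-- The density of the competitor's type, as seen by type `φ`. -/
def condDensity (P : Belief) (φ z : ℝ) : ℝ≥0∞ := ENNReal.ofReal (P.density φ z / P.marginal φ)

theorem measurable_condDensity (P : Belief) (φ : ℝ) : Measurable (P.condDensity φ) :=
  ((P.measurable_density_right φ).div_const _).ennreal_ofReal

/-- The bid of type `z` in the war of attrition if all beliefs were those of type `θ`. -/
def hazardBid (P : Belief) (θ z : ℝ) : ℝ≥0∞ :=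
  ∫⁻ x in Icc 0 z, ENNReal.ofReal x * (P.condDensity θ x / P.condLaw θ (Ici x))

theorem measurable_hazard (P : Belief) (θ : ℝ) :
    Measurable fun x => ENNReal.ofReal x * (P.condDensity θ x / P.condLaw θ (Ici x)) := by
  have : Antitone fun x => P.condLaw θ (Ici x) := fun x y h => measure_mono (Ici_subset_Ici.2 h)
  exact ENNReal.measurable_ofReal.mul ((P.measurable_condDensity θ).div this.measurable)

theorem condLaw_Ici (P : Belief) (θ : ℝ) {x : ℝ} (hx : 0 ≤ x) :
    P.condLaw θ (Ici x) = ∫⁻ y in Icc x 1, P.condDensity θ y := by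
  rw [condLaw, withDensity_apply _ measurableSet_Ici, Measure.restrict_restrict measurableSet_Ici]
  congr 2
  ext y
  simp only [mem_inter_iff, mem_Ici, mem_Icc]
  exact ⟨fun h => ⟨h.1, h.2.2⟩, fun h => ⟨h.1, hx.trans h.1, h.2⟩⟩

theorem IsC1.condLaw_Ici_eq (hP : P.IsC1) {θ : ℝ} (hθ : θ ∈ Icc (0 : ℝ) 1) {x : ℝ} (hx : 0 ≤ x) :
    P.condLaw θ (Ici x) = ENNReal.ofReal ((∫ y in Icc x 1, P.density θ y) / P.marginal θ) := by
  rw [condLaw_Ici P θ hx, ← hP.condLaw_eq_ofReal hθ measurableSet_Icc (Icc_subset_Icc_left hx),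
    condLaw_apply P θ measurableSet_Icc (Icc_subset_Icc_left hx)]
  rfl

/-- Higher types believe in lower hazard rates. -/
theorem IsAffiliated.hazard_le (hA : P.IsAffiliated) (hP : P.IsC1) {θ φ x : ℝ}
    (hθ : θ ∈ Icc (0 : ℝ) 1) (hφ : φ ∈ Icc (0 : ℝ) 1) (hle : θ ≤ φ) (hx : x ∈ Icc (0 : ℝ) 1) :
    P.condDensity φ x * P.condLaw θ (Ici x) ≤ P.condDensity θ x * P.condLaw φ (Ici x) := by
  rw [condLaw_Ici P θ hx.1, condLaw_Ici P φ hx.1,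
    ← lintegral_const_mul' (P.condDensity φ x) _ ENNReal.ofReal_ne_top,
    ← lintegral_const_mul' (P.condDensity θ x) _ ENNReal.ofReal_ne_top]
  -- The likelihood ratio inequality at `x ≤ y`, integrated over `y` in `[x,1]`, compares hazard
  -- rates.
  refine setLIntegral_mono' measurableSet_Icc fun y hy => ?_
  have hy' : y ∈ Icc (0 : ℝ) 1 := ⟨hx.1.trans hy.1, hy.2⟩
  have hmθ := hP.marginal_pos hθ
  have hmφ := hP.marginal_pos hφ
  unfold condDensity
  rw [← ENNReal.ofReal_mul (div_nonneg (P.density_pos φ hφ x hx).le hmφ.le),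
    ← ENNReal.ofReal_mul (div_nonneg (P.density_pos θ hθ x hx).le hmθ.le)]
  refine ENNReal.ofReal_le_ofReal ?_
  rw [div_mul_div_comm, div_mul_div_comm, mul_comm (P.marginal φ)]
  have := hA.mul_le_mul hθ hφ hx hy' hle hy.1
  gcongr ?_ / _
  linarith

theorem lintegral_hazardBid (hP : P.IsC1) (θ : ℝ) {φ : ℝ} (hφ : φ ∈ Icc (0 : ℝ) 1) :
    ∫⁻ z, P.hazardBid θ (min θ z) ∂(P.condLaw φ) = ∫⁻ x in Icc 0 θ,
      ENNReal.ofReal x * (P.condDensity θ x / P.condLaw θ (Ici x)) * P.condLaw φ (Ici x) := by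
  have := hP.isProbabilityMeasure_condLaw hφ
  exact lintegral_lintegral_Icc_min (P.measurable_hazard θ) θ

theorem IsC1.condLaw_Ici_pos (hP : P.IsC1) {θ : ℝ} (hθ : θ ∈ Icc (0 : ℝ) 1) {x : ℝ}
    (hx : x ∈ Ico (0 : ℝ) 1) : P.condLaw θ (Ici x) ≠ 0 :=
  ((hP.condLaw_Icc_pos hθ hx.1 hx.2 le_rfl).trans_le (measure_mono Icc_subset_Ici_self)).ne'

theorem condDensity_div_mul (hP : P.IsC1) {θ : ℝ} (hθ : θ ∈ Icc (0 : ℝ) 1) {x : ℝ}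
    (hx : x ∈ Ico (0 : ℝ) 1) (A B : ℝ≥0∞) :
    (A * (B / P.condLaw θ (Ici x))) * P.condLaw θ (Ici x) = A * B := by
  have := hP.isProbabilityMeasure_condLaw hθ
  rw [mul_assoc, ENNReal.div_mul_cancel (hP.condLaw_Ici_pos hθ hx) (measure_ne_top _ _)]

/-- Hazard rate times survival probability is the density, so the right side is the second-price
payment of type `θ`. The survival probability vanishes at 1, hence the half-open interval. -/
theorem lintegral_hazardBid_self (hP : P.IsC1) {θ : ℝ} (hθ : θ ∈ Icc (0 : ℝ) 1) :
    ∫⁻ z, P.hazardBid θ (min θ z) ∂(P.condLaw θ)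
      = ∫⁻ x in Icc 0 θ, ENNReal.ofReal x * P.condDensity θ x := by
  rw [lintegral_hazardBid hP θ hθ, ← restrict_Ico_eq_restrict_Icc]
  refine setLIntegral_congr_fun measurableSet_Ico fun x hx => ?_
  exact condDensity_div_mul hP hθ ⟨hx.1, hx.2.trans_le hθ.2⟩ _ _

/-- The survival probability of `φ` times the hazard rate of `θ`, which exceeds that of the higher
type `φ`, is at least the density seen by `φ`. For `φ ≤ θ` the inequality is reversed. -/
theorem IsAffiliated.le_lintegral_hazardBid (hA : P.IsAffiliated) (hP : P.IsC1) {θ φ : ℝ}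
    (hθ : θ ∈ Icc (0 : ℝ) 1) (hφ : φ ∈ Icc (0 : ℝ) 1) (hle : θ ≤ φ) :
    ∫⁻ x in Icc 0 θ, ENNReal.ofReal x * P.condDensity φ x
      ≤ ∫⁻ z, P.hazardBid θ (min θ z) ∂(P.condLaw φ) := by
  have := hP.isProbabilityMeasure_condLaw hθ
  rw [lintegral_hazardBid hP θ hφ, ← restrict_Ico_eq_restrict_Icc]
  refine setLIntegral_mono' measurableSet_Ico fun x hx => ?_
  rw [mul_assoc, ENNReal.mul_div_right_comm.symm]
  gcongr
  rw [ENNReal.le_div_iff_mul_le (Or.inl (hP.condLaw_Ici_pos hθ ⟨hx.1, hx.2.trans_le hθ.2⟩))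
    (Or.inl (measure_ne_top _ _))]
  exact hA.hazard_le hP hθ hφ hle ⟨hx.1, hx.2.le.trans hθ.2⟩

theorem IsAffiliated.lintegral_hazardBid_le (hA : P.IsAffiliated) (hP : P.IsC1) {θ φ : ℝ}
    (hθ : θ ∈ Icc (0 : ℝ) 1) (hφ : φ ∈ Icc (0 : ℝ) 1) (hle : φ ≤ θ) :
    ∫⁻ z, P.hazardBid θ (min θ z) ∂(P.condLaw φ)
      ≤ ∫⁻ x in Icc 0 θ, ENNReal.ofReal x * P.condDensity φ x := by
  have := hP.isProbabilityMeasure_condLaw hθ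
  rw [lintegral_hazardBid hP θ hφ, ← restrict_Ico_eq_restrict_Icc]
  refine setLIntegral_mono' measurableSet_Ico fun x hx => ?_
  rw [mul_assoc, ENNReal.mul_div_right_comm.symm]
  gcongr
  refine ENNReal.div_le_of_le_mul ?_
  exact hA.hazard_le hP hφ hθ hle ⟨hx.1, hx.2.le.trans hθ.2⟩

/-- An upper Riemann bound, with `x` and the survival probability frozen at the right endpoint.
Equilibrium bids have the matching lower bound with the left endpoint, so the discrepancy is of
second order. -/
theorem hazardBid_le_add (hP : P.IsC1) {θ : ℝ} (hθ : θ ∈ Icc (0 : ℝ) 1) {x y : ℝ} (hx : 0 ≤ x)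
    (hxy : x < y) (hy : y < 1) :
    P.hazardBid θ y ≤ P.hazardBid θ x + ENNReal.ofReal
      (y / (∫ z in Icc y 1, P.density θ z) * ∫ z in Icc x y, P.density θ z) := by
  have hm := hP.marginal_pos hθ
  have hG := hP.integral_Icc_pos hθ (hx.trans hxy.le) hy le_rfl
  have hsub : Icc x y ⊆ Icc (0 : ℝ) 1 := Icc_subset_Icc hx hy.le
  calc P.hazardBid θ y
      ≤ ∫⁻ t in Icc 0 x ∪ Icc x y,
          ENNReal.ofReal t * (P.condDensity θ t / P.condLaw θ (Ici t)) :=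
        lintegral_mono_set (by rw [Icc_union_Icc_eq_Icc hx hxy.le])
    _ ≤ P.hazardBid θ x + ∫⁻ t in Icc x y,
          ENNReal.ofReal t * (P.condDensity θ t / P.condLaw θ (Ici t)) := lintegral_union_le _ _ _
    _ ≤ P.hazardBid θ x + ∫⁻ t in Icc x y,
          ENNReal.ofReal (y / (∫ z in Icc y 1, P.density θ z) * P.density θ t) := by
        gcongr 1
        refine setLIntegral_mono' measurableSet_Icc fun t ht => ?_
        have ht' := hsub ht
        calc _ ≤ ENNReal.ofReal y * (P.condDensity θ t / P.condLaw θ (Ici y)) := by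
              gcongr
              · exact ht.2
              · exact ht.2
          _ = _ := by
              rw [hP.condLaw_Ici_eq hθ (hx.trans hxy.le), condDensity,
                ← ENNReal.ofReal_div_of_pos (div_pos hG hm), ← ENNReal.ofReal_mul (hx.trans hxy.le),
                div_div_div_cancel_right₀ hm.ne']
              congr 1
              ring
    _ = _ := by
        rw [← integral_const_mul, ofReal_integral_eq_lintegral_ofReal]
        · exact (hP.integrableOn hθ hsub).const_mul _
        · filter_upwards [self_mem_ae_restrict measurableSet_Icc] with t ht
          exact mul_nonneg (div_nonneg (hx.trans hxy.le) hG.le) (P.density_pos θ hθ t (hsub ht)).le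

theorem hazardBid_ne_top (hP : P.IsC1) {θ : ℝ} (hθ : θ ∈ Icc (0 : ℝ) 1) {x : ℝ}
    (hx : x ∈ Ico (0 : ℝ) 1) : P.hazardBid θ x ≠ ∞ := by
  have h0 : P.hazardBid θ 0 = 0 := by simp [hazardBid]
  rcases hx.1.eq_or_lt with rfl | h
  · simp [h0]
  · refine ne_top_of_le_ne_top ?_ (hazardBid_le_add hP hθ le_rfl h hx.2)
    rw [h0, zero_add]
    exact ENNReal.ofReal_ne_top

theorem hazardBid_mono (P : Belief) (θ : ℝ) : Monotone (P.hazardBid θ) := fun _ _ h =>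
  lintegral_mono_set (Icc_subset_Icc_right h)

end Belief

namespace IsSymmetricIncreasingEquilibrium

variable {P : Belief} {β : ℝ → ℝ≥0∞}

/-- Passes from the belief of `x` to that of `θ ≥ x`: given that the competitor's type is at least
`x`, the higher type finds it less likely to be at most `y`. This is Chebyshev's inequality on
`[x,1]` for the decreasing indicator of `Iic y`. -/
theorem mul_integral_le_warOfAttrition_of_le
    (h : IsSymmetricIncreasingEquilibrium P .warOfAttrition β) (hP : P.IsC1) (hA : P.IsAffiliated)
    {θ x y : ℝ} (hθ : θ ∈ Icc (0 : ℝ) 1) (hx : 0 ≤ x) (hxy : x < y) (hy : y < 1) (hxθ : x ≤ θ) :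
    x / (∫ z in Icc x 1, P.density θ z) * (∫ z in Icc x y, P.density θ z)
      ≤ (β y).toReal - (β x).toReal := by
  have hx' : x ∈ Icc (0 : ℝ) 1 := ⟨hx, hxy.le.trans hy.le⟩
  have hsub : Icc x 1 ⊆ Icc (0 : ℝ) 1 := Icc_subset_Icc_left hx
  have hG := hP.integral_Icc_pos hθ hx (hxy.trans hy) le_rfl
  have hGx := hP.integral_Icc_pos hx' hx (hxy.trans hy) le_rfl
  have h1 := h.mul_integral_le_warOfAttrition hP hx hxy hy
  have hind : ∀ ψ, (fun z => (Iic y).indicator (fun _ => (1 : ℝ)) z * P.density ψ z)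
      = (Iic y).indicator (P.density ψ) := fun ψ => by
    ext z
    by_cases hz : z ∈ Iic y <;> simp [hz]
  have hint : ∀ ψ, (∫ z in Icc x 1, (Iic y).indicator (fun _ => (1 : ℝ)) z * P.density ψ z)
      = ∫ z in Icc x y, P.density ψ z := fun ψ => by
    rw [hind, integral_indicator measurableSet_Iic, Measure.restrict_restrict measurableSet_Iic]
    congr 2
    ext z
    simp only [mem_inter_iff, mem_Iic, mem_Icc]
    exact ⟨fun hz => ⟨hz.2.1, hz.1⟩, fun hz => ⟨hz.2, hz.1, hz.2.trans hy.le⟩⟩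
  have hi : ∀ ψ ∈ Icc (0 : ℝ) 1, IntegrableOn
      (fun z => (Iic y).indicator (fun _ => (1 : ℝ)) z * P.density ψ z) (Icc x 1) :=
    fun ψ hψ => by
      rw [hind]
      exact (hP.integrableOn hψ hsub).indicator measurableSet_Iic
  have h2 := integral_mul_integral_le_of_ratio measurableSet_Icc (hP.integrableOn hθ hsub)
    (hP.integrableOn hx' hsub) (hi θ hθ) (hi x hx') fun z hz w hw => by
      have hanti : ∀ u v : ℝ, u ≤ v → (Iic y).indicator (fun _ => (1 : ℝ)) v
          ≤ (Iic y).indicator (fun _ => (1 : ℝ)) u := fun u v huv => by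
        by_cases hv : v ∈ Iic y
        · rw [indicator_of_mem hv, indicator_of_mem (show u ∈ Iic y from huv.trans hv)]
        · rw [indicator_of_notMem hv]
          exact indicator_nonneg (fun _ _ => zero_le_one) u
      rcases le_total z w with hzw | hzw
      · refine mul_nonneg (sub_nonneg.2 (hanti _ _ hzw)) ?_
        linarith [hA.mul_le_mul hx' hθ (hsub hz) (hsub hw) hxθ hzw]
      · refine mul_nonneg_of_nonpos_of_nonpos (sub_nonpos.2 (hanti _ _ hzw)) ?_
        linarith [hA.mul_le_mul hx' hθ (hsub hw) (hsub hz) hxθ hzw]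
  rw [hint, hint] at h2
  rw [div_mul_eq_mul_div, div_le_iff₀ hG]
  refine le_of_mul_le_mul_right ?_ hGx
  nlinarith [mul_le_mul_of_nonneg_left h2 hx, mul_le_mul_of_nonneg_right h1 hG.le]

/-- The lower bound for `β` and the upper bound for the hazard bid differ by `ψ y - ψ x` times the
mass of `[x,y]`, at most `M (ψ y - ψ x)(y - x)`, an error that `le_of_forall_increment_ge` absorbs.
-/
theorem monotoneOn_sub_hazardBid
    (h : IsSymmetricIncreasingEquilibrium P .warOfAttrition β) (hP : P.IsC1) (hA : P.IsAffiliated)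
    {θ : ℝ} (hθ : θ ∈ Icc (0 : ℝ) 1) :
    MonotoneOn (fun z => (β z).toReal - (P.hazardBid θ z).toReal) (Icc 0 θ ∩ Ico 0 1) := by
  intro a ha b hb hab
  rcases hab.eq_or_lt with rfl | hab
  · exact le_rfl
  obtain ⟨m, M, -, hM, hmM⟩ := hP.exists_bounds
  refine le_of_forall_increment_ge (g := fun z => (β z).toReal - (P.hazardBid θ z).toReal)
    (ψ := fun y => y / ∫ z in Icc y 1, P.density θ z) (C := M) hab
    fun x y hx hxy hy => ?_
  have hx0 : 0 ≤ x := ha.2.1.trans hx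
  have hy1 : y < 1 := hy.trans_lt hb.2.2
  have h1 := h.mul_integral_le_warOfAttrition_of_le hP hA hθ hx0 hxy hy1
    (hxy.le.trans (hy.trans hb.1.2))
  have hfx := Belief.hazardBid_ne_top hP hθ (x := x) ⟨hx0, hxy.trans hy1⟩
  have h2 := ENNReal.toReal_mono (by finiteness) (Belief.hazardBid_le_add hP hθ hx0 hxy hy1)
  have hG := hP.integral_Icc_pos hθ hx0 (hxy.trans hy1) le_rfl
  have hGy := hP.integral_Icc_pos hθ (hx0.trans hxy.le) hy1 le_rfl
  have hI := hP.integral_Icc_pos hθ hx0 hxy hy1.le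
  have hy0 : 0 ≤ y := hx0.trans hxy.le
  have hIM : ∫ z in Icc x y, P.density θ z ≤ M * (y - x) := by
    calc _ ≤ ∫ z in Icc x y, M := by
          refine setIntegral_mono_on (hP.integrableOn hθ (Icc_subset_Icc hx0 hy1.le)) (by simp)
            measurableSet_Icc fun z hz => (hmM θ hθ z ⟨hx0.trans hz.1, hz.2.trans hy1.le⟩).2
      _ = _ := by simp [hxy.le, mul_comm]
  rw [ENNReal.toReal_add hfx ENNReal.ofReal_ne_top, ENNReal.toReal_ofReal (by positivity)] at h2
  have hψ : x / (∫ z in Icc x 1, P.density θ z) ≤ y / ∫ z in Icc y 1, P.density θ z := by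
    have : ∫ z in Icc y 1, P.density θ z ≤ ∫ z in Icc x 1, P.density θ z := by
      refine setIntegral_mono_set (hP.integrableOn hθ (Icc_subset_Icc_left hx0)) ?_
        (Icc_subset_Icc_left hxy.le).eventuallyLE
      filter_upwards [self_mem_ae_restrict measurableSet_Icc] with z hz
      exact (P.density_pos θ hθ z ⟨hx0.trans hz.1, hz.2⟩).le
    gcongr
  nlinarith [mul_le_mul_of_nonneg_left hIM (sub_nonneg.2 hψ)]

end IsSymmetricIncreasingEquilibrium

/-- Split `t^W - t^II` as `(t^W - B) + (B - t^II)`. The first part is non-decreasing in the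
competitor's type; the second has mean zero under the belief of `θ`, and under that of `φ` a mean
with the sign of `φ - θ`. -/
theorem linkageUnderAffiliation_secondPrice_warOfAttrition :
    LinkageUnderAffiliation .secondPrice .warOfAttrition := by
  intro P _ hA hP βX βY hX hY
  refine Or.inl fun θ hθ => ?_
  refine hP.partialDerivLE one_pos le_rfl hθ (fun _ hφ => hP.expectedPayment_eq_condLmean _ _ hφ)
    (fun _ hφ => hP.expectedPayment_eq_condLmean _ _ hφ) (hX.aemeasurable_transfer θ le_rfl)
    (hX.lintegral_transfer_ne_top hP hθ le_rfl) (hY.aemeasurable_transfer θ le_rfl)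
    (hY.lintegral_transfer_ne_top hP hθ le_rfl) fun φ hφ => ?_
  have hiX := integrable_toReal_of_lintegral_ne_top (hX.aemeasurable_transfer θ le_rfl)
    (hX.lintegral_transfer_ne_top hP hθ le_rfl)
  have hiY := integrable_toReal_of_lintegral_ne_top (hY.aemeasurable_transfer θ le_rfl)
    (hY.lintegral_transfer_ne_top hP hθ le_rfl)
  set B : ℝ → ℝ≥0∞ := fun z => P.hazardBid θ (min θ z) with hB
  have hBm : Measurable B :=
    ((P.hazardBid_mono θ).comp fun _ _ h => min_le_min_left θ h).measurable
  -- the expected payment in the second-price auction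
  have hS : ∀ ψ ∈ Icc (0 : ℝ) 1, P.condLmean 1 (Auction.secondPrice.transfer βX θ) ψ
      = ∫⁻ x in Icc 0 θ, ENNReal.ofReal x * P.condDensity ψ x := by
    intro ψ hψ
    rw [← hP.expectedPayment_eq_condLmean _ _ hψ, expectedPayment]
    have hsub : Icc 0 θ ∩ Icc 0 1 = Icc 0 θ := inter_eq_left.2 (Icc_subset_Icc_right hθ.2)
    conv_rhs => rw [← hsub, ← Measure.restrict_restrict measurableSet_Icc,
      ← lintegral_indicator measurableSet_Icc]
    rw [P.lintegral_condLaw]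
    refine lintegral_congr_ae ?_
    filter_upwards [self_mem_ae_restrict measurableSet_Icc,
      ae_restrict_of_ae (Measure.ae_ne volume θ)] with z hz hne
    rcases lt_or_gt_of_ne hne with hlt | hlt
    · rw [hX.transfer_secondPrice_of_lt hP hθ hz.1 hlt,
        indicator_of_mem (show z ∈ Icc 0 θ from ⟨hz.1, hlt.le⟩), mul_comm]
      rfl
    · rw [hX.transfer_secondPrice_of_gt hP hθ.1 hlt hz.2, mul_zero,
        indicator_of_notMem fun hcon => not_le.2 hlt hcon.2]
  have hT : ∀ ψ ∈ Icc (0 : ℝ) 1, P.condLmean 1 B ψ = ∫⁻ z, B z ∂(P.condLaw ψ) := fun ψ hψ =>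
    (hP.expectedPayment_eq_condLmean (fun _ => B) θ hψ).symm
  have hTS : P.condLmean 1 B θ = P.condLmean 1 (Auction.secondPrice.transfer βX θ) θ := by
    rw [hS θ hθ, hT θ hθ, hB, P.lintegral_hazardBid_self hP hθ]
  have hXeq := fun ψ hψ => hP.condLmean_eq one_pos le_rfl (hX.aemeasurable_transfer θ le_rfl)
    (hX.lintegral_transfer_ne_top hP hθ le_rfl) (φ := ψ) hψ
  have hBfin : ∫⁻ z in Icc 0 1, B z ≠ ∞ := by
    refine hP.lintegral_ne_top hθ ?_
    rw [← hT θ hθ, hTS, hXeq θ hθ]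
    exact ENNReal.ofReal_ne_top
  have hBeq := fun ψ hψ => hP.condLmean_eq one_pos le_rfl hBm.aemeasurable hBfin (φ := ψ) hψ
  have hiB := integrable_toReal_of_lintegral_ne_top hBm.aemeasurable hBfin
  have hiYB : IntegrableOn (fun z => (Auction.warOfAttrition.transfer βY θ z).toReal
      - (B z).toReal) (Icc 0 1) := hiY.sub hiB
  have hu : MonotoneOn (fun z => (Auction.warOfAttrition.transfer βY θ z).toReal - (B z).toReal)
      (Ioo 0 1) := by
    intro z hz z' hz' hle
    have hmin : ∀ w ∈ Ioo (0 : ℝ) 1, min θ w ∈ Icc 0 θ ∩ Ico 0 1 := fun w hw =>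
      ⟨⟨le_min hθ.1 hw.1.le, min_le_left _ _⟩, le_min hθ.1 hw.1.le, (min_le_right _ _).trans_lt hw.2⟩
    have htr : ∀ w ∈ Ioo (0 : ℝ) 1, Auction.warOfAttrition.transfer βY θ w = βY (min θ w) :=
      fun w hw => (hY.1.map_min hθ (Ioo_subset_Icc_self hw)).symm
    simp only [htr z hz, htr z' hz', hB]
    exact hY.monotoneOn_sub_hazardBid hP hA hθ (hmin z hz) (hmin z' hz') (min_le_min_left θ hle)
  have hdec : ∀ ψ ∈ Icc (0 : ℝ) 1, P.condMean 1 (fun z =>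
        (Auction.warOfAttrition.transfer βY θ z).toReal
          - (Auction.secondPrice.transfer βX θ z).toReal) ψ
      = P.condMean 1 (fun z => (Auction.warOfAttrition.transfer βY θ z).toReal - (B z).toReal) ψ
        + (P.condMean 1 (fun z => (B z).toReal) ψ
          - P.condMean 1 (fun z => (Auction.secondPrice.transfer βX θ z).toReal) ψ) :=
    fun ψ hψ => by
      rw [hP.condMean_sub le_rfl hiY hiX hψ, hP.condMean_sub le_rfl hiY hiB hψ]
      ring
  have hnX := fun ψ hψ => P.condMean_nonneg le_rfl (Auction.secondPrice.transfer βX θ) (φ := ψ) hψ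
  have hnB := fun ψ hψ => P.condMean_nonneg le_rfl B (φ := ψ) hψ
  have h0 : P.condMean 1 (fun z => (B z).toReal) θ
      = P.condMean 1 (fun z => (Auction.secondPrice.transfer βX θ z).toReal) θ := by
    rw [hBeq θ hθ, hXeq θ hθ] at hTS
    exact (ENNReal.ofReal_eq_ofReal_iff (hnB θ hθ) (hnX θ hθ)).1 hTS
  rw [hdec φ hφ, hdec θ hθ, h0, sub_self, add_zero]
  rcases le_total θ φ with hle | hle
  · refine mul_nonneg (sub_nonneg.2 hle) ?_
    have h1 := hP.condMean_mono hA one_pos le_rfl hiYB hu hθ hφ hle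
    have h2 := hA.le_lintegral_hazardBid hP hθ hφ hle
    rw [← hS φ hφ, ← hT φ hφ, hXeq φ hφ, hBeq φ hφ,
      ENNReal.ofReal_le_ofReal_iff (hnB φ hφ)] at h2
    linarith
  · refine mul_nonneg_of_nonpos_of_nonpos (sub_nonpos.2 hle) ?_
    have h1 := hP.condMean_mono hA one_pos le_rfl hiYB hu hφ hθ hle
    have h2 := hA.lintegral_hazardBid_le hP hθ hφ hle
    rw [← hS φ hφ, ← hT φ hφ, hXeq φ hφ, hBeq φ hφ,
      ENNReal.ofReal_le_ofReal_iff (hnX φ hφ)] at h2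
    linarith

/-! ### Verification of equilibria -/

theorem Auction.payment_mono_left {X : Auction} (hX : X ≠ .secondPrice) {a a' : ℝ≥0∞}
    (h : a ≤ a') (b : ℝ≥0∞) : X.payment a b ≤ X.payment a' b := by
  cases X
  · exact mul_le_mul' h (winShare_mono_left h b)
  · exact absurd rfl hX
  · exact h
  · exact min_le_min_right b h

/-- A strictly increasing, left-continuous strategy is an equilibrium if no type gains by
imitating another one. -/
theorem isSymmetricIncreasingEquilibrium_of_imitation {P : Belief} (hP : P.IsC1) {X : Auction}
    (hX : X ≠ .secondPrice) {β : ℝ → ℝ≥0∞} (hs : StrictMonoOn β (Icc 0 1))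
    (hleft : ∀ x ∈ Icc (0 : ℝ) 1, ∀ a, (∀ z ∈ Icc (0 : ℝ) 1, z < x → β z ≤ a) → β x ≤ a)
    (hfin : ∀ θ ∈ Icc (0 : ℝ) 1, ∫⁻ z, X.payment (β θ) (β z) ∂(P.condLaw θ) ≠ ∞)
    (hIC : ∀ θ ∈ Icc (0 : ℝ) 1, ∀ x ∈ Icc (0 : ℝ) 1,
      ENNReal.ofReal θ * P.condLaw θ (Icc 0 x) + ∫⁻ z, X.payment (β θ) (β z) ∂(P.condLaw θ)
        ≤ ENNReal.ofReal θ * P.condLaw θ (Icc 0 θ)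
          + ∫⁻ z, X.payment (β x) (β z) ∂(P.condLaw θ)) :
    IsSymmetricIncreasingEquilibrium P X β := by
  refine ⟨hs.monotoneOn, fun θ hθ a => (interimPayoff_le_iff hP hθ (hfin θ hθ)).2 ?_⟩
  have hwin : ∀ x ∈ Icc (0 : ℝ) 1, ∀ b, (∀ z ∈ Icc (0 : ℝ) 1, z < x → β z < b) →
      (∀ z ∈ Icc (0 : ℝ) 1, x < z → b < β z) →
      ∫⁻ z, winShare b (β z) ∂(P.condLaw θ) = P.condLaw θ (Icc 0 x) := by
    intro x hx b h1 h2
    rw [← lintegral_indicator_one measurableSet_Icc]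
    refine lintegral_congr_ae ?_
    filter_upwards [P.ae_mem_Ioo_condLaw θ, P.ae_ne_condLaw θ x] with z hz hne
    have hz' := Ioo_subset_Icc_self hz
    rcases lt_or_gt_of_ne hne with h | h
    · rw [winShare_of_lt (h1 z hz' h), indicator_of_mem (show z ∈ Icc 0 x from ⟨hz'.1, h.le⟩)]
      rfl
    · rw [winShare_of_gt (h2 z hz' h), indicator_of_notMem fun hcon => not_le.2 h hcon.2]
  -- The bid `a` wins exactly as often as the bid of the type `x` at which `β` passes `a`.
  -- Left-continuity gives `β x ≤ a`, so imitating `x` costs no more.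
  obtain ⟨x, hx, h1, h2⟩ := exists_threshold
    (S := {z | z ∈ Icc (0 : ℝ) 1 ∧ β z ≤ a}) fun z hz => hz.1
  have hlt : ∀ z ∈ Icc (0 : ℝ) 1, z < x → β z < a := fun z hz hzx => by
    obtain ⟨w, ⟨hw, hwa⟩, hzw⟩ := h1 z hz hzx
    exact (hs hz hw hzw).trans_le hwa
  have hgt : ∀ z ∈ Icc (0 : ℝ) 1, x < z → a < β z := fun z hz hxz => by
    have := h2 z hxz
    simp only [mem_ofPred_eq, not_and, not_le] at this
    exact this hz
  have hxa : β x ≤ a := hleft x hx a fun z hz hzx => (hlt z hz hzx).le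
  rw [hwin x hx a hlt hgt, hwin θ hθ (β θ) (fun z hz h => hs hz hθ h) fun z hz h => hs hθ hz h]
  refine (hIC θ hθ x hx).trans (add_le_add le_rfl (lintegral_mono fun z => ?_))
  exact Auction.payment_mono_left hX hxa _

/-- Truthful bidding is weakly dominant, so the comparison holds pointwise in the competitor's type.
-/
theorem isSymmetricIncreasingEquilibrium_secondPrice {P : Belief} (hP : P.IsC1) :
    IsSymmetricIncreasingEquilibrium P .secondPrice ENNReal.ofReal := by
  have hm : MonotoneOn ENNReal.ofReal (Icc 0 1) := fun _ _ _ _ h => ENNReal.ofReal_le_ofReal h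
  refine ⟨hm, fun θ hθ a => ?_⟩
  have hw : ∀ b, Measurable fun z => winShare b (ENNReal.ofReal z) := fun b =>
    (measurable_winShare b).comp ENNReal.measurable_ofReal
  rw [interimPayoff_le_iff hP hθ]
  · rw [← lintegral_const_mul _ (hw _), ← lintegral_const_mul _ (hw _),
      ← lintegral_add_left ((hw _).const_mul _), ← lintegral_add_left ((hw _).const_mul _)]
    exact lintegral_mono fun z => mul_winShare_add_le ENNReal.ofReal_ne_top _ _
  · have := hP.isProbabilityMeasure_condLaw hθ
    refine (lt_of_le_of_lt (b := ∫⁻ _, 1 ∂(P.condLaw θ)) (lintegral_mono_ae ?_) (by simp)).ne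
    filter_upwards [P.ae_mem_Ioo_condLaw θ] with z hz
    calc _ ≤ ENNReal.ofReal 1 * 1 := mul_le_mul' (ENNReal.ofReal_le_ofReal hz.2.le)
          (winShare_le_one _ _)
      _ = 1 := by simp

theorem setLIntegral_Icc_add {b : ℝ → ℝ≥0∞} {x y : ℝ} (hx : 0 ≤ x) (hxy : x ≤ y) :
    ∫⁻ z in Icc 0 y, b z = (∫⁻ z in Icc 0 x, b z) + ∫⁻ z in Ioo x y, b z := by
  rw [← Icc_union_Ioc_eq_Icc hx hxy, lintegral_union measurableSet_Ioc, restrict_Ioo_eq_restrict_Ioc]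
  exact Set.disjoint_left.2 fun z hz hz' => absurd hz.2 (not_le.2 hz'.1)

/-- Left-continuity of `x ↦ ∫₀ˣ b`, by monotone convergence along intervals that exhaust `[0,x)`; it
holds even where the integral is infinite. -/
theorem setLIntegral_Icc_le_of_forall_lt {b : ℝ → ℝ≥0∞} {x : ℝ} {a : ℝ≥0∞}
    (hx : x ∈ Icc (0 : ℝ) 1)
    (h : ∀ z ∈ Icc (0 : ℝ) 1, z < x → ∫⁻ y in Icc 0 z, b y ≤ a) : ∫⁻ y in Icc 0 x, b y ≤ a := by
  rcases hx.1.eq_or_lt with rfl | hx0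
  · simp
  have hU : Ico 0 x = ⋃ n : ℕ, Icc 0 (x * (1 - 1 / (n + 1))) := by
    ext y
    simp only [mem_Ico, mem_iUnion, mem_Icc]
    constructor
    · rintro ⟨h0, hy⟩
      obtain ⟨n, hn⟩ := exists_nat_one_div_lt (sub_pos.2 ((div_lt_one hx0).2 hy))
      refine ⟨n, h0, ?_⟩
      have : y / x ≤ 1 - 1 / ((n : ℝ) + 1) := by linarith
      rwa [div_le_iff₀ hx0, mul_comm] at this
    · rintro ⟨n, h0, hy⟩
      refine ⟨h0, hy.trans_lt ?_⟩
      have : 0 < 1 / ((n : ℝ) + 1) := by positivity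
      nlinarith
  have hdir : Directed (· ⊆ ·) fun n : ℕ => Icc 0 (x * (1 - 1 / ((n : ℝ) + 1))) := by
    refine Monotone.directed_le fun n m hnm => Icc_subset_Icc_right ?_
    have : (n : ℝ) ≤ m := by exact_mod_cast hnm
    gcongr
  rw [← restrict_Ico_eq_restrict_Icc, hU, setLIntegral_iUnion_of_directed _ hdir]
  refine iSup_le fun n => ?_
  have h1 : 0 < 1 / ((n : ℝ) + 1) := by positivity
  have h2 : 1 / ((n : ℝ) + 1) ≤ 1 := by
    rw [div_le_one (by positivity)]; linarith [n.cast_nonneg (α := ℝ)]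
  exact h _ ⟨by nlinarith, by nlinarith [hx.2]⟩ (by nlinarith)

/-- Equilibria given by a bidding density, for auctions in which the expected payment is the
integral of a cost density. -/
theorem isSymmetricIncreasingEquilibrium_of_density {P : Belief} (hP : P.IsC1) {X : Auction}
    (hX : X ≠ .secondPrice) {b : ℝ → ℝ≥0∞} (hb : Measurable b) (hpos : ∀ z ∈ Ioo (0 : ℝ) 1, 0 < b z)
    (hbfin : ∀ x ∈ Ico (0 : ℝ) 1, ∫⁻ z in Icc 0 x, b z ≠ ∞) {c : ℝ → ℝ → ℝ≥0∞}
    (hpay : ∀ θ ∈ Icc (0 : ℝ) 1, ∀ x ∈ Icc (0 : ℝ) 1,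
      ∫⁻ z, X.payment (∫⁻ y in Icc 0 x, b y) (∫⁻ y in Icc 0 z, b y) ∂(P.condLaw θ)
        = ∫⁻ z in Icc 0 x, c θ z)
    (hle : ∀ θ ∈ Icc (0 : ℝ) 1, ∀ y ∈ Ioo (0 : ℝ) 1, y ≤ θ →
      c θ y ≤ ENNReal.ofReal θ * P.condDensity θ y)
    (hge : ∀ θ ∈ Icc (0 : ℝ) 1, ∀ y ∈ Ioo (0 : ℝ) 1, θ ≤ y →
      ENNReal.ofReal θ * P.condDensity θ y ≤ c θ y) :
    IsSymmetricIncreasingEquilibrium P X fun x => ∫⁻ y in Icc 0 x, b y := by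
  have hD : ∀ θ, ∀ x ∈ Icc (0 : ℝ) 1,
      P.condLaw θ (Icc 0 x) = ∫⁻ y in Icc 0 x, P.condDensity θ y := fun θ x hx =>
    P.condLaw_apply θ measurableSet_Icc (Icc_subset_Icc_right hx.2)
  have hcm : ∀ θ x y, ENNReal.ofReal θ * ∫⁻ z in Ioo x y, P.condDensity θ z
      = ∫⁻ z in Ioo x y, ENNReal.ofReal θ * P.condDensity θ z := fun θ x y =>
    (lintegral_const_mul' _ _ ENNReal.ofReal_ne_top).symm
  refine isSymmetricIncreasingEquilibrium_of_imitation hP hX ?_ ?_ ?_ ?_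
  · intro x hx y hy hxy
    have hx1 : x < 1 := hxy.trans_le hy.2
    simp only
    rw [setLIntegral_Icc_add (b := b) hx.1 hxy.le]
    refine ENNReal.lt_add_right (hbfin x ⟨hx.1, hx1⟩) (ne_of_gt ?_)
    rw [setLIntegral_pos_iff hb]
    refine lt_of_lt_of_le ?_ (measure_mono (s := Ioo x y) fun z hz => ⟨?_, hz⟩)
    · simpa using hxy
    · exact (hpos z ⟨hx.1.trans_lt hz.1, hz.2.trans_le hy.2⟩).ne'
  · exact fun x hx a h => setLIntegral_Icc_le_of_forall_lt hx h
  · intro θ hθ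
    have := hP.isProbabilityMeasure_condLaw hθ
    rw [hpay θ hθ θ hθ, ← restrict_Ioo_eq_restrict_Icc]
    refine ne_top_of_le_ne_top ?_ (setLIntegral_mono' measurableSet_Ioo fun y hy =>
      hle θ hθ y ⟨hy.1, hy.2.trans_le hθ.2⟩ hy.2.le)
    rw [← hcm, restrict_Ioo_eq_restrict_Icc, ← hD θ θ hθ]
    exact ENNReal.mul_ne_top ENNReal.ofReal_ne_top (measure_ne_top _ _)
  · intro θ hθ x hx
    rw [hpay θ hθ θ hθ, hpay θ hθ x hx, hD θ x hx, hD θ θ hθ]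
    -- Imitating `x` yields the integral over `[0,x]` of `θ f(y|θ) - c(θ,y)`, which is non-negative
    -- below `θ` and non-positive above.
    rcases le_total x θ with h | h
    · rw [setLIntegral_Icc_add (b := c θ) hx.1 h, setLIntegral_Icc_add (b := P.condDensity θ) hx.1 h,
        mul_add, hcm, add_assoc, add_comm (∫⁻ z in Icc 0 x, c θ z)]
      refine add_le_add le_rfl (add_le_add ?_ le_rfl)
      exact setLIntegral_mono' measurableSet_Ioo fun y hy =>
        hle θ hθ y ⟨hx.1.trans_lt hy.1, hy.2.trans_le hθ.2⟩ hy.2.le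
    · rw [setLIntegral_Icc_add (b := c θ) hθ.1 h, setLIntegral_Icc_add (b := P.condDensity θ) hθ.1 h,
        mul_add, hcm, add_assoc, add_comm (∫⁻ z in Icc 0 θ, c θ z)]
      refine add_le_add le_rfl (add_le_add ?_ le_rfl)
      exact setLIntegral_mono' measurableSet_Ioo fun y hy =>
        hge θ hθ y ⟨hθ.1.trans_lt hy.1, hy.2.trans_le hx.2⟩ hy.1.le

namespace Belief

/-! ### A belief with positively dependent types -/

/-- The density proportional to `1 + 2 θ θ'`. -/
def bilinear : Belief where
  density θ z := 2 / 3 * (1 + 2 * θ * z)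
  measurable_density := by fun_prop
  density_pos θ hθ z hz := by
    have := mul_nonneg hθ.1 hz.1
    nlinarith
  total_mass := by
    have hI : IntegrableOn (fun p : ℝ × ℝ => 2 / 3 * (1 + 2 * p.1 * p.2))
        (Icc (0 : ℝ) 1 ×ˢ Icc (0 : ℝ) 1) :=
      ContinuousOn.integrableOn_compact (isCompact_Icc.prod isCompact_Icc)
        (Continuous.continuousOn (by fun_prop))
    rw [← ofReal_integral_eq_lintegral_ofReal hI]
    · have h1 : ∫ z in Icc (0 : ℝ) 1, z = 1 / 2 := by
        rw [integral_Icc_eq_integral_Ioc, ← intervalIntegral.integral_of_le zero_le_one, integral_id]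
        norm_num
      have hi : Integrable (fun z : ℝ => z) (volume.restrict (Icc (0 : ℝ) 1)) :=
        continuous_id.continuousOn.integrableOn_Icc
      rw [integral_const_mul, Measure.volume_eq_prod, ← Measure.prod_restrict, integral_add]
      · simp_rw [mul_assoc]
        rw [integral_const_mul, integral_prod_mul (fun z : ℝ => z) fun z : ℝ => z, h1]
        have : ((volume.restrict (Icc (0 : ℝ) 1)).prod (volume.restrict (Icc (0 : ℝ) 1))).real univ
            = 1 := by
          rw [measureReal_def, ← univ_prod_univ, Measure.prod_prod]
          simp
        rw [integral_const, this]
        norm_num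
      · exact integrable_const _
      · simp_rw [mul_assoc]
        exact (hi.mul_prod hi).const_mul 2
    · filter_upwards [self_mem_ae_restrict (measurableSet_Icc.prod measurableSet_Icc)] with p hp
      have := mul_nonneg hp.1.1 hp.2.1
      simp only [Pi.zero_apply]
      nlinarith

theorem isSymmetric_bilinear : bilinear.IsSymmetric := fun θ _ z _ => by
  simp only [bilinear]; ring

theorem isAffiliated_bilinear : bilinear.IsAffiliated := by
  intro θ _ z _ φ _ w _
  simp only [bilinear]
  rcases le_total θ φ with h | h <;> rcases le_total z w with h' | h' <;>
    simp only [h, h', max_eq_left, max_eq_right, min_eq_left, min_eq_right] <;>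
    nlinarith [mul_nonneg (sub_nonneg.2 h) (sub_nonneg.2 h')]

theorem isC1_bilinear : bilinear.IsC1 := by
  unfold IsC1 bilinear
  fun_prop

theorem integral_bilinear {θ x y : ℝ} (hxy : x ≤ y) :
    ∫ z in Icc x y, bilinear.density θ z = 2 / 3 * ((y - x) * (1 + θ * (x + y))) := by
  simp only [bilinear]
  rw [integral_Icc_eq_integral_Ioc, ← intervalIntegral.integral_of_le hxy,
    intervalIntegral.integral_const_mul, intervalIntegral.integral_add (by simp)
      (Continuous.intervalIntegrable (by fun_prop) _ _),
    intervalIntegral.integral_const_mul, integral_id]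
  simp
  ring

theorem marginal_bilinear (θ : ℝ) : bilinear.marginal θ = 2 / 3 * (1 + θ) := by
  rw [marginal, integral_bilinear zero_le_one]
  ring

theorem condDensity_bilinear (θ z : ℝ) :
    bilinear.condDensity θ z = ENNReal.ofReal ((1 + 2 * θ * z) / (1 + θ)) := by
  rw [condDensity, marginal_bilinear]
  simp only [bilinear]
  rw [mul_div_mul_left _ _ (by norm_num)]

theorem condLaw_Icc_bilinear {θ x : ℝ} (hθ : θ ∈ Icc (0 : ℝ) 1) (hx : x ∈ Icc (0 : ℝ) 1) :
    bilinear.condLaw θ (Icc 0 x) = ENNReal.ofReal (x * (1 + θ * x) / (1 + θ)) := by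
  rw [isC1_bilinear.condLaw_eq_ofReal hθ measurableSet_Icc (Icc_subset_Icc_right hx.2),
    integral_bilinear hx.1, marginal_bilinear, mul_div_mul_left _ _ (by norm_num)]
  simp

theorem condLaw_Ici_bilinear {θ x : ℝ} (hθ : θ ∈ Icc (0 : ℝ) 1) (hx : x ∈ Icc (0 : ℝ) 1) :
    bilinear.condLaw θ (Ici x) = ENNReal.ofReal ((1 - x) * (1 + θ * (x + 1)) / (1 + θ)) := by
  rw [isC1_bilinear.condLaw_Ici_eq hθ hx.1, integral_bilinear hx.2, marginal_bilinear,
    mul_div_mul_left _ _ (by norm_num)]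

/-! ### Its equilibria -/

/-- The first-order condition gives the bidding density `y f(y|y)`. Imitation does not pay because
`θ f(y|θ)` is non-decreasing in `θ`, despite the dependence of types. -/
theorem isSymmetricIncreasingEquilibrium_allPay_bilinear :
    IsSymmetricIncreasingEquilibrium bilinear .allPay fun x =>
      ∫⁻ y in Icc 0 x, ENNReal.ofReal (y * (1 + 2 * y * y) / (1 + y)) := by
  have hcmp : ∀ u v y : ℝ, 0 ≤ u → u ≤ v → 0 ≤ y →
      u * ((1 + 2 * u * y) / (1 + u)) ≤ v * ((1 + 2 * v * y) / (1 + v)) := by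
    intro u v y hu huv hy
    have hv := hu.trans huv
    have h1 : u / (1 + u) ≤ v / (1 + v) := by
      rw [div_le_div_iff₀ (by positivity) (by positivity)]
      nlinarith
    calc _ = u / (1 + u) * (1 + 2 * u * y) := by ring
      _ ≤ v / (1 + v) * (1 + 2 * v * y) := by gcongr
      _ = _ := by ring
  refine isSymmetricIncreasingEquilibrium_of_density isC1_bilinear (by simp) (by fun_prop)
    (fun z hz => ?_) (fun x hx => ?_)
    (c := fun _ y => ENNReal.ofReal (y * (1 + 2 * y * y) / (1 + y))) (fun θ hθ x hx => ?_)
    (fun θ hθ y hy h => ?_) fun θ hθ y hy h => ?_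
  · have := hz.1
    exact ENNReal.ofReal_pos.2 (by positivity)
  · refine ((setLIntegral_mono' measurableSet_Icc (g := fun _ => ENNReal.ofReal 3)
      fun z hz => ENNReal.ofReal_le_ofReal ?_).trans_lt ?_).ne
    · have h0 := hz.1
      have h1 : z ≤ 1 := hz.2.trans hx.2.le
      rw [div_le_iff₀ (by positivity)]
      nlinarith [mul_nonneg h0 h0, mul_nonneg h0 (mul_nonneg h0 h0),
        mul_le_mul_of_nonneg_left h1 (mul_nonneg h0 h0), mul_le_mul_of_nonneg_left h1 h0]
    · simp [ENNReal.mul_lt_top_iff]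
  · have := isC1_bilinear.isProbabilityMeasure_condLaw hθ
    simp [Auction.payment]
  · rw [condDensity_bilinear, ← ENNReal.ofReal_mul hθ.1, mul_div_assoc]
    exact ENNReal.ofReal_le_ofReal (hcmp y θ y hy.1.le h hy.1.le)
  · rw [condDensity_bilinear, ← ENNReal.ofReal_mul hθ.1, mul_div_assoc]
    exact ENNReal.ofReal_le_ofReal (hcmp θ y y hθ.1 h hy.1.le)

/-- The bidding density is `y f(y|y) / (1 - F(y|y))`. Its cost for type `θ` is weighted by the
survival probability under her own belief. Once that common factor is split off, the comparison
reduces to the monotonicity in `θ` of `θ` times her hazard rate. -/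
theorem isSymmetricIncreasingEquilibrium_warOfAttrition_bilinear :
    IsSymmetricIncreasingEquilibrium bilinear .warOfAttrition fun x =>
      ∫⁻ y in Icc 0 x, ENNReal.ofReal (y * (1 + 2 * y * y) / (1 - y ^ 3)) := by
  have hcmp : ∀ u v y : ℝ, 0 ≤ u → u ≤ v → 0 ≤ y →
      u * (1 + 2 * u * y) / (1 + u * (y + 1)) ≤ v * (1 + 2 * v * y) / (1 + v * (y + 1)) := by
    intro u v y hu huv hy
    have hv := hu.trans huv
    have h1 : u / (1 + u * (y + 1)) ≤ v / (1 + v * (y + 1)) := by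
      rw [div_le_div_iff₀ (by positivity) (by positivity)]
      nlinarith
    calc _ = u / (1 + u * (y + 1)) * (1 + 2 * u * y) := by ring
      _ ≤ v / (1 + v * (y + 1)) * (1 + 2 * v * y) := by gcongr
      _ = _ := by ring
  have hcost : ∀ θ y : ℝ, θ ∈ Icc (0 : ℝ) 1 → y ∈ Ioo (0 : ℝ) 1 →
      ENNReal.ofReal (y * (1 + 2 * y * y) / (1 - y ^ 3)) * bilinear.condLaw θ (Ici y)
      = ENNReal.ofReal (y * (1 + 2 * y * y) / (1 + y * (y + 1)) * ((1 + θ * (y + 1)) / (1 + θ))) := by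
    intro θ y hθ hy
    have h0 := hy.1
    have h1 := hθ.1
    have hy3 : 1 - y ^ 3 = (1 - y) * (1 + y * (y + 1)) := by ring
    have h2 : 0 < 1 - y := sub_pos.2 hy.2
    rw [condLaw_Ici_bilinear hθ (Ioo_subset_Icc_self hy), ← ENNReal.ofReal_mul, hy3]
    · congr 1
      field_simp
    · rw [hy3]
      positivity
  have hval : ∀ θ y : ℝ, θ ∈ Icc (0 : ℝ) 1 → y ∈ Ioo (0 : ℝ) 1 →
      ENNReal.ofReal θ * bilinear.condDensity θ y
      = ENNReal.ofReal (θ * (1 + 2 * θ * y) / (1 + θ * (y + 1)) * ((1 + θ * (y + 1)) / (1 + θ))) := by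
    intro θ y hθ hy
    have h0 := hy.1
    have h1 := hθ.1
    rw [condDensity_bilinear, ← ENNReal.ofReal_mul hθ.1]
    congr 1
    field_simp
  refine isSymmetricIncreasingEquilibrium_of_density isC1_bilinear (by simp) (by fun_prop)
    (fun z hz => ?_) (fun x hx => ?_)
    (c := fun θ y => ENNReal.ofReal (y * (1 + 2 * y * y) / (1 - y ^ 3)) * bilinear.condLaw θ (Ici y))
    (fun θ hθ x hx => ?_) (fun θ hθ y hy h => ?_) fun θ hθ y hy h => ?_
  · have h0 := hz.1
    have : z ^ 3 < 1 := pow_lt_one₀ h0.le hz.2 (by norm_num)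
    have : 0 < 1 - z ^ 3 := by linarith
    exact ENNReal.ofReal_pos.2 (by positivity)
  · refine ((setLIntegral_mono' measurableSet_Icc
      (g := fun _ => ENNReal.ofReal (3 / (1 - x ^ 3)))
      fun z hz => ENNReal.ofReal_le_ofReal ?_).trans_lt ?_).ne
    · have h0 := hz.1
      have h1 : z ≤ 1 := hz.2.trans hx.2.le
      have h3 : x ^ 3 < 1 := pow_lt_one₀ hx.1 hx.2 (by norm_num)
      have h4 : z ^ 3 ≤ x ^ 3 := pow_le_pow_left₀ h0 hz.2 3
      refine div_le_div₀ (by norm_num) ?_ (by linarith) (by linarith)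
      nlinarith [mul_nonneg h0 h0, mul_le_mul_of_nonneg_left h1 (mul_nonneg h0 h0),
        mul_le_mul_of_nonneg_left h1 h0]
    · simp [ENNReal.mul_lt_top_iff]
  · have := isC1_bilinear.isProbabilityMeasure_condLaw hθ
    rw [← lintegral_lintegral_Icc_min (by fun_prop)]
    refine lintegral_congr fun z => ?_
    have hm : Monotone fun x : ℝ =>
        ∫⁻ y in Icc 0 x, ENNReal.ofReal (y * (1 + 2 * y * y) / (1 - y ^ 3)) :=
      fun _ _ h => lintegral_mono_set (Icc_subset_Icc_right h)
    exact (hm.map_min).symm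
  · have h1 := hθ.1
    have h0 := hy.1
    rw [hcost θ y hθ hy, hval θ y hθ hy]
    refine ENNReal.ofReal_le_ofReal (mul_le_mul_of_nonneg_right (hcmp y θ y h0.le h h0.le) ?_)
    positivity
  · have h1 := hθ.1
    have h0 := hy.1
    rw [hcost θ y hθ hy, hval θ y hθ hy]
    refine ENNReal.ofReal_le_ofReal (mul_le_mul_of_nonneg_right (hcmp θ y y h1 h h0.le) ?_)
    positivity

/-- The equilibrium bid in the first-price auction. -/
def bilinearFirstPriceBid (x : ℝ) : ℝ :=
  x * (2 / 3 - 1 / (3 * (√(1 + x ^ 2) * (√(1 + x ^ 2) + 1))))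

theorem one_le_sqrt_one_add_sq (x : ℝ) : 1 ≤ √(1 + x ^ 2) :=
  Real.one_le_sqrt.2 (by nlinarith [sq_nonneg x])

theorem continuous_bilinearFirstPriceBid : Continuous bilinearFirstPriceBid := by
  unfold bilinearFirstPriceBid
  refine continuous_id.mul (continuous_const.sub (continuous_const.div (by fun_prop) fun x => ?_))
  have := one_le_sqrt_one_add_sq x
  positivity

theorem strictMonoOn_bilinearFirstPriceBid : StrictMonoOn bilinearFirstPriceBid (Ici 0) := by
  intro x hx y hy hxy
  have h1 := one_le_sqrt_one_add_sq x
  have h2 : √(1 + x ^ 2) ≤ √(1 + y ^ 2) :=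
    Real.sqrt_le_sqrt (by have : x ^ 2 ≤ y ^ 2 := pow_le_pow_left₀ hx hxy.le 2; linarith)
  have h3 : 1 / (3 * (√(1 + y ^ 2) * (√(1 + y ^ 2) + 1)))
      ≤ 1 / (3 * (√(1 + x ^ 2) * (√(1 + x ^ 2) + 1))) := by gcongr
  have h4 : 1 / (3 * (√(1 + x ^ 2) * (√(1 + x ^ 2) + 1))) ≤ 1 / 6 := by
    apply one_div_le_one_div_of_le (by norm_num)
    nlinarith
  have hx0 : 0 ≤ x := hx
  unfold bilinearFirstPriceBid
  nlinarith [mul_le_mul_of_nonneg_left h3 hx0]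

/-- The bid solves `b' = (x - b) f(x|x) / F(x|x)`, with integrating factor `x s` for `s = √(1 +
x²)`; this gives `x s b = 2s³/3 - s + 1/3`. The defining formula is this solution rewritten without
division by `x`. The payoff, up to the factor `1 / (1 + θ)`, then involves `b` only through `x (x -
b) = (s² - 1/s) / 3`. -/
theorem sub_bilinearFirstPriceBid_mul (θ x : ℝ) :
    (θ - bilinearFirstPriceBid x) * (x * (1 + θ * x))
      = (θ - x) * (x * (1 + θ * x)) + (1 + θ * x) * (1 + x ^ 2 - 1 / √(1 + x ^ 2)) / 3 := by
  have h1 := one_le_sqrt_one_add_sq x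
  have hs : √(1 + x ^ 2) ^ 2 = 1 + x ^ 2 := Real.sq_sqrt (by positivity)
  unfold bilinearFirstPriceBid
  set s := √(1 + x ^ 2)
  have hx : x ^ 2 = s ^ 2 - 1 := by linarith
  have key : (x - x * (2 / 3 - 1 / (3 * (s * (s + 1))))) * x = (1 + x ^ 2 - 1 / s) / 3 := by
    have : (x - x * (2 / 3 - 1 / (3 * (s * (s + 1))))) * x
        = x ^ 2 * (1 / 3 + 1 / (3 * (s * (s + 1)))) := by ring
    rw [this, hx]
    field_simp
    ring
  linear_combination (1 + θ * x) * key

/-- The factor next to `θ - x` is at least 1 for non-negative `θ` and `x`, so the payoff is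
single-peaked at the true type. -/
theorem hasDerivAt_firstPrice_payoff (θ x : ℝ) :
    HasDerivAt (fun x => (θ - bilinearFirstPriceBid x) * (x * (1 + θ * x)))
      ((θ - x) * (4 / 3 + 2 * θ * x - 1 / (3 * √(1 + x ^ 2) ^ 3))) x := by
  have h1 := one_le_sqrt_one_add_sq x
  have hs : √(1 + x ^ 2) ^ 2 = 1 + x ^ 2 := Real.sq_sqrt (by positivity)
  have hpos : (1 + x ^ 2 : ℝ) ≠ 0 := by positivity
  have hq : HasDerivAt (fun x : ℝ => 1 + x ^ 2) (2 * x) x := by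
    simpa using ((hasDerivAt_id x).pow 2).const_add 1
  have hinv := (hq.sqrt hpos).inv (by positivity)
  have hlin : HasDerivAt (fun x : ℝ => 1 + θ * x) θ x := by
    simpa using ((hasDerivAt_id x).const_mul θ).const_add 1
  have hF : HasDerivAt (fun x : ℝ => x * (1 + θ * x)) (1 * (1 + θ * x) + x * θ) x :=
    (hasDerivAt_id x).mul hlin
  have hmain := (((hasDerivAt_id x).const_sub θ).mul hF).add
    ((hlin.mul (hq.sub hinv)).div_const 3)
  refine (hmain.congr_deriv ?_).congr_of_eventuallyEq (Filter.Eventually.of_forall fun y => ?_)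
  · simp only [id, Pi.sub_apply, Pi.inv_apply]
    set s := √(1 + x ^ 2)
    field_simp
    linear_combination -θ * hs
  · simp only [sub_bilinearFirstPriceBid_mul, one_div, id, Pi.add_apply, Pi.mul_apply, Pi.sub_apply,
      Pi.inv_apply]

theorem firstPrice_payoff_le {θ x : ℝ} (hθ : 0 ≤ θ) (hx : 0 ≤ x) :
    (θ - bilinearFirstPriceBid x) * (x * (1 + θ * x))
      ≤ (θ - bilinearFirstPriceBid θ) * (θ * (1 + θ * θ)) := by
  have hder := hasDerivAt_firstPrice_payoff θ
  have hcont : Continuous fun x => (θ - bilinearFirstPriceBid x) * (x * (1 + θ * x)) :=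
    continuous_iff_continuousAt.2 fun x => (hder x).continuousAt
  have hfac : ∀ y, 0 ≤ y → 0 ≤ 4 / 3 + 2 * θ * y - 1 / (3 * √(1 + y ^ 2) ^ 3) := by
    intro y hy
    have h3 : 1 / (3 * √(1 + y ^ 2) ^ 3) ≤ 1 / 3 := by
      apply one_div_le_one_div_of_le (by norm_num)
      linarith [one_le_pow₀ (one_le_sqrt_one_add_sq y) (n := 3)]
    nlinarith [mul_nonneg hθ hy]
  rcases le_total x θ with h | h
  · refine monotoneOn_of_deriv_nonneg (convex_Icc 0 θ) hcont.continuousOn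
      (fun y _ => (hder y).differentiableAt.differentiableWithinAt) (fun y hy => ?_)
      ⟨hx, h⟩ ⟨hθ, le_rfl⟩ h
    rw [interior_Icc] at hy
    rw [(hder y).deriv]
    exact mul_nonneg (sub_nonneg.2 hy.2.le) (hfac y hy.1.le)
  · refine antitoneOn_of_deriv_nonpos (convex_Ici θ) hcont.continuousOn
      (fun y _ => (hder y).differentiableAt.differentiableWithinAt) (fun y hy => ?_)
      (mem_Ici.2 le_rfl) h h
    rw [interior_Ici] at hy
    rw [(hder y).deriv]
    exact mul_nonpos_of_nonpos_of_nonneg (sub_nonpos.2 hy.le) (hfac y (hθ.trans hy.le))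

theorem bilinearFirstPriceBid_nonneg {x : ℝ} (hx : 0 ≤ x) : 0 ≤ bilinearFirstPriceBid x := by
  have := strictMonoOn_bilinearFirstPriceBid.monotoneOn (mem_Ici.2 le_rfl) hx hx
  simpa [bilinearFirstPriceBid] using this

theorem strictMonoOn_ofReal_bilinearFirstPriceBid :
    StrictMonoOn (fun x => ENNReal.ofReal (bilinearFirstPriceBid x)) (Icc 0 1) := by
  intro x hx y hy hxy
  exact (ENNReal.ofReal_lt_ofReal_iff_of_nonneg (bilinearFirstPriceBid_nonneg hx.1)).2
    (strictMonoOn_bilinearFirstPriceBid hx.1 hy.1 hxy)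

theorem isSymmetricIncreasingEquilibrium_firstPrice_bilinear :
    IsSymmetricIncreasingEquilibrium bilinear .firstPrice fun x =>
      ENNReal.ofReal (bilinearFirstPriceBid x) := by
  have hs := strictMonoOn_ofReal_bilinearFirstPriceBid
  have hpay : ∀ θ ∈ Icc (0 : ℝ) 1, ∀ x ∈ Icc (0 : ℝ) 1,
      ∫⁻ z, Auction.firstPrice.payment (ENNReal.ofReal (bilinearFirstPriceBid x))
        (ENNReal.ofReal (bilinearFirstPriceBid z)) ∂(bilinear.condLaw θ)
      = ENNReal.ofReal (bilinearFirstPriceBid x) * bilinear.condLaw θ (Icc 0 x) := by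
    intro θ hθ x hx
    rw [← lintegral_indicator_one measurableSet_Icc,
      ← lintegral_const_mul' _ _ ENNReal.ofReal_ne_top]
    refine lintegral_congr_ae ?_
    filter_upwards [bilinear.ae_mem_Ioo_condLaw θ, bilinear.ae_ne_condLaw θ x] with z hz hne
    have hz' := Ioo_subset_Icc_self hz
    simp only [Auction.payment]
    rcases lt_or_gt_of_ne hne with h | h
    · rw [winShare_of_lt (hs hz' hx h), indicator_of_mem (show z ∈ Icc 0 x from ⟨hz'.1, h.le⟩)]
      rfl
    · rw [winShare_of_gt (hs hx hz' h), indicator_of_notMem fun hcon => not_le.2 h hcon.2]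
  refine isSymmetricIncreasingEquilibrium_of_imitation isC1_bilinear (by simp) hs ?_ ?_ ?_
  · intro x hx a h
    rcases hx.1.eq_or_lt with rfl | hx0
    · simp [bilinearFirstPriceBid]
    have hcont : Continuous fun x => ENNReal.ofReal (bilinearFirstPriceBid x) :=
      ENNReal.continuous_ofReal.comp continuous_bilinearFirstPriceBid
    have hne : (nhdsWithin x (Ioo 0 x)).NeBot := right_nhdsWithin_Ioo_neBot hx0
    refine le_of_tendsto (hcont.continuousAt.mono_left nhdsWithin_le_nhds :
      Filter.Tendsto _ (nhdsWithin x (Ioo 0 x)) _) ?_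
    filter_upwards [self_mem_nhdsWithin] with z hz
    exact h z ⟨hz.1.le, hz.2.le.trans hx.2⟩ hz.2
  · intro θ hθ
    have := isC1_bilinear.isProbabilityMeasure_condLaw hθ
    rw [hpay θ hθ θ hθ]
    exact ENNReal.mul_ne_top ENNReal.ofReal_ne_top (measure_ne_top _ _)
  · intro θ hθ x hx
    have h0 := hθ.1
    have h1 := hx.1
    have hbx := bilinearFirstPriceBid_nonneg h1
    have hbθ := bilinearFirstPriceBid_nonneg h0
    rw [hpay θ hθ θ hθ, hpay θ hθ x hx, condLaw_Icc_bilinear hθ hx, condLaw_Icc_bilinear hθ hθ,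
      ← ENNReal.ofReal_mul h0, ← ENNReal.ofReal_mul h0, ← ENNReal.ofReal_mul hbx,
      ← ENNReal.ofReal_mul hbθ, ← ENNReal.ofReal_add (by positivity) (by positivity),
      ← ENNReal.ofReal_add (by positivity) (by positivity)]
    refine ENNReal.ofReal_le_ofReal ?_
    have := div_le_div_of_nonneg_right (firstPrice_payoff_le h0 h1) (by positivity : 0 ≤ 1 + θ)
    simp only [mul_div_assoc] at this ⊢
    linarith

end Belief

namespace Belief

/-! ### Linkage fails for the remaining pairs -/

/-- Under the bilinear belief, the derivative of a conditional mean has the sign of the covariance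
with a uniform type. -/
theorem hasDerivWithinAt_condMean_bilinear {h : ℝ → ℝ} (hh : IntegrableOn h (Icc 0 1)) {θ : ℝ}
    (hθ : θ ∈ Icc (0 : ℝ) 1) :
    HasDerivWithinAt (bilinear.condMean 1 h) ((∫ z in Icc 0 1, h z * (2 * z - 1)) / (1 + θ) ^ 2)
      (Icc 0 1) θ := by
  have hhz : IntegrableOn (fun z => h z * z) (Icc 0 1) := by
    refine Integrable.mul_bdd (c := 1) hh aestronglyMeasurable_id ?_
    filter_upwards [self_mem_ae_restrict measurableSet_Icc] with z hz
    rw [Real.norm_of_nonneg hz.1]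
    exact hz.2
  set A := ∫ z in Icc 0 1, h z
  set C := ∫ z in Icc 0 1, h z * z
  have hnum : ∫ z in Icc 0 1, h z * (2 * z - 1) = 2 * C - A := by
    rw [← integral_const_mul, ← integral_sub (hhz.const_mul 2) hh]
    congr 1
    ext z
    ring
  have heq : ∀ φ ∈ Icc (0 : ℝ) 1, bilinear.condMean 1 h φ = (A + φ * (2 * C)) / (1 + φ) := by
    intro φ hφ
    have h1 : ∫ z in Icc (0 : ℝ) 1, bilinear.density φ z = 2 / 3 * (1 + φ) := marginal_bilinear φ
    have h2 : ∫ z in Icc 0 1, h z * bilinear.density φ z = 2 / 3 * (A + φ * (2 * C)) := by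
      have : ∀ z, h z * bilinear.density φ z = 2 / 3 * (h z + φ * (2 * (h z * z))) := fun z => by
        simp only [bilinear]; ring
      simp only [this]
      rw [integral_const_mul, integral_add hh ((hhz.const_mul 2).const_mul φ), integral_const_mul,
        integral_const_mul]
    rw [condMean, h1, h2, mul_div_mul_left _ _ (by norm_num)]
  have hne : (1 + θ) ≠ 0 := by linarith [hθ.1]
  have hder : HasDerivAt (fun φ : ℝ => (A + φ * (2 * C)) / (1 + φ))
      ((1 * (2 * C) * (1 + θ) - (A + θ * (2 * C)) * 1) / (1 + θ) ^ 2) θ :=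
    (((hasDerivAt_id θ).mul_const (2 * C)).const_add A).div ((hasDerivAt_id θ).const_add 1) hne
  rw [hnum]
  refine (hder.hasDerivWithinAt.congr heq (heq θ hθ)).congr_deriv ?_
  congr 1
  ring

/-- Stated for any `GX`, `GY` that are means over `[0,1]`, so that it serves both LC1 and, at `θ =
1`, LC2. -/
theorem integral_le_of_partialDerivLE_bilinear {X Y : Auction} {βX βY : ℝ → ℝ≥0∞}
    (hX : IsSymmetricIncreasingEquilibrium bilinear X βX)
    (hY : IsSymmetricIncreasingEquilibrium bilinear Y βY) {θ : ℝ} (hθ : θ ∈ Icc (0 : ℝ) 1)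
    {GX GY : ℝ → ℝ → ℝ≥0∞}
    (hGX : ∀ φ ∈ Icc (0 : ℝ) 1, GX θ φ = bilinear.condLmean 1 (X.transfer βX θ) φ)
    (hGY : ∀ φ ∈ Icc (0 : ℝ) 1, GY θ φ = bilinear.condLmean 1 (Y.transfer βY θ) φ)
    (h : PartialDerivLE GX GY θ) :
    ∫ z in Icc 0 1, (X.transfer βX θ z).toReal * (2 * z - 1)
      ≤ ∫ z in Icc 0 1, (Y.transfer βY θ z).toReal * (2 * z - 1) := by
  have hder : ∀ {Z : Auction} {β : ℝ → ℝ≥0∞} {G : ℝ → ℝ → ℝ≥0∞} {d : ℝ},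
      IsSymmetricIncreasingEquilibrium bilinear Z β →
      (∀ φ ∈ Icc (0 : ℝ) 1, G θ φ = bilinear.condLmean 1 (Z.transfer β θ) φ) →
      HasDerivWithinAt (fun φ => (G θ φ).toReal) d (Icc 0 1) θ →
      d = (∫ z in Icc 0 1, (Z.transfer β θ z).toReal * (2 * z - 1)) / (1 + θ) ^ 2 := by
    intro Z β G d hZ hG hd
    have hm := hZ.aemeasurable_transfer θ le_rfl
    have hf := hZ.lintegral_transfer_ne_top isC1_bilinear hθ le_rfl
    have heq : ∀ φ ∈ Icc (0 : ℝ) 1,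
        (G θ φ).toReal = bilinear.condMean 1 (fun z => (Z.transfer β θ z).toReal) φ := fun φ hφ => by
      rw [hG φ hφ, isC1_bilinear.toReal_condLmean one_pos le_rfl hm hf hφ]
    refine UniqueDiffWithinAt.eq_deriv _ (uniqueDiffOn_Icc one_pos θ hθ) hd ?_
    exact (hasDerivWithinAt_condMean_bilinear (integrable_toReal_of_lintegral_ne_top hm hf) hθ).congr
      heq (heq θ hθ)
  obtain ⟨-, dX, dY, hdX, hdY, hle⟩ := h
  rw [hder hX hGX hdX, hder hY hGY hdY] at hle
  have : 0 < (1 + θ) ^ 2 := by have := hθ.1; positivity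
  exact (div_le_div_iff_of_pos_right this).1 hle

theorem integral_le_of_lc1_bilinear {X Y : Auction} {βX βY : ℝ → ℝ≥0∞}
    (hX : IsSymmetricIncreasingEquilibrium bilinear X βX)
    (hY : IsSymmetricIncreasingEquilibrium bilinear Y βY) {θ : ℝ} (hθ : θ ∈ Icc (0 : ℝ) 1)
    (h : LC1 bilinear (X.transfer βX) (Y.transfer βY)) :
    ∫ z in Icc 0 1, (X.transfer βX θ z).toReal * (2 * z - 1)
      ≤ ∫ z in Icc 0 1, (Y.transfer βY θ z).toReal * (2 * z - 1) :=
  integral_le_of_partialDerivLE_bilinear hX hY hθ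
    (fun _ hφ => isC1_bilinear.expectedPayment_eq_condLmean _ _ hφ)
    (fun _ hφ => isC1_bilinear.expectedPayment_eq_condLmean _ _ hφ) (h θ hθ)

theorem integral_Icc_two_mul_sub_one (x : ℝ) (hx : 0 ≤ x) :
    ∫ z in Icc 0 x, (2 * z - 1) = x ^ 2 - x := by
  rw [integral_Icc_eq_integral_Ioc, ← intervalIntegral.integral_of_le hx,
    intervalIntegral.integral_sub (Continuous.intervalIntegrable (by fun_prop) _ _) (by simp),
    intervalIntegral.integral_const_mul, integral_id]
  simp
  ring

theorem integral_Icc_mul_two_mul_sub_one (x : ℝ) (hx : 0 ≤ x) :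
    ∫ z in Icc 0 x, z * (2 * z - 1) = 2 * x ^ 3 / 3 - x ^ 2 / 2 := by
  have : ∀ z : ℝ, z * (2 * z - 1) = 2 * z ^ 2 - z := fun z => by ring
  simp only [this]
  rw [integral_Icc_eq_integral_Ioc, ← intervalIntegral.integral_of_le hx,
    intervalIntegral.integral_sub (Continuous.intervalIntegrable (by fun_prop) _ _) (by simp),
    intervalIntegral.integral_const_mul, integral_id, integral_pow]
  norm_num
  ring

theorem integral_eq_of_zero_above {g h : ℝ → ℝ} {θ : ℝ} (hθ : θ ∈ Icc (0 : ℝ) 1)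
    (hlt : ∀ z ∈ Ico 0 θ, g z = h z) (hgt : ∀ z ∈ Ioc θ 1, g z = 0) :
    ∫ z in Icc 0 1, g z * (2 * z - 1) = ∫ z in Icc 0 θ, h z * (2 * z - 1) := by
  have hsub : Icc 0 θ ∩ Icc 0 1 = Icc 0 θ := inter_eq_left.2 (Icc_subset_Icc_right hθ.2)
  conv_rhs => rw [← hsub, ← Measure.restrict_restrict measurableSet_Icc,
    ← integral_indicator measurableSet_Icc]
  refine integral_congr_ae ?_
  filter_upwards [self_mem_ae_restrict measurableSet_Icc,
    ae_restrict_of_ae (Measure.ae_ne volume θ)] with z hz hne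
  rcases lt_or_gt_of_ne hne with h' | h'
  · rw [indicator_of_mem (show z ∈ Icc 0 θ from ⟨hz.1, h'.le⟩), hlt z ⟨hz.1, h'⟩]
  · rw [indicator_of_notMem (fun hcon => not_le.2 h' hcon.2), hgt z ⟨h', hz.2⟩, zero_mul]

section Slopes

variable {β : ℝ → ℝ≥0∞}

theorem integral_transfer_allPay (θ : ℝ) :
    ∫ z in Icc 0 1, (Auction.allPay.transfer β θ z).toReal * (2 * z - 1) = 0 := by
  simp only [Auction.transfer, Auction.payment]
  rw [integral_const_mul, integral_Icc_two_mul_sub_one 1 zero_le_one]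
  norm_num

theorem integral_transfer_firstPrice (h : IsSymmetricIncreasingEquilibrium bilinear .firstPrice β)
    {θ : ℝ} (hθ : θ ∈ Icc (0 : ℝ) 1) :
    ∫ z in Icc 0 1, (Auction.firstPrice.transfer β θ z).toReal * (2 * z - 1)
      = (β θ).toReal * (θ ^ 2 - θ) := by
  have hs := h.strictMonoOn_firstPrice isC1_bilinear
  rw [integral_eq_of_zero_above (h := fun _ => (β θ).toReal) hθ, integral_const_mul,
    integral_Icc_two_mul_sub_one θ hθ.1]
  · intro z hz
    rw [Auction.transfer, Auction.payment,
      winShare_of_lt (hs ⟨hz.1, hz.2.le.trans hθ.2⟩ hθ hz.2), mul_one]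
  · intro z hz
    rw [Auction.transfer, Auction.payment,
      winShare_of_gt (hs hθ ⟨hθ.1.trans hz.1.le, hz.2⟩ hz.1), mul_zero, ENNReal.toReal_zero]

theorem integral_transfer_secondPrice (h : IsSymmetricIncreasingEquilibrium bilinear .secondPrice β)
    {θ : ℝ} (hθ : θ ∈ Icc (0 : ℝ) 1) :
    ∫ z in Icc 0 1, (Auction.secondPrice.transfer β θ z).toReal * (2 * z - 1)
      = 2 * θ ^ 3 / 3 - θ ^ 2 / 2 := by
  rw [integral_eq_of_zero_above (h := fun z => z) hθ, integral_Icc_mul_two_mul_sub_one θ hθ.1]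
  · intro z hz
    rw [h.transfer_secondPrice_of_lt isC1_bilinear hθ hz.1 hz.2, ENNReal.toReal_ofReal hz.1]
  · intro z hz
    rw [h.transfer_secondPrice_of_gt isC1_bilinear hθ.1 hz.1 hz.2, ENNReal.toReal_zero]

/-- Subtracting the constant `k = β(1/2)` does not change the integral, as `2z - 1` integrates to
zero. The remainder is negative below `1/2`, where `2z - 1` is negative too, and zero above. -/
theorem integral_transfer_warOfAttrition_pos
    (h : IsSymmetricIncreasingEquilibrium bilinear .warOfAttrition β) :
    0 < ∫ z in Icc 0 1, (Auction.warOfAttrition.transfer β (1 / 2) z).toReal * (2 * z - 1) := by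
  have hs := h.strictMonoOn_warOfAttrition isC1_bilinear
  have hmem : (1 / 2 : ℝ) ∈ Icc (0 : ℝ) 1 := by norm_num
  have hfin : β (1 / 2) ≠ ∞ := h.ne_top_warOfAttrition isC1_bilinear (by norm_num)
  set k := (β (1 / 2)).toReal
  have hint := integrable_toReal_of_lintegral_ne_top (h.aemeasurable_transfer (1 / 2) le_rfl)
    (h.lintegral_transfer_ne_top isC1_bilinear hmem le_rfl)
  have hbdd : ∀ z ∈ Icc (0 : ℝ) 1, ‖2 * z - 1‖ ≤ 1 := fun z hz => by
    rw [Real.norm_eq_abs, abs_le]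
    constructor <;> linarith [hz.1, hz.2]
  have hi1 : IntegrableOn (fun z => (Auction.warOfAttrition.transfer β (1 / 2) z).toReal
      * (2 * z - 1)) (Icc 0 1) := by
    refine Integrable.mul_bdd (c := 1) hint (by fun_prop) ?_
    filter_upwards [self_mem_ae_restrict measurableSet_Icc] with z hz using hbdd z hz
  have hi2 : IntegrableOn (fun z : ℝ => k * (2 * z - 1)) (Icc 0 1) :=
    (Continuous.continuousOn (by fun_prop)).integrableOn_Icc
  have hk : ∫ z in Icc (0 : ℝ) 1, k * (2 * z - 1) = 0 := by
    rw [integral_const_mul, integral_Icc_two_mul_sub_one 1 zero_le_one]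
    norm_num
  refine lt_of_lt_of_eq ?_ ((integral_sub hi1 hi2).trans (by rw [hk, sub_zero]))
  have hlow : ∀ z ∈ Icc (0 : ℝ) 1, z < 1 / 2 →
      (Auction.warOfAttrition.transfer β (1 / 2) z).toReal < k := fun z hz hlt => by
    have := hs hz hmem hlt
    rw [Auction.transfer, Auction.payment, min_eq_right this.le]
    exact (ENNReal.toReal_lt_toReal this.ne_top hfin).2 this
  have hhigh : ∀ z ∈ Icc (0 : ℝ) 1, 1 / 2 ≤ z →
      (Auction.warOfAttrition.transfer β (1 / 2) z).toReal = k := fun z hz hle => by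
    rw [Auction.transfer, Auction.payment, min_eq_left (h.1 hmem hz hle)]
  have hi12 : IntegrableOn (fun z => (Auction.warOfAttrition.transfer β (1 / 2) z).toReal
      * (2 * z - 1) - k * (2 * z - 1)) (Icc 0 1) := hi1.sub hi2
  rw [setIntegral_pos_iff_support_of_nonneg_ae _ hi12]
  · refine lt_of_lt_of_le ?_ (measure_mono (s := Ioo (0 : ℝ) (1 / 2)) fun z hz => ?_)
    · simp
    · have hz' : z ∈ Icc (0 : ℝ) 1 := ⟨hz.1.le, hz.2.le.trans (by norm_num)⟩
      refine ⟨ne_of_gt ?_, hz'⟩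
      have := hlow z hz' hz.2
      have := hz.2
      nlinarith
  · filter_upwards [self_mem_ae_restrict measurableSet_Icc] with z hz
    simp only [Pi.zero_apply]
    rcases lt_or_ge z (1 / 2) with hlt | hge
    · have := hlow z hz hlt
      nlinarith
    · rw [hhigh z hz hge, sub_self]

end Slopes

theorem not_loserPaysNothing_warOfAttrition {β : ℝ → ℝ≥0∞}
    (h : IsSymmetricIncreasingEquilibrium bilinear .warOfAttrition β) :
    ¬ LoserPaysNothing (Auction.warOfAttrition.transfer β) := by
  intro hl
  have hs := h.strictMonoOn_warOfAttrition isC1_bilinear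
  have h1 : (1 / 4 : ℝ) ∈ Icc (0 : ℝ) 1 := by norm_num
  have h2 : (1 / 2 : ℝ) ∈ Icc (0 : ℝ) 1 := by norm_num
  have h3 := hl _ h1 _ h2 (by norm_num)
  rw [Auction.transfer, Auction.payment, min_eq_left (h.1 h1 h2 (by norm_num))] at h3
  have h4 := hs (left_mem_Icc.2 zero_le_one) h1 (by norm_num)
  rw [h3] at h4
  exact absurd h4 not_lt_zero

theorem exists_equilibrium_allPay_bilinear : ∃ β : ℝ → ℝ≥0∞,
    IsSymmetricIncreasingEquilibrium bilinear .allPay β ∧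
      ¬ LoserPaysNothing (Auction.allPay.transfer β) := by
  refine ⟨_, isSymmetricIncreasingEquilibrium_allPay_bilinear, fun hl => ?_⟩
  have h := hl (1 / 4) (by norm_num) (1 / 2) (by norm_num) (by norm_num)
  rw [Auction.transfer, Auction.payment] at h
  refine ne_of_gt ?_ h
  rw [setLIntegral_pos_iff (by fun_prop)]
  refine lt_of_lt_of_le ?_ (measure_mono (s := Ioo (0 : ℝ) (1 / 4)) fun z hz =>
    ⟨?_, Ioo_subset_Icc_self hz⟩)
  · simp
  · have := hz.1
    exact (ENNReal.ofReal_pos.2 (by positivity)).ne'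

end Belief

/-! ### The pairs that satisfy linkage, and the conclusion -/

open Belief

theorem linkageUnderAffiliation_iff {X Y : Auction} (hXY : X ≠ Y) :
    LinkageUnderAffiliation X Y ↔ X.IsRankedPair Y := by
  constructor
  · intro h
    have h := fun βX βY => h bilinear isSymmetric_bilinear isAffiliated_bilinear isC1_bilinear βX βY
    have hI := isSymmetricIncreasingEquilibrium_firstPrice_bilinear
    have hII := isSymmetricIncreasingEquilibrium_secondPrice isC1_bilinear
    obtain ⟨βA, hA, hAl⟩ := exists_equilibrium_allPay_bilinear
    have hW := isSymmetricIncreasingEquilibrium_warOfAttrition_bilinear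
    have hWl := not_loserPaysNothing_warOfAttrition hW
    have half : (1 / 2 : ℝ) ∈ Icc (0 : ℝ) 1 := by norm_num
    have one : (1 : ℝ) ∈ Icc (0 : ℝ) 1 := by norm_num
    have jI := integral_transfer_firstPrice hI half
    have jI1 := integral_transfer_firstPrice hI one
    have jII := integral_transfer_secondPrice hII half
    have jII1 := integral_transfer_secondPrice hII one
    have jA := integral_transfer_allPay (β := βA)
    have jW := integral_transfer_warOfAttrition_pos hW
    have hIpos : 0 < (ENNReal.ofReal (bilinearFirstPriceBid (1 / 2))).toReal := by
      refine ENNReal.toReal_pos (ne_of_gt ?_) ENNReal.ofReal_ne_top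
      exact (zero_le).trans_lt
        (hI.strictMonoOn_firstPrice isC1_bilinear (left_mem_Icc.2 zero_le_one) half (by norm_num))
    by_contra hcon
    cases X <;> cases Y <;> simp [Auction.IsRankedPair] at hXY hcon
    -- At `θ = 1` a win is almost sure, so both versions compare the same means: the integral is
    -- `1/6` for II and `0` for I.
    · rcases h _ _ hII hI with h | h
      · have := integral_le_of_lc1_bilinear hII hI one h
        rw [jII1, jI1] at this
        norm_num at this
      · have := integral_le_of_partialDerivLE_bilinear hII hI one (fun _ _ => rfl) (fun _ _ => rfl)
          (h.2.2 1 (by norm_num))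
        rw [jII1, jI1] at this
        norm_num at this
    -- In all other cases one auction makes losers pay, which excludes LC2. Against LC1: the
    -- integral is zero for A, at `θ = 1/2` negative for I and II and positive for W, and at `θ = 1`
    -- positive for II.
    · rcases h _ _ hII hA with h | h
      · have := integral_le_of_lc1_bilinear hII hA one h
        rw [jII1, jA] at this
        norm_num at this
      · exact hAl h.2.1
    · rcases h _ _ hA hI with h | h
      · have := integral_le_of_lc1_bilinear hA hI half h
        rw [jA, jI] at this
        nlinarith
      · exact hAl h.1
    · rcases h _ _ hA hII with h | h
      · have := integral_le_of_lc1_bilinear hA hII half h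
        rw [jA, jII] at this
        norm_num at this
      · exact hAl h.1
    · rcases h _ _ hW hI with h | h
      · have := integral_le_of_lc1_bilinear hW hI half h
        rw [jI] at this
        nlinarith
      · exact hWl h.1
    · rcases h _ _ hW hII with h | h
      · have := integral_le_of_lc1_bilinear hW hII half h
        rw [jII] at this
        norm_num at this jW
        linarith
      · exact hWl h.1
    · rcases h _ _ hW hA with h | h
      · have := integral_le_of_lc1_bilinear hW hA half h
        rw [jA] at this
        linarith
      · exact hWl h.1
  · rintro (⟨rfl, rfl⟩ | ⟨rfl, rfl⟩ | ⟨rfl, rfl⟩ | ⟨rfl, rfl⟩ | ⟨rfl, rfl⟩)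
    · exact linkageUnderAffiliation_firstPrice_secondPrice
    · exact linkageUnderAffiliation_firstPrice_allPay
    · exact linkageUnderAffiliation_allPay_warOfAttrition
    · exact linkageUnderAffiliation_secondPrice_warOfAttrition
    · exact linkageUnderAffiliation_firstPrice_warOfAttrition

end

theorem proposition3 (X Y : Auction) (hXY : X ≠ Y) :
    (WSCCUnderIID X Y ↔ LinkageUnderAffiliation X Y) ∧
    (WSCCUnderIID X Y ↔
      (X = .firstPrice ∧ Y = .secondPrice) ∨
      (X = .firstPrice ∧ Y = .allPay) ∨
      (X = .allPay ∧ Y = .warOfAttrition) ∨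
      (X = .secondPrice ∧ Y = .warOfAttrition) ∨
      (X = .firstPrice ∧ Y = .warOfAttrition)) :=
  ⟨(wsccUnderIID_iff hXY).trans (linkageUnderAffiliation_iff hXY).symm, wsccUnderIID_iff hXY⟩
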